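/- Let $\Omega=(a,b)\subset\mathbb R$ be a bounded open interval, $n\in(0,3)$, and let $u_{in}\in H^1(\Omega)$ be non-negative. Fix $\varepsilon_0<1$. For every $\varepsilon\in(0,\varepsilon_0]$ let $u^\varepsilon(t,x)\ge 0$ be a weak solution on $(0,\infty)\times\Omega$ of the thin film equation $$|\ln\varepsilon|^{-1}\,\partial_t u+\partial_x\big((\varepsilon^{3-n}u^n+u^3)\,u_{xxx}\big)=0,\qquad u(0,\cdot)=u_{in},$$ with the boundary conditions $(\varepsilon^{3-n}u^n+u^3)u_{xxx}=0$ and $u_x=0$ on $\partial\Omega$. Here $u^\varepsilon(t,\cdot)\in H^1(\Omega)$ for all $t>0$, the derivatives $u_{xx},u_{xxx}$ are weak derivatives on $\{u^\varepsilon>0\}$, and the flux is extended by $0$ to $\{u^\varepsilon=0\}$. The solution is assumed to satisfy, for all $t>0$, conservation of mass $\int_\Omega u^\varepsilon(t)\,dx=\int_\Omega u_{in}\,dx$, the energy inequality $$\int_\Omega\tfrac12|u^\varepsilon_x(t)|^2dx+\int_0^t\!\!\int_{\{u^\varepsilon>0\}}|\ln\varepsilon|\,\big(\varepsilon^{3-n}(u^\varepsilon)^n+(u^\varepsilon)^3\big)|u^\varepsilon_{xxx}|^2dx\,ds\le\int_\Omega\tfrac12|u_{in}'|^2dx,$$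 and the entropy inequality $$\int_\Omega\rho^\varepsilon(t)\,dx\ge\int_0^t\!\!\int_{\{u^\varepsilon>0\}}u^\varepsilon|u^\varepsilon_{xx}|^2dx\,ds+\int_\Omega\rho^\varepsilon(0)\,dx,$$ where $$\rho^\varepsilon(t,x)=B^\varepsilon(u^\varepsilon(t,x)),\qquad B^\varepsilon(s)=\frac{1}{|\ln\varepsilon|}B\Big(\frac s\varepsilon\Big),\qquad B(s)=\int_0^s\int_r^\infty\frac{dv}{v^{n-1}+v^2}\,dr .$$ It is also assumed to have the following regularity for every $T>0$: $u^\varepsilon\in L^2((0,T);H^2(\Omega))$ if $n<2$; $(u^\varepsilon)^{3/2}\in L^2((0,T);H^2(\Omega))$ and $\big((u^\varepsilon)^{3/4}\big)_x\in L^4((0,T)\times\Omega)$ if $n\ge2$. Let $W^{-1,1}(\Omega)$ be the space of distributions $f_0+\partial_xf_1$ with $f_0,f_1\in L^1(\Omega)$, normed by the infimum of $\|f_0\|_{L^1}+\|f_1\|_{L^1}$ over all such representations. Then for every $T>0$: (i) $\rho^\varepsilon$ is bounded in $L^\infty((0,T)\times\Omega)$, uniformly in $\varepsilon\in(0,\varepsilon_0]$;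 (ii) the weak derivative $\partial_t\rho^\varepsilon$ belongs to $L^1((0,T);W^{-1,1}(\Omega))$ and is bounded there, uniformly in $\varepsilon\in(0,\varepsilon_0]$; (iii) for every $p\in[1,\infty)$, the family $\{\rho^\varepsilon\}_{0<\varepsilon\le\varepsilon_0}$ is contained and relatively compact in $L^p((0,T);W^{-1,1}(\Omega))$. -/

import Mathlib

open MeasureTheory Set
open scoped ENNReal NNReal ContDiff

noncomputable section

/-! ### Test functions and weak derivatives on open subsets of the line -/

/-- `φ ∈ C_c^∞(U)`. -/
def IsTestFun (U : Set ℝ) (φ : ℝ → ℝ) : Prop :=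
  ContDiff ℝ ∞ φ ∧ HasCompactSupport φ ∧ tsupport φ ⊆ U

/-- `g` is the weak (distributional) derivative of `f` on the open set `U ⊆ ℝ`, for locally
integrable functions with values in a Banach space `X`. -/
def HasWeakDerivOn {X : Type*} [NormedAddCommGroup X] [NormedSpace ℝ X]
    (U : Set ℝ) (f g : ℝ → X) : Prop :=
  LocallyIntegrableOn f U ∧ LocallyIntegrableOn g U ∧
    ∀ φ : ℝ → ℝ, IsTestFun U φ → ∫ x in U, deriv φ x • f x = -∫ x in U, φ x • g x

/-! ### The space `W^{-1,1}(a,b)` -/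

/-- `L¹(a,b)`. -/
abbrev L1Ioo (a b : ℝ) : Type := Lp ℝ 1 (volume.restrict (Ioo a b))

/-- `L¹(a,b) × L¹(a,b)` with the norm `‖f₀‖₁ + ‖f₁‖₁`. -/
abbrev L1Pair (a b : ℝ) : Type := WithLp 1 (L1Ioo a b × L1Ioo a b)

theorem L1Ioo.integrable_mul {a b : ℝ} (f : L1Ioo a b) {h : ℝ → ℝ} (hc : Continuous h)
    (hs : HasCompactSupport h) : Integrable (fun x => f x * h x) (volume.restrict (Ioo a b)) := by
  obtain ⟨C, hC⟩ := hc.bounded_above_of_compact_support hs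
  exact (L1.integrable_coeFn f).mul_bdd hc.aestronglyMeasurable (Filter.Eventually.of_forall hC)

/-- The continuous functional `f ↦ ∫ f h` on `L¹(a,b)`. -/
theorem L1Ioo.continuous_integral_mul {a b : ℝ} {h : ℝ → ℝ} (hc : Continuous h)
    (hs : HasCompactSupport h) :
    Continuous fun f : L1Ioo a b => ∫ x in Ioo a b, f x * h x := by
  obtain ⟨C, hC⟩ := hc.bounded_above_of_compact_support hs
  have hC0 : 0 ≤ C := (norm_nonneg _).trans (hC 0)
  refine LipschitzWith.continuous (K := C.toNNReal) (LipschitzWith.of_dist_le_mul fun f g => ?_)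
  rw [dist_eq_norm, dist_eq_norm, Real.coe_toNNReal _ hC0,
    ← integral_sub (f.integrable_mul hc hs) (g.integrable_mul hc hs), L1.norm_eq_integral_norm,
    ← integral_const_mul]
  refine norm_integral_le_of_norm_le ((L1.integrable_coeFn (f - g)).norm.const_mul C) ?_
  filter_upwards [Lp.coeFn_sub f g] with x hx
  rw [hx, Pi.sub_apply, ← sub_mul, norm_mul, mul_comm]
  exact mul_le_mul_of_nonneg_right (hC x) (norm_nonneg _)

/-- The pairs `(f₀, f₁) ∈ L¹ × L¹` for which the distribution `f₀ + ∂ₓ f₁` on `(a,b)` vanishes. -/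
def Wm11Null (a b : ℝ) : Submodule ℝ (L1Pair a b) where
  carrier := {F | ∀ φ : ℝ → ℝ, IsTestFun (Ioo a b) φ →
    (∫ x in Ioo a b, F.fst x * φ x) - ∫ x in Ioo a b, F.snd x * deriv φ x = 0}
  zero_mem' := by
    intro φ _
    have h0 : ⇑(0 : L1Ioo a b) =ᵐ[volume.restrict (Ioo a b)] (0 : ℝ → ℝ) := Lp.coeFn_zero ..
    have h (k : ℝ → ℝ) : ∫ x in Ioo a b, (0 : L1Ioo a b) x * k x = 0 := by
      refine integral_eq_zero_of_ae ?_
      filter_upwards [h0] with x hx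
      rw [hx, Pi.zero_apply, zero_mul]
    rw [WithLp.zero_fst, WithLp.zero_snd, h, h, sub_zero]
  add_mem' := by
    intro F G hF hG φ hφ
    have hc := hφ.1.continuous
    have hc' := hφ.1.continuous_deriv (by simp)
    have h (f g : L1Ioo a b) {k : ℝ → ℝ} (hk : Continuous k) (hs : HasCompactSupport k) :
        ∫ x in Ioo a b, (f + g) x * k x
          = (∫ x in Ioo a b, f x * k x) + ∫ x in Ioo a b, g x * k x := by
      rw [← integral_add (f.integrable_mul hk hs) (g.integrable_mul hk hs)]
      refine integral_congr_ae ?_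
      filter_upwards [Lp.coeFn_add f g] with x hx
      rw [hx, Pi.add_apply, add_mul]
    have h1 := hF φ hφ
    have h2 := hG φ hφ
    rw [WithLp.add_fst, WithLp.add_snd, h _ _ hc hφ.2.1, h _ _ hc' hφ.2.1.deriv]
    linarith
  smul_mem' := by
    intro c F hF φ hφ
    have h (f : L1Ioo a b) (k : ℝ → ℝ) :
        ∫ x in Ioo a b, (c • f) x * k x = c * ∫ x in Ioo a b, f x * k x := by
      rw [← integral_const_mul]
      refine integral_congr_ae ?_
      filter_upwards [Lp.coeFn_smul c f] with x hx
      rw [hx, Pi.smul_apply, smul_eq_mul, mul_assoc]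
    have h1 := hF φ hφ
    rw [WithLp.smul_fst, WithLp.smul_snd, h, h, ← mul_sub, h1, mul_zero]

instance Wm11Null.isClosed (a b : ℝ) : IsClosed (Wm11Null a b : Set (L1Pair a b)) := by
  have : (Wm11Null a b : Set (L1Pair a b)) = ⋂ φ : {φ : ℝ → ℝ // IsTestFun (Ioo a b) φ},
      {F | (∫ x in Ioo a b, F.fst x * φ.1 x) - ∫ x in Ioo a b, F.snd x * deriv φ.1 x = 0} := by
    ext F
    simp [Wm11Null]
  rw [this]
  refine isClosed_iInter fun φ => isClosed_eq (Continuous.sub ?_ ?_) continuous_const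
  · exact (L1Ioo.continuous_integral_mul φ.2.1.continuous φ.2.2.1).comp
      (WithLp.prod_continuous_ofLp 1 _ _).fst
  · exact (L1Ioo.continuous_integral_mul (φ.2.1.continuous_deriv (by simp)) φ.2.2.1.deriv).comp
      (WithLp.prod_continuous_ofLp 1 _ _).snd

/-- `W^{-1,1}(a,b)`: the distributions `f₀ + ∂ₓ f₁` with `f₀, f₁ ∈ L¹(a,b)`, with the norm
`inf (‖f₀‖₁ + ‖f₁‖₁)` over all such representations. -/
abbrev Wm11 (a b : ℝ) : Type := L1Pair a b ⧸ Wm11Null a b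

open Classical in
/-- The embedding `L¹(a,b) → W^{-1,1}(a,b)`, `f ↦ f + ∂ₓ 0`, on functions (`0` for functions that
are not integrable on `(a,b)`). -/
def toWm11 (a b : ℝ) (f : ℝ → ℝ) : Wm11 a b :=
  if h : MemLp f 1 (volume.restrict (Ioo a b)) then
    Submodule.Quotient.mk (WithLp.toLp 1 (h.toLp f, 0))
  else 0

/-! ### The functions `B`, `B^ε` and `ρ^ε` -/

/-- `B(s) = ∫_0^s ∫_r^∞ dv / (v^{n-1} + v^2) dr`. -/
def Bfun (n s : ℝ) : ℝ := ∫ r in (0 : ℝ)..s, ∫ v in Ioi r, 1 / (v ^ (n - 1) + v ^ 2)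

/-- `B^ε(s) = B(s/ε) / |ln ε|`. -/
def Beps (n ε s : ℝ) : ℝ := |Real.log ε|⁻¹ * Bfun n (s / ε)

/-- `ρ^ε(t,x) = B^ε(u(t,x))`. -/
def rhoEps (n ε : ℝ) (u : ℝ → ℝ → ℝ) (t x : ℝ) : ℝ := Beps n ε (u t x)

/-! ### Solutions of the thin film equation -/

/-- The mobility `ε^{3-n} u^n + u^3`. -/
def mobility (n ε s : ℝ) : ℝ := ε ^ (3 - n) * s ^ n + s ^ 3

/-- The positivity set `{w > 0}` in `(a,b)`. -/
def posSet (a b : ℝ) (w : ℝ → ℝ) : Set ℝ := {x ∈ Ioo a b | 0 < w x}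

/-- `w ∈ L^p((0,T) × (a,b))`, `w` being a function of `(t,x)`. -/
def MemLpSpaceTime (a b T : ℝ) (p : ℝ≥0∞) (w : ℝ → ℝ → ℝ) : Prop :=
  MemLp (fun z : ℝ × ℝ => w z.1 z.2) p (volume.restrict (Ioo 0 T ×ˢ Ioo a b))

/-- `w ∈ L^2((0,T); H^2(a,b))`. -/
def MemL2H2 (a b T : ℝ) (w : ℝ → ℝ → ℝ) : Prop :=
  ∃ w₁ w₂ : ℝ → ℝ → ℝ,
    (∀ᵐ t ∂volume.restrict (Ioo 0 T),
      HasWeakDerivOn (Ioo a b) (w t) (w₁ t) ∧ HasWeakDerivOn (Ioo a b) (w₁ t) (w₂ t)) ∧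
    MemLpSpaceTime a b T 2 w ∧ MemLpSpaceTime a b T 2 w₁ ∧ MemLpSpaceTime a b T 2 w₂

/-- `w_x ∈ L^4((0,T) × (a,b))`. -/
def DerivMemL4 (a b T : ℝ) (w : ℝ → ℝ → ℝ) : Prop :=
  ∃ w₁ : ℝ → ℝ → ℝ,
    (∀ᵐ t ∂volume.restrict (Ioo 0 T), HasWeakDerivOn (Ioo a b) (w t) (w₁ t)) ∧
    MemLpSpaceTime a b T 4 w₁

/-- `u` is a non-negative weak solution on `(0,∞) × (a,b)` of
`|ln ε|⁻¹ u_t + ((ε^{3-n} u^n + u^3) u_xxx)_x = 0` with zero flux and `u_x = 0` at the endpoints and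
with `u(0,·) = u_in`, that has constant mass and satisfies the energy and entropy inequalities.
Here `ux` is the weak derivative of `u` in `x`, and `uxx`, `uxxx` are the second and third weak
derivatives on `{u > 0}`; `uin'` is the weak derivative of `uin`. -/
structure IsThinFilmSolutionWith (a b n ε : ℝ) (uin uin' : ℝ → ℝ)
    (u ux uxx uxxx : ℝ → ℝ → ℝ) : Prop where
  measurable_u : AEStronglyMeasurable (fun z : ℝ × ℝ => u z.1 z.2)
    (volume.restrict (Ioi 0 ×ˢ Ioo a b))
  measurable_ux : AEStronglyMeasurable (fun z : ℝ × ℝ => ux z.1 z.2)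
    (volume.restrict (Ioi 0 ×ˢ Ioo a b))
  measurable_uxx : AEStronglyMeasurable (fun z : ℝ × ℝ => uxx z.1 z.2)
    (volume.restrict (Ioi 0 ×ˢ Ioo a b))
  measurable_uxxx : AEStronglyMeasurable (fun z : ℝ × ℝ => uxxx z.1 z.2)
    (volume.restrict (Ioi 0 ×ˢ Ioo a b))
  /-- `u(t,·)` is the continuous representative on `[a,b]` of an `H¹` function. -/
  continuousOn : ∀ t, 0 ≤ t → ContinuousOn (u t) (Icc a b)
  nonneg : ∀ t, 0 ≤ t → ∀ x ∈ Icc a b, 0 ≤ u t x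
  initial : ∀ x ∈ Icc a b, u 0 x = uin x
  weakDeriv_ux : ∀ t, 0 < t → HasWeakDerivOn (Ioo a b) (u t) (ux t)
  memLp_ux : ∀ t, 0 < t → MemLp (ux t) 2 (volume.restrict (Ioo a b))
  weakDeriv_uxx : ∀ᵐ t ∂volume.restrict (Ioi 0), HasWeakDerivOn (posSet a b (u t)) (ux t) (uxx t)
  weakDeriv_uxxx : ∀ᵐ t ∂volume.restrict (Ioi 0),
    HasWeakDerivOn (posSet a b (u t)) (uxx t) (uxxx t)
  /-- The equation in weak form; test functions on `[0,∞) × [a,b]` encode the zero flux and the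
  initial condition. -/
  weak_equation : ∀ ψ : ℝ → ℝ → ℝ, ContDiff ℝ ∞ (fun z : ℝ × ℝ => ψ z.1 z.2) →
    HasCompactSupport (fun z : ℝ × ℝ => ψ z.1 z.2) →
    |Real.log ε|⁻¹ * ((∫ t in Ioi (0 : ℝ), ∫ x in Ioo a b, u t x * deriv (fun s => ψ s x) t)
        + ∫ x in Ioo a b, uin x * ψ 0 x)
      + (∫ t in Ioi (0 : ℝ), ∫ x in posSet a b (u t),
          mobility n ε (u t x) * uxxx t x * deriv (ψ t) x) = 0
  /-- The boundary condition `u_x = 0`. -/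
  neumann : ∀ᵐ t ∂volume.restrict (Ioi 0),
    HasDerivWithinAt (u t) 0 (Icc a b) a ∧ HasDerivWithinAt (u t) 0 (Icc a b) b
  mass : ∀ t, 0 < t → ∫ x in Ioo a b, u t x = ∫ x in Ioo a b, uin x
  energy : ∀ t, 0 < t →
    (∫⁻ x in Ioo a b, ENNReal.ofReal (ux t x ^ 2 / 2))
      + (∫⁻ s in Ioo 0 t, ∫⁻ x in posSet a b (u s),
          ENNReal.ofReal (|Real.log ε| * mobility n ε (u s x) * uxxx s x ^ 2))
      ≤ ∫⁻ x in Ioo a b, ENNReal.ofReal (uin' x ^ 2 / 2)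
  entropy : ∀ t, 0 < t →
    (∫⁻ s in Ioo 0 t, ∫⁻ x in posSet a b (u s), ENNReal.ofReal (u s x * uxx s x ^ 2))
      + (∫⁻ x in Ioo a b, ENNReal.ofReal (rhoEps n ε u 0 x))
      ≤ ∫⁻ x in Ioo a b, ENNReal.ofReal (rhoEps n ε u t x)
  regularity_lt_two : n < 2 → ∀ T, 0 < T → MemL2H2 a b T u
  regularity_ge_two : 2 ≤ n → ∀ T, 0 < T →
    MemL2H2 a b T (fun t x => u t x ^ (3 / 2 : ℝ)) ∧
    DerivMemL4 a b T (fun t x => u t x ^ (3 / 4 : ℝ))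

/-- `u` is a weak solution, in the class above, for some choice of weak derivatives. -/
def IsThinFilmSolution (a b n ε : ℝ) (uin uin' : ℝ → ℝ) (u : ℝ → ℝ → ℝ) : Prop :=
  ∃ ux uxx uxxx : ℝ → ℝ → ℝ, IsThinFilmSolutionWith a b n ε uin uin' u ux uxx uxxx

end

/-! Write m for the mobility, J = |ln ε| m(u) u_xxx, and b for the derivative of B^ε, so that the
equation reads u_t = -J_x. Conservation of mass and the energy bound give u ≤ M with M independent
of ε (`le_bound`). Since B grows at most logarithmically, B^ε(u) ≤ |ln ε|⁻¹ (B(1) + ln(1+M)) + 1,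
which stays bounded for ε ≤ ε₀ < 1 (`Beps_le`). The entropy inequality at time T then bounds ∬ u
u_xx² (`integrable_rhoSource`).

The entropy is built so that |ln ε| m(s) b'(s) = -s (`hasDerivAt_beps`). Formally, therefore, ρ_t =
-b(u) J_x = -(b(u) J)_x - u u_x u_xxx, and two further integrations by parts give ρ_t = u u_xx² -
(b(u) J + u u_x u_xx - u_x³/3)_x. All terms are bounded in L¹ of space-time uniformly in ε. For b(u)
J, Young's inequality pairs the dissipation with |ln ε| b² m ≤ C |ln ε|⁻¹ (1+u)
(`integrable_drive`). For u u_x u_xx, it pairs u u_xx² with the energy (`integrable_mixed`). For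
u_x³, the Neumann condition allows (u u_x|u_x|)_x = |u_x|³ + 2u|u_x|u_xx to be integrated over the
interval without boundary terms (`slice_lintegral_abs_cube_le`, `integrable_cube`). This gives the
estimate for the time derivative.

To justify the identity, the chain rule is first proved for C² functions of u by mollifying in
space-time (`chain_rule_of_weak`). B^ε is not C² at 0, so it is replaced by `betaApprox`, whose
second derivative is cut off for u ≤ δ; the spatial integration by parts then takes place on compact
subsets of {u > 0} (`weak_betaApprox`). As δ → 0 every term is dominated by one of the bounds above,
except the one with u_x² u_xx. The assumed regularity is needed exactly there. If n < 2, then u_x ∈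
L^∞L² ∩ L²L^∞ ⊆ L⁴ and u_xx ∈ L². If n ≥ 2, then u_x⁴/u is a multiple of |(u^{3/4})_x|⁴ and is
paired with u u_xx². In both cases u_x² u_xx is integrable and equals (u_x³/3)_x, which yields
`weak_rhoEps`. Testing with products θ(t)φ(x) turns it into a weak derivative with values in
W^{-1,1} (`exists_hasWeakDerivOn_toWm11`).

Compactness is an Aubin–Lions argument in a direct form. The functions ρ^ε(t) lie in the image of a
ball of L^∞, which is totally bounded in W^{-1,1}, and their variation in time is uniformly bounded.
Such functions are close in L¹ in time to step functions on a fine partition with values in a finite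
net, and the uniform bound upgrades L¹ to L^p (`totallyBounded_of_variation_le`). The same lemma,
applied in x to primitives, shows that the ball is totally bounded in W^{-1,1}
(`totallyBounded_toWm11`). -/

open Filter Topology
open scoped Convolution

noncomputable section

section

/-! ### Mollifiers -/

/-- A sequence of bump functions at the origin whose supports shrink to a point. -/
def mollBump (E : Type*) [NormedAddCommGroup E] (k : ℕ) : ContDiffBump (0 : E) :=
  ⟨1 / (k + 1), 2 / (k + 1), by positivity, by gcongr; norm_num⟩

theorem mollBump_rOut (E : Type*) [NormedAddCommGroup E] (k : ℕ) :
    (mollBump E k).rOut = 2 / (k + 1) := rfl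

theorem tendsto_mollBump_rOut (E : Type*) [NormedAddCommGroup E] :
    Tendsto (fun k => (mollBump E k).rOut) atTop (𝓝 0) := by
  have := (tendsto_one_div_add_atTop_nhds_zero_nat (𝕜 := ℝ)).const_mul 2
  simpa [mollBump_rOut, mul_one_div, div_eq_mul_inv] using this

/-- A bounded ratio of the radii is what Lebesgue differentiation requires for convergence of the
mollifications almost everywhere. -/
theorem mollBump_rOut_le (E : Type*) [NormedAddCommGroup E] (k : ℕ) :
    (mollBump E k).rOut ≤ 2 * (mollBump E k).rIn := by
  simp [mollBump, div_eq_mul_inv]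

/-! ### Weak derivatives on the line -/

section WeakDeriv

variable {X : Type*} [NormedAddCommGroup X] [NormedSpace ℝ X]

theorem IsTestFun.mono {U V : Set ℝ} {φ : ℝ → ℝ} (h : IsTestFun V φ) (hVU : V ⊆ U) :
    IsTestFun U φ := ⟨h.1, h.2.1, h.2.2.trans hVU⟩

theorem IsTestFun.continuous {U : Set ℝ} {φ : ℝ → ℝ} (h : IsTestFun U φ) : Continuous φ :=
  h.1.continuous

theorem IsTestFun.continuous_deriv {U : Set ℝ} {φ : ℝ → ℝ} (h : IsTestFun U φ) :
    Continuous (deriv φ) := h.1.continuous_deriv (by simp)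

theorem IsTestFun.eq_zero {U : Set ℝ} {φ : ℝ → ℝ} (h : IsTestFun U φ) {x : ℝ} (hx : x ∉ U) :
    φ x = 0 := image_eq_zero_of_notMem_tsupport fun hx' => hx (h.2.2 hx')

theorem IsTestFun.deriv_eq_zero {U : Set ℝ} {φ : ℝ → ℝ} (h : IsTestFun U φ) {x : ℝ} (hx : x ∉ U) :
    deriv φ x = 0 :=
  image_eq_zero_of_notMem_tsupport fun hx' => hx (h.2.2 (tsupport_deriv_subset hx'))

theorem IsTestFun.differentiable {U : Set ℝ} {φ : ℝ → ℝ} (h : IsTestFun U φ) :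
    Differentiable ℝ φ := h.1.differentiable (by simp)

theorem setIntegral_eq_integral_of_eq_zero {U : Set ℝ} {f : ℝ → X}
    (hf : ∀ x, x ∉ U → f x = 0) : ∫ x in U, f x = ∫ x, f x :=
  setIntegral_eq_integral_of_forall_compl_eq_zero hf

/-- The integrands vanish off the support of the test function, so all integrals may be taken over ℝ
and shrinking the set only shrinks the class of test functions. -/
theorem HasWeakDerivOn.mono {U V : Set ℝ} {f g : ℝ → X} (h : HasWeakDerivOn U f g)
    (hVU : V ⊆ U) : HasWeakDerivOn V f g := by
  refine ⟨h.1.mono_set hVU, h.2.1.mono_set hVU, fun φ hφ => ?_⟩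
  have := h.2.2 φ (hφ.mono hVU)
  have key (W : Set ℝ) (hW : IsTestFun W φ) : (∫ x in W, deriv φ x • f x = ∫ x, deriv φ x • f x) ∧
      ∫ x in W, φ x • g x = ∫ x, φ x • g x :=
    ⟨setIntegral_eq_integral_of_eq_zero fun x hx => by simp [hW.deriv_eq_zero hx],
      setIntegral_eq_integral_of_eq_zero fun x hx => by simp [hW.eq_zero hx]⟩
  rw [(key U (hφ.mono hVU)).1, (key U (hφ.mono hVU)).2] at this
  rw [(key V hφ).1, (key V hφ).2, this]

/-- A smooth approximation of the indicator of `[s, t]`. -/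
def smoothIcc (κ : ℝ → ℝ) (s t x : ℝ) : ℝ := ∫ y in (x - t)..(x - s), κ y

theorem hasDerivAt_smoothIcc {κ : ℝ → ℝ} (hκ : Continuous κ) (s t x : ℝ) :
    HasDerivAt (smoothIcc κ s t) (κ (x - s) - κ (x - t)) x := by
  have h : smoothIcc κ s t = fun x => (∫ y in (0 : ℝ)..(x - s), κ y) - ∫ y in (0 : ℝ)..(x - t), κ y := by
    funext x
    rw [smoothIcc, intervalIntegral.integral_interval_sub_left] <;>
      exact hκ.intervalIntegrable _ _
  rw [h]
  have h1 (c : ℝ) : HasDerivAt (fun x => ∫ y in (0 : ℝ)..(x - c), κ y) (κ (x - c)) x := by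
    have := (hκ.integral_hasStrictDerivAt 0 (x - c)).hasDerivAt.comp x ((hasDerivAt_id x).sub_const c)
    simpa [Function.comp_def] using this
  exact (h1 s).sub (h1 t)

theorem contDiff_smoothIcc {κ : ℝ → ℝ} (hκ : ContDiff ℝ ∞ κ) (s t : ℝ) :
    ContDiff ℝ ∞ (smoothIcc κ s t) := by
  rw [contDiff_infty_iff_deriv]
  refine ⟨fun x => (hasDerivAt_smoothIcc hκ.continuous s t x).differentiableAt, ?_⟩
  rw [funext fun x => (hasDerivAt_smoothIcc hκ.continuous s t x).deriv]
  fun_prop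

theorem smoothIcc_eq_zero {κ : ℝ → ℝ} {r s t x : ℝ} (hκ : ∀ y, r ≤ |y| → κ y = 0) (hst : s ≤ t)
    (hx : x ≤ s - r ∨ t + r ≤ x) : smoothIcc κ s t x = 0 := by
  refine intervalIntegral.integral_zero_ae (Eventually.of_forall fun y hy => hκ y ?_)
  rw [uIoc_of_le (by linarith)] at hy
  rcases hx with hx | hx
  · exact le_abs.2 (Or.inr (by linarith [hy.2]))
  · exact le_abs.2 (Or.inl (by linarith [hy.1]))

theorem smoothIcc_eq_one {κ : ℝ → ℝ} {r s t x : ℝ} (hκ : ∀ y, r ≤ |y| → κ y = 0)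
    (hκ1 : ∫ y, κ y = 1) (hx : s + r ≤ x ∧ x ≤ t - r) (hst : s ≤ t) : smoothIcc κ s t x = 1 := by
  rw [smoothIcc, intervalIntegral.integral_of_le (by linarith), ← hκ1]
  refine setIntegral_eq_integral_of_forall_compl_eq_zero fun y hy => ?_
  by_contra h
  have h' : |y| < r := not_le.1 fun h' => h (hκ y h')
  rw [abs_lt] at h'
  exact hy ⟨by linarith, by linarith⟩

theorem norm_smoothIcc_le {κ : ℝ → ℝ} (hκ0 : ∀ y, 0 ≤ κ y) (hκi : Integrable κ)
    (hκ1 : ∫ y, κ y = 1) {s t : ℝ} (hst : s ≤ t) (x : ℝ) : ‖smoothIcc κ s t x‖ ≤ 1 := by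
  rw [smoothIcc, intervalIntegral.integral_of_le (by linarith), ← hκ1, Real.norm_of_nonneg
    (setIntegral_nonneg measurableSet_Ioc fun y _ => hκ0 y)]
  exact setIntegral_le_integral hκi (Eventually.of_forall hκ0)

theorem exists_rat_Icc_subset {U : Set ℝ} (hU : IsOpen U) {s t : ℝ} (hst : s ≤ t)
    (h : Icc s t ⊆ U) : ∃ p q : ℚ, (p : ℝ) < s ∧ t < q ∧ Icc (p : ℝ) q ⊆ U := by
  obtain ⟨r, hr, hrs⟩ := Metric.isOpen_iff.1 hU s (h ⟨le_rfl, hst⟩)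
  obtain ⟨r', hr', hrt⟩ := Metric.isOpen_iff.1 hU t (h ⟨hst, le_rfl⟩)
  obtain ⟨p, hp, hps⟩ := exists_rat_btwn (show s - r < s by linarith)
  obtain ⟨q, hq, hqt⟩ := exists_rat_btwn (show t < t + r' by linarith)
  refine ⟨p, q, hps, hq, fun x hx => ?_⟩
  rcases lt_or_ge x s with h1 | h1
  · exact hrs (by rw [Real.ball_eq_Ioo]; exact ⟨by linarith [hx.1], by linarith⟩)
  rcases le_or_gt x t with h2 | h2
  · exact h ⟨h1, h2⟩
  · exact hrt (by rw [Real.ball_eq_Ioo]; exact ⟨by linarith, by linarith [hx.2]⟩)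

/-- Outside a null set, a function is recovered by integrating its weak derivative. -/
theorem HasWeakDerivOn.exists_sub_eq_integral [CompleteSpace X] {U : Set ℝ} (hU : IsOpen U)
    {f g : ℝ → X} (h : HasWeakDerivOn U f g) :
    ∃ N : Set ℝ, (∀ᵐ x, x ∈ N) ∧
      ∀ s ∈ N, ∀ t ∈ N, s ≤ t → Icc s t ⊆ U → f t - f s = ∫ r in s..t, g r := by
  set κ : ℕ → ℝ → ℝ := fun k => (mollBump ℝ k).normed volume with hκ
  set F : ℚ → ℚ → ℝ → X := fun p q => (Ioo (p : ℝ) q).indicator f with hF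
  have hFi (p q : ℚ) (hpq : Icc (p : ℝ) q ⊆ U) : Integrable (F p q) := by
    rw [hF, integrable_indicator_iff measurableSet_Ioo]
    exact (h.1.integrableOn_compact_subset hpq isCompact_Icc).mono_set Ioo_subset_Icc_self
  -- `f` is only locally integrable on `U`, so it is truncated to intervals compactly contained in
  -- `U` before mollifying. Rational endpoints suffice, and countably many exceptional null sets
  -- leave one good set of full measure.
  refine ⟨{x | ∀ p q : ℚ, Icc (p : ℝ) q ⊆ U →
    Tendsto (fun k => (κ k ⋆[ContinuousLinearMap.lsmul ℝ ℝ, volume] F p q) x) atTop (𝓝 (F p q x))},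
    ?_, ?_⟩
  · simp only [mem_ofPred_eq]
    rw [ae_all_iff]; intro p
    rw [ae_all_iff]; intro q
    by_cases hpq : Icc (p : ℝ) q ⊆ U
    · filter_upwards [ContDiffBump.ae_convolution_tendsto_right_of_locallyIntegrable
        (tendsto_mollBump_rOut ℝ) (Eventually.of_forall (mollBump_rOut_le ℝ))
        (hFi p q hpq).locallyIntegrable] with x hx _
      exact hx
    · exact Eventually.of_forall fun x hx => absurd hx hpq
  intro s hs t ht hst hstU
  obtain ⟨p, q, hps, hqt, hpq⟩ := exists_rat_Icc_subset hU hst hstU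
  have hz (k : ℕ) (y : ℝ) (hy : 2 / ((k : ℝ) + 1) ≤ |y|) : κ k y = 0 := by
    have : y ∉ Function.support (κ k) := by
      rw [hκ, ContDiffBump.support_normed_eq, mollBump_rOut]
      simpa using hy
    simpa using this
  have hconv (k : ℕ) (c : ℝ) : (κ k ⋆[ContinuousLinearMap.lsmul ℝ ℝ, volume] F p q) c
      = ∫ x, κ k (x - c) • F p q x := by
    rw [convolution_lsmul_swap]
    congr 1; funext x
    rw [← neg_sub, hκ]
    simp only [ContDiffBump.normed_neg]
  have hκc (k : ℕ) : Continuous (κ k) := (mollBump ℝ k).continuous_normed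
  have hint (k : ℕ) (c : ℝ) : Integrable fun x => κ k (x - c) • F p q x := by
    obtain ⟨C, hC⟩ := (mollBump ℝ k).hasCompactSupport_normed.exists_bound_of_continuous (hκc k)
    exact (hFi p q hpq).bdd_smul C
      ((hκc k).comp (continuous_id.sub continuous_const)).aestronglyMeasurable
      (Eventually.of_forall fun x => hC _)
  -- The smoothed indicator of `[s, t]` has derivative κ(x-s) - κ(x-t), so testing `f` with it
  -- evaluates mollifications of `f` at the two good points.
  have hlim1 : Tendsto (fun k => ∫ x, deriv (smoothIcc (κ k) s t) x • F p q x) atTop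
      (𝓝 (f s - f t)) := by
    have e (k : ℕ) : ∫ x, deriv (smoothIcc (κ k) s t) x • F p q x
        = (κ k ⋆[ContinuousLinearMap.lsmul ℝ ℝ, volume] F p q) s
          - (κ k ⋆[ContinuousLinearMap.lsmul ℝ ℝ, volume] F p q) t := by
      rw [hconv, hconv, ← integral_sub (hint k s) (hint k t)]
      congr 1; funext x
      rw [(hasDerivAt_smoothIcc (hκc k) s t x).deriv, sub_smul]
    simp_rw [e]
    have hsI : s ∈ Ioo (p : ℝ) q := ⟨hps, by linarith⟩
    have htI : t ∈ Ioo (p : ℝ) q := ⟨by linarith, hqt⟩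
    have hsF : F p q s = f s := indicator_of_mem hsI f
    have htF : F p q t = f t := indicator_of_mem htI f
    rw [← hsF, ← htF]
    exact (hs p q hpq).sub (ht p q hpq)
  have hgi : IntegrableOn g (Ioo (p : ℝ) q) :=
    (h.2.1.integrableOn_compact_subset hpq isCompact_Icc).mono_set Ioo_subset_Icc_self
  have hlim2 : Tendsto (fun k => ∫ x in Ioo (p : ℝ) q, smoothIcc (κ k) s t x • g x) atTop
      (𝓝 (∫ x in Ioo (p : ℝ) q, (Ioc s t).indicator g x)) := by
    refine tendsto_integral_of_dominated_convergence (fun x => ‖g x‖) (fun k => ?_) hgi.norm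
      (fun k => Eventually.of_forall fun x => ?_) ?_
    · exact ((contDiff_smoothIcc (mollBump ℝ k).contDiff_normed s
        t).continuous.aestronglyMeasurable).smul hgi.aestronglyMeasurable
    · rw [norm_smul]
      exact mul_le_of_le_one_left (norm_nonneg _) (norm_smoothIcc_le
        (mollBump ℝ k).nonneg_normed (mollBump ℝ k).integrable_normed
        (mollBump ℝ k).integral_normed hst x)
    · have hne (c : ℝ) : ∀ᵐ x ∂volume.restrict (Ioo (p : ℝ) q), x ≠ c :=
        ae_restrict_of_ae (by simp [ae_iff])
      filter_upwards [hne s, hne t] with x hxs hxt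
      have hsm (d : ℝ) (hd : 0 < d) : ∀ᶠ k : ℕ in atTop, 2 / ((k : ℝ) + 1) < d :=
        (tendsto_mollBump_rOut ℝ).eventually_lt_const hd
      by_cases hx : x ∈ Ioc s t
      · rw [indicator_of_mem hx]
        have h1 : 0 < x - s := sub_pos.2 hx.1
        have h2 : 0 < t - x := sub_pos.2 (lt_of_le_of_ne hx.2 hxt)
        refine tendsto_const_nhds.congr' ?_
        filter_upwards [hsm _ h1, hsm _ h2] with k hk1 hk2
        rw [smoothIcc_eq_one (hz k) (mollBump ℝ k).integral_normed
          ⟨by linarith, by linarith⟩ hst, one_smul]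
      · rw [indicator_of_notMem hx]
        rw [mem_Ioc, not_and_or, not_lt, not_le] at hx
        refine tendsto_const_nhds.congr' ?_
        rcases hx with hx | hx
        · filter_upwards [hsm (s - x) (sub_pos.2 (lt_of_le_of_ne hx hxs))] with k hk
          rw [smoothIcc_eq_zero (hz k) hst (Or.inl (by linarith)), zero_smul]
        · filter_upwards [hsm (x - t) (sub_pos.2 hx)] with k hk
          rw [smoothIcc_eq_zero (hz k) hst (Or.inr (by linarith)), zero_smul]
  -- For large `k` the smoothed indicator is supported inside `(p, q)` and becomes an admissible
  -- test function.
  have heq : ∀ᶠ k in atTop, ∫ x in Ioo (p : ℝ) q, smoothIcc (κ k) s t x • g x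
      = -∫ x, deriv (smoothIcc (κ k) s t) x • F p q x := by
    have hsm (d : ℝ) (hd : 0 < d) : ∀ᶠ k : ℕ in atTop, 2 / ((k : ℝ) + 1) < d :=
      (tendsto_mollBump_rOut ℝ).eventually_lt_const hd
    filter_upwards [hsm _ (sub_pos.2 hps), hsm _ (sub_pos.2 hqt)] with k hk1 hk2
    have hts : tsupport (smoothIcc (κ k) s t)
        ⊆ Icc (s - 2 / ((k : ℝ) + 1)) (t + 2 / ((k : ℝ) + 1)) := by
      refine closure_minimal (fun x hx => ?_) isClosed_Icc
      by_contra hx'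
      rw [mem_Icc, not_and_or, not_le, not_le] at hx'
      exact hx (smoothIcc_eq_zero (hz k) hst (hx'.imp le_of_lt le_of_lt))
    have htest : IsTestFun (Ioo (p : ℝ) q) (smoothIcc (κ k) s t) :=
      ⟨contDiff_smoothIcc (mollBump ℝ k).contDiff_normed s t,
        isCompact_Icc.of_isClosed_subset (isClosed_tsupport _) hts,
        hts.trans fun x hx => ⟨by linarith [hx.1], by linarith [hx.2]⟩⟩
    have := (h.mono (Ioo_subset_Icc_self.trans hpq)).2.2 _ htest
    rw [← neg_eq_iff_eq_neg, ← this, ← integral_indicator measurableSet_Ioo]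
    congr 1; funext x
    simp only [hF, indicator_apply]
    split_ifs <;> simp
  have h3 := tendsto_nhds_unique (hlim2.congr' heq) hlim1.neg
  rw [neg_sub] at h3
  rw [← h3, setIntegral_indicator measurableSet_Ioc, intervalIntegral.integral_of_le hst,
    inter_eq_self_of_subset_right]
  exact fun x hx => ⟨by linarith [hx.1], by linarith [hx.2]⟩

end WeakDeriv

end

/-! ### Representatives, uniqueness and C¹ test functions for weak derivatives -/

section

theorem intervalIntegrable_of_uIcc_subset {X : Type*} [NormedAddCommGroup X]
    {U : Set ℝ} {g : ℝ → X} (hg : LocallyIntegrableOn g U)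
    {s t : ℝ} (h : uIcc s t ⊆ U) : IntervalIntegrable g volume s t :=
  (hg.integrableOn_compact_subset h isCompact_uIcc).intervalIntegrable

section WeakDeriv

variable {X : Type*} [NormedAddCommGroup X] [NormedSpace ℝ X]

/-- A function with a weak derivative has a representative given by integrating the derivative. -/
theorem HasWeakDerivOn.exists_representative [CompleteSpace X] {U : Set ℝ} (hU : IsOpen U)
    {f g : ℝ → X} (h : HasWeakDerivOn U f g) :
    ∃ F : ℝ → X, (∀ᵐ x, x ∈ U → F x = f x) ∧
      ∀ s t, uIcc s t ⊆ U → F t - F s = ∫ r in s..t, g r := by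
  obtain ⟨N, hN, hNf⟩ := h.exists_sub_eq_integral hU
  have hNf' : ∀ s ∈ N, ∀ t ∈ N, uIcc s t ⊆ U → f t - f s = ∫ r in s..t, g r := by
    intro s hs t ht hst
    rcases le_total s t with h1 | h1
    · exact hNf s hs t ht h1 (by rwa [uIcc_of_le h1] at hst)
    · rw [intervalIntegral.integral_symm, ← hNf t ht s hs h1 (by rwa [uIcc_of_ge h1] at hst),
        neg_sub]
  have hd : Dense N := Measure.dense_of_ae hN
  have hex (x : ℝ) : ∃ s, x ∈ U → s ∈ N ∧ uIcc s x ⊆ U := by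
    by_cases hx : x ∈ U
    · obtain ⟨r, hr, hrU⟩ := Metric.isOpen_iff.1 hU x hx
      obtain ⟨s, hs, hsr⟩ := hd.inter_open_nonempty (Metric.ball x r) Metric.isOpen_ball
        ⟨x, Metric.mem_ball_self hr⟩
      refine ⟨s, fun _ => ⟨hsr, Subset.trans ?_ hrU⟩⟩
      rw [Real.ball_eq_Ioo] at hs ⊢
      exact ordConnected_Ioo.uIcc_subset hs ⟨by linarith, by linarith⟩
    · exact ⟨0, fun h => absurd h hx⟩
  choose σ hσ using hex
  have hsub {s t : ℝ} (hs : uIcc s t ⊆ U) : s ∈ U ∧ t ∈ U := ⟨hs left_mem_uIcc, hs right_mem_uIcc⟩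
  -- Every point is reached by integrating from its own nearby good point `σ x`. Increments between
  -- good points are already integrals of `g`, so the choice of `σ x` does not affect the result.
  refine ⟨fun x => f (σ x) + ∫ r in (σ x)..x, g r, ?_, fun s t hst => ?_⟩
  · filter_upwards [hN] with x hx hxU
    rw [← hNf' _ (hσ x hxU).1 x hx (hσ x hxU).2, add_sub_cancel]
  · obtain ⟨hs, ht⟩ := hsub hst
    obtain ⟨hsN, hsU⟩ := hσ s hs
    obtain ⟨htN, htU⟩ := hσ t ht
    have h3 : uIcc (σ s) (σ t) ⊆ U :=
      uIcc_subset_uIcc_union_uIcc.trans (union_subset hsU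
        (uIcc_subset_uIcc_union_uIcc.trans (union_subset hst (by rw [uIcc_comm]; exact htU))))
    have i1 := intervalIntegrable_of_uIcc_subset h.2.1 hsU
    have i2 := intervalIntegrable_of_uIcc_subset h.2.1 hst
    have i3 := intervalIntegrable_of_uIcc_subset h.2.1 htU
    have e := hNf' _ hsN _ htN h3
    have e2 : ∫ r in (σ s)..(σ t), g r
        = (∫ r in (σ s)..s, g r) + (∫ r in s..t, g r) - ∫ r in (σ t)..t, g r := by
      rw [intervalIntegral.integral_add_adjacent_intervals i1 i2, sub_eq_add_neg,
        ← intervalIntegral.integral_symm,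
        intervalIntegral.integral_add_adjacent_intervals (i1.trans i2) i3.symm]
    have e3 : f (σ t) = f (σ s) + ((∫ r in (σ s)..s, g r) + (∫ r in s..t, g r)
        - ∫ r in (σ t)..t, g r) := by rw [← e2, ← e]; abel
    simp only [e3]
    abel

theorem continuousOn_of_sub_eq_integral {U : Set ℝ} (hU : IsOpen U) {F g : ℝ → X}
    (hg : LocallyIntegrableOn g U) (h : ∀ s t, uIcc s t ⊆ U → F t - F s = ∫ r in s..t, g r) :
    ContinuousOn F U := by
  intro x hx
  obtain ⟨r, hr, hrU⟩ := Metric.isOpen_iff.1 hU x hx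
  have hIcc : Icc (x - r / 2) (x + r / 2) ⊆ U := fun y hy =>
    hrU (by rw [Real.ball_eq_Ioo]; exact ⟨by linarith [hy.1], by linarith [hy.2]⟩)
  have hgi := hg.integrableOn_compact_subset hIcc isCompact_Icc
  have hc : ContinuousOn (fun y => F (x - r / 2) + ∫ s in (x - r / 2)..y, g s)
      (Icc (x - r / 2) (x + r / 2)) := by
    refine continuousOn_const.add ?_
    have := intervalIntegral.continuousOn_primitive_interval (a := x - r / 2) (b := x + r / 2)
      (f := g) (μ := volume) (by rwa [uIcc_of_le (by linarith)])
    rwa [uIcc_of_le (by linarith)] at this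
  have hc2 : ContinuousOn F (Icc (x - r / 2) (x + r / 2)) := by
    refine hc.congr fun y hy => ?_
    simp only
    rw [← h _ _ (by rw [uIcc_of_le hy.1]; exact (Icc_subset_Icc_right hy.2).trans hIcc),
      add_sub_cancel]
  exact (hc2.continuousAt (Icc_mem_nhds (by linarith) (by linarith))).continuousWithinAt

theorem hasDerivAt_of_sub_eq_integral [CompleteSpace X] {U : Set ℝ} (hU : IsOpen U) {F g : ℝ → X}
    (hg : ContinuousOn g U) (h : ∀ s t, uIcc s t ⊆ U → F t - F s = ∫ r in s..t, g r)
    {x : ℝ} (hx : x ∈ U) : HasDerivAt F (g x) x := by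
  obtain ⟨r, hr, hrU⟩ := Metric.isOpen_iff.1 hU x hx
  have hd : HasDerivAt (fun y => F x + ∫ s in x..y, g s) (g x) x := by
    refine HasDerivAt.const_add _ (intervalIntegral.integral_hasDerivAt_right (by simp)
      (hg.stronglyMeasurableAtFilter hU x hx) (hg.continuousAt (hU.mem_nhds hx)))
  refine hd.congr_of_eventuallyEq ?_
  filter_upwards [Metric.ball_mem_nhds x hr] with y hy
  rw [← h x y, add_sub_cancel]
  refine Subset.trans ?_ hrU
  rw [Real.ball_eq_Ioo] at hy ⊢
  exact ordConnected_Ioo.uIcc_subset ⟨by linarith, by linarith⟩ hy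

/-- Extension by zero of a `C¹` function that vanishes outside a compact subset of `U`. -/
theorem contDiff_one_indicator {U K : Set ℝ} (hU : IsOpen U) (hK : IsCompact K) (hKU : K ⊆ U)
    {H H' : ℝ → ℝ} (hH : ∀ x ∈ U, HasDerivAt H (H' x) x) (hH' : ContinuousOn H' U)
    (hz : ∀ x ∈ U, x ∉ K → H x = 0) :
    ContDiff ℝ 1 (U.indicator H) ∧ deriv (U.indicator H) = U.indicator H' ∧
      HasCompactSupport (U.indicator H) ∧ tsupport (U.indicator H) ⊆ U := by
  -- `U \ K` is open and `H` vanishes on it, hence so does its derivative.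
  have hz' : ∀ x ∈ U, x ∉ K → H' x = 0 := by
    intro x hx hxK
    refine (hH x hx).unique ((hasDerivAt_const x (0 : ℝ)).congr_of_eventuallyEq ?_)
    filter_upwards [(hU.inter hK.isClosed.isOpen_compl).mem_nhds ⟨hx, hxK⟩] with y hy
    exact hz y hy.1 hy.2
  have hH0 : ∀ x, x ∉ K → U.indicator H x = 0 := by
    intro x hx
    by_cases hxU : x ∈ U
    · rw [indicator_of_mem hxU, hz x hxU hx]
    · rw [indicator_of_notMem hxU]
  have hH0' : ∀ x, x ∉ K → U.indicator H' x = 0 := by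
    intro x hx
    by_cases hxU : x ∈ U
    · rw [indicator_of_mem hxU, hz' x hxU hx]
    · rw [indicator_of_notMem hxU]
  have hder (x : ℝ) : HasDerivAt (U.indicator H) (U.indicator H' x) x := by
    by_cases hxU : x ∈ U
    · rw [indicator_of_mem hxU]
      refine (hH x hxU).congr_of_eventuallyEq ?_
      filter_upwards [hU.mem_nhds hxU] with y hy
      rw [indicator_of_mem hy]
    · rw [indicator_of_notMem hxU]
      refine (hasDerivAt_const x (0 : ℝ)).congr_of_eventuallyEq ?_
      filter_upwards [hK.isClosed.isOpen_compl.mem_nhds fun h => hxU (hKU h)] with y hy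
      exact hH0 y hy
  have hcont : Continuous (U.indicator H') := by
    rw [continuous_iff_continuousAt]
    intro x
    by_cases hxU : x ∈ U
    · refine (hH'.continuousAt (hU.mem_nhds hxU)).congr ?_
      filter_upwards [hU.mem_nhds hxU] with y hy
      rw [indicator_of_mem hy]
    · refine (continuousAt_const (y := (0 : ℝ))).congr ?_
      filter_upwards [hK.isClosed.isOpen_compl.mem_nhds fun h => hxU (hKU h)] with y hy
      exact (hH0' y hy).symm
  have hd : deriv (U.indicator H) = U.indicator H' := funext fun x => (hder x).deriv
  refine ⟨?_, hd, HasCompactSupport.intro hK hH0, ?_⟩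
  · rw [contDiff_one_iff_deriv, hd]
    exact ⟨fun x => (hder x).differentiableAt, hcont⟩
  · refine (closure_minimal (fun x hx => ?_) hK.isClosed).trans hKU
    by_contra hxK
    exact hx (hH0 x hxK)

/-- Integral of the derivative of a compactly supported function. -/
theorem setIntegral_deriv_eq_zero {U K : Set ℝ} (hU : IsOpen U) (hK : IsCompact K) (hKU : K ⊆ U)
    {H H' : ℝ → ℝ} (hH : ∀ x ∈ U, HasDerivAt H (H' x) x) (hH' : ContinuousOn H' U)
    (hz : ∀ x ∈ U, x ∉ K → H x = 0) : ∫ x in U, H' x = 0 := by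
  obtain ⟨hc, hd, hs, -⟩ := contDiff_one_indicator hU hK hKU hH hH' hz
  rw [← integral_indicator hU.measurableSet, ← hd]
  exact integral_eq_zero_of_hasDerivAt_of_integrable
    (fun x => (hc.differentiable one_ne_zero x).hasDerivAt)
    ((hc.continuous_deriv le_rfl).integrable_of_hasCompactSupport hs.deriv)
    (hc.continuous.integrable_of_hasCompactSupport hs)

/-- A classical derivative is a weak derivative. -/
theorem hasWeakDerivOn_of_hasDerivAt {U : Set ℝ} (hU : IsOpen U) {f f' : ℝ → ℝ}
    (hf : ∀ x ∈ U, HasDerivAt f (f' x) x) (hf' : ContinuousOn f' U) : HasWeakDerivOn U f f' := by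
  have hfc : ContinuousOn f U := fun x hx => (hf x hx).continuousAt.continuousWithinAt
  refine ⟨hfc.locallyIntegrableOn hU.measurableSet, hf'.locallyIntegrableOn hU.measurableSet,
    fun φ hφ => ?_⟩
  have key := setIntegral_deriv_eq_zero hU hφ.2.1 hφ.2.2 (H := fun x => φ x * f x)
    (H' := fun x => deriv φ x * f x + φ x * f' x)
    (fun x hx => (hφ.differentiable x).hasDerivAt.mul (hf x hx))
    ((hφ.continuous_deriv.continuousOn.mul hfc).add (hφ.continuous.continuousOn.mul hf'))
    (fun x _ hx => by rw [image_eq_zero_of_notMem_tsupport hx, zero_mul])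
  have hint {ψ h : ℝ → ℝ} (hψ : Continuous ψ) (hs : tsupport ψ ⊆ tsupport φ)
      (hh : ContinuousOn h U) : IntegrableOn (fun x => ψ x * h x) U := by
    have h1 : IntegrableOn (fun x => ψ x * h x) (tsupport φ) :=
      ((hψ.continuousOn.mul (hh.mono hφ.2.2)).integrableOn_compact hφ.2.1)
    refine (integrableOn_iff_integrable_of_support_subset (s := tsupport φ) ?_).1 h1 |>.integrableOn
    exact (Function.support_mul_subset_left _ _).trans ((subset_tsupport _).trans hs)
  rw [integral_add (hint hφ.continuous_deriv (tsupport_deriv_subset) hfc)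
    (hint hφ.continuous subset_rfl hf')] at key
  simp only [smul_eq_mul]
  linarith

/-- Weak derivatives may be tested with compactly supported `C¹` functions. -/
theorem HasWeakDerivOn.integral_deriv_smul {U : Set ℝ} (hU : IsOpen U) {f g : ℝ → X}
    (h : HasWeakDerivOn U f g) {F : ℝ → ℝ} (hF : ContDiff ℝ 1 F) (hFs : HasCompactSupport F)
    (hFU : tsupport F ⊆ U) : ∫ x in U, deriv F x • f x = -∫ x in U, F x • g x := by
  obtain ⟨δ, hδ, hδU⟩ := hFs.isCompact.exists_cthickening_subset_open hU hFU
  set K := Metric.cthickening δ (tsupport F) with hK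
  have hKc : IsCompact K := hFs.isCompact.cthickening
  set κ : ℕ → ℝ → ℝ := fun k => (mollBump ℝ k).normed volume with hκ
  -- Mollifications of a compactly supported continuous `G` converge uniformly and are eventually
  -- supported in the fixed compact set `K`, on which `w` is integrable; dominated convergence
  -- applies.
  have conv_lim (G : ℝ → ℝ) (hG : Continuous G) (hGs : tsupport G ⊆ tsupport F) (w : ℝ → X)
      (hw : LocallyIntegrableOn w U) :
      Tendsto (fun k => ∫ x in U, (κ k ⋆[ContinuousLinearMap.lsmul ℝ ℝ, volume] G) x • w x)
        atTop (𝓝 (∫ x in U, G x • w x)) := by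
    have hGc : HasCompactSupport G := hFs.isCompact.of_isClosed_subset (isClosed_tsupport _) hGs
    have huc := hGc.uniformContinuous_of_continuous hG
    obtain ⟨C, hC⟩ := hGc.exists_bound_of_continuous hG
    have hdist (e : ℝ) (he : 0 < e) : ∀ᶠ k in atTop, ∀ x,
        dist ((κ k ⋆[ContinuousLinearMap.lsmul ℝ ℝ, volume] G) x) (G x) ≤ e := by
      obtain ⟨r, hr, hrG⟩ := Metric.uniformContinuous_iff.1 huc e he
      filter_upwards [(tendsto_mollBump_rOut ℝ).eventually_lt_const hr] with k hk x
      refine ContDiffBump.dist_normed_convolution_le hG.aestronglyMeasurable fun y hy => ?_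
      exact (hrG ((Metric.mem_ball.1 hy).trans hk)).le
    have hsupp : ∀ᶠ k in atTop, ∀ x, x ∉ K →
        (κ k ⋆[ContinuousLinearMap.lsmul ℝ ℝ, volume] G) x = 0 := by
      filter_upwards [(tendsto_mollBump_rOut ℝ).eventually_lt_const hδ] with k hk x hx
      by_contra hne
      obtain ⟨y, hy, z, hz, rfl⟩ := support_convolution_subset _ (Function.mem_support.2 hne)
      rw [hκ, ContDiffBump.support_normed_eq, mem_ball_zero_iff] at hy
      refine hx (Metric.mem_cthickening_of_dist_le _ z _ _ (hGs (subset_tsupport _ hz)) ?_)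
      rw [dist_eq_norm, add_sub_cancel_right]
      linarith
    have hwK : IntegrableOn w K := hw.integrableOn_compact_subset hδU hKc
    refine tendsto_integral_filter_of_dominated_convergence
      (K.indicator fun x => (C + 1) * ‖w x‖) ?_ ?_ ?_ ?_
    · refine Eventually.of_forall fun k => AEStronglyMeasurable.smul ?_ hw.aestronglyMeasurable
      exact (((mollBump ℝ k).hasCompactSupport_normed.contDiff_convolution_left _
        (mollBump ℝ k).contDiff_normed hG.locallyIntegrable
        (n := 0)).continuous).aestronglyMeasurable
    · filter_upwards [hsupp, hdist 1 one_pos] with k hk hk1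
      refine Eventually.of_forall fun x => ?_
      by_cases hx : x ∈ K
      · rw [indicator_of_mem hx, norm_smul]
        refine mul_le_mul_of_nonneg_right ?_ (norm_nonneg _)
        have := hk1 x
        rw [dist_eq_norm] at this
        have h2 := norm_sub_norm_le ((κ k ⋆[ContinuousLinearMap.lsmul ℝ ℝ, volume] G) x) (G x)
        linarith [hC x]
      · rw [indicator_of_notMem hx, hk x hx, zero_smul, norm_zero]
    · have : Integrable (K.indicator fun x => (C + 1) * ‖w x‖) :=
        (integrable_indicator_iff hKc.measurableSet).2 (hwK.norm.const_mul _)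
      exact this.integrableOn
    · refine Eventually.of_forall fun x => Tendsto.smul_const ?_ _
      exact ContDiffBump.convolution_tendsto_right_of_continuous (tendsto_mollBump_rOut ℝ) hG x
  have hF' : Continuous (deriv F) := hF.continuous_deriv le_rfl
  have l1 := conv_lim (deriv F) hF' tsupport_deriv_subset f h.1
  have l2 := (conv_lim F hF.continuous subset_rfl g h.2.1).neg
  refine tendsto_nhds_unique (l1.congr' ?_) l2
  filter_upwards [(tendsto_mollBump_rOut ℝ).eventually_lt_const hδ] with k hk
  set Fk := κ k ⋆[ContinuousLinearMap.lsmul ℝ ℝ, volume] F with hFk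
  have hderiv (x : ℝ) : deriv Fk x
      = (κ k ⋆[ContinuousLinearMap.lsmul ℝ ℝ, volume] deriv F) x :=
    (hFs.hasDerivAt_convolution_right _ (mollBump ℝ k).integrable_normed.locallyIntegrable hF
      x).deriv
  have hts : tsupport Fk ⊆ K := by
    refine closure_minimal (fun x hne => ?_) hKc.isClosed
    obtain ⟨y, hy, z, hz, rfl⟩ := support_convolution_subset _ hne
    rw [hκ, ContDiffBump.support_normed_eq, mem_ball_zero_iff] at hy
    refine Metric.mem_cthickening_of_dist_le _ z _ _ (subset_tsupport _ hz) ?_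
    rw [dist_eq_norm, add_sub_cancel_right]
    linarith
  have htest : IsTestFun U Fk :=
    ⟨(mollBump ℝ k).hasCompactSupport_normed.contDiff_convolution_left _
      (mollBump ℝ k).contDiff_normed hF.continuous.locallyIntegrable,
      hKc.of_isClosed_subset (isClosed_tsupport _) hts, hts.trans hδU⟩
  have := h.2.2 Fk htest
  simp_rw [hderiv] at this
  exact this

/-- Uniqueness of weak derivatives. -/
theorem HasWeakDerivOn.ae_eq [CompleteSpace X] {U : Set ℝ} (hU : IsOpen U) {f₁ f₂ g₁ g₂ : ℝ → X}
    (h₁ : HasWeakDerivOn U f₁ g₁) (h₂ : HasWeakDerivOn U f₂ g₂)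
    (hf : ∀ᵐ x, x ∈ U → f₁ x = f₂ x) : ∀ᵐ x, x ∈ U → g₁ x = g₂ x := by
  have key := hU.ae_eq_zero_of_integral_contDiff_smul_eq_zero (μ := volume) (f := g₁ - g₂)
    (h₁.2.1.sub h₂.2.1) ?_
  · filter_upwards [key] with x hx hxU
    exact sub_eq_zero.1 (hx hxU)
  intro φ hφ hφs hφU
  have htest : IsTestFun U φ := ⟨hφ, hφs, hφU⟩
  have e : ∫ x in U, φ x • g₁ x = ∫ x in U, φ x • g₂ x := by
    rw [← neg_inj, ← h₁.2.2 φ htest, ← h₂.2.2 φ htest]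
    refine setIntegral_congr_ae hU.measurableSet ?_
    filter_upwards [hf] with x hx hxU
    rw [hx hxU]
  have hint {g : ℝ → X} (hg : LocallyIntegrableOn g U) : IntegrableOn (fun x => φ x • g x) U := by
    have h1 : IntegrableOn (fun x => φ x • g x) (tsupport φ) :=
      (hg.integrableOn_compact_subset hφU hφs).continuousOn_smul hφ.continuous.continuousOn hφs
    refine ((integrableOn_iff_integrable_of_support_subset (s := tsupport φ) ?_).1 h1).integrableOn
    exact (Function.support_smul_subset_left _ _).trans (subset_tsupport _)
  rw [← setIntegral_eq_integral_of_eq_zero (U := U) fun x hx => by simp [htest.eq_zero hx]]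
  simp only [Pi.sub_apply, smul_sub]
  rw [integral_sub (hint h₁.2.1) (hint h₂.2.1), e, sub_self]

end WeakDeriv

end

/-! ### Mollification in L² -/

section

/-- Jensen's inequality for the probability density κ: Cauchy–Schwarz applied to κ^{1/2} · (κ^{1/2}
h). -/
theorem lintegral_mul_sq_le {E : Type*} [MeasureSpace E] {κ : E → ℝ≥0∞} (hκ : AEMeasurable κ) (hκ1 : ∫⁻ y, κ y = 1)
    {h : E → ℝ≥0∞} (hh : AEMeasurable h) :
    (∫⁻ y, κ y * h y) ^ 2 ≤ ∫⁻ y, κ y * h y ^ 2 := by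
  have H := ENNReal.lintegral_mul_le_Lp_mul_Lq volume (p := 2) (q := 2)
    (Real.HolderConjugate.two_two) (f := fun y => κ y ^ (1 / 2 : ℝ))
    (g := fun y => κ y ^ (1 / 2 : ℝ) * h y) (hκ.pow_const _) ((hκ.pow_const _).mul hh)
  have e1 (y : E) : κ y ^ (1 / 2 : ℝ) * (κ y ^ (1 / 2 : ℝ) * h y) = κ y * h y := by
    rw [← mul_assoc, ← ENNReal.rpow_add_of_nonneg _ _ (by norm_num) (by norm_num)]
    norm_num
  have e2 (y : E) : (κ y ^ (1 / 2 : ℝ)) ^ (2 : ℝ) = κ y := by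
    rw [← ENNReal.rpow_mul]; norm_num
  simp only [Pi.mul_apply, e1, e2, ENNReal.mul_rpow_of_nonneg _ _ (zero_le_two (α := ℝ)), hκ1,
    ENNReal.one_rpow, one_mul] at H
  calc (∫⁻ y, κ y * h y) ^ 2 ≤ ((∫⁻ y, κ y * h y ^ (2 : ℝ)) ^ (1 / 2 : ℝ)) ^ 2 := by gcongr
    _ = ∫⁻ y, κ y * h y ^ 2 := by
        rw [← ENNReal.rpow_two, ← ENNReal.rpow_mul]
        norm_num

theorem eLpNorm_two_sq {α : Type*} [MeasurableSpace α] (μ : Measure α) (f : α → ℝ) :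
    eLpNorm f 2 μ ^ 2 = ∫⁻ x, ‖f x‖ₑ ^ 2 ∂μ := by
  rw [eLpNorm_eq_lintegral_rpow_enorm_toReal (by norm_num) (by norm_num), ← ENNReal.rpow_two,
    ← ENNReal.rpow_mul]
  simp

section Mollification

set_option linter.unusedSectionVars false

variable {E : Type*} [NormedAddCommGroup E] [NormedSpace ℝ E] [FiniteDimensional ℝ E]
  [MeasureSpace E] [BorelSpace E] [(volume : Measure E).IsAddHaarMeasure]

/-- The `k`-th mollification of `f`. -/
def moll (k : ℕ) (f : E → ℝ) : E → ℝ :=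
  (mollBump E k).normed volume ⋆[ContinuousLinearMap.lsmul ℝ ℝ, volume] f

theorem moll_apply (k : ℕ) (f : E → ℝ) (x : E) :
    moll k f x = ∫ y, (mollBump E k).normed volume (x - y) * f y :=
  convolution_lsmul_swap

theorem moll_apply' (k : ℕ) (f : E → ℝ) (x : E) :
    moll k f x = ∫ y, (mollBump E k).normed volume y * f (x - y) := by
  rw [moll, convolution_def]; rfl

theorem contDiff_moll (k : ℕ) {f : E → ℝ} (hf : LocallyIntegrable f) : ContDiff ℝ ∞ (moll k f) :=
  (mollBump E k).hasCompactSupport_normed.contDiff_convolution_left _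
    (mollBump E k).contDiff_normed hf

/-- The derivative falls on the kernel. A distributional identity tested with a translated kernel
thereby becomes a pointwise identity for mollified functions. -/
theorem fderiv_moll (k : ℕ) {f : E → ℝ} (hf : LocallyIntegrable f) (x v : E) :
    fderiv ℝ (moll k f) x v
      = ∫ y, fderiv ℝ ((mollBump E k).normed volume) (x - y) v * f y := by
  have hflip : moll k f
      = f ⋆[(ContinuousLinearMap.lsmul ℝ ℝ).flip, volume] (mollBump E k).normed volume := by
    rw [moll, ← convolution_flip]
  have hκ : ContDiff ℝ 1 ((mollBump E k).normed (volume : Measure E)) :=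
    (mollBump E k).contDiff_normed
  have hs := (mollBump E k).hasCompactSupport_normed (μ := (volume : Measure E))
  rw [hflip, (hs.hasFDerivAt_convolution_right _ hf hκ x).fderiv,
    convolution_precompR_apply _ hf (hs.fderiv ℝ) (hκ.continuous_fderiv one_ne_zero),
    ← convolution_flip, convolution_eq_swap]
  rfl

theorem abs_moll_le (k : ℕ) {f : E → ℝ} {M : ℝ} (hM : ∀ᵐ x, |f x| ≤ M) (x : E) :
    |moll k f x| ≤ M := by
  have hM' : ∀ᵐ y, |f (x - y)| ≤ M :=
    (quasiMeasurePreserving_sub_left volume x).ae hM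
  have hi : Integrable ((mollBump E k).normed (volume : Measure E)) :=
    (mollBump E k).integrable_normed
  have h1 : ∫ y, (mollBump E k).normed (volume : Measure E) y * M = M := by
    rw [integral_mul_const, (mollBump E k).integral_normed, one_mul]
  rw [moll_apply', ← Real.norm_eq_abs, ← h1]
  refine norm_integral_le_of_norm_le (hi.mul_const M) ?_
  filter_upwards [hM'] with y hy
  rw [norm_mul, Real.norm_of_nonneg ((mollBump E k).nonneg_normed y)]
  exact mul_le_mul_of_nonneg_left hy ((mollBump E k).nonneg_normed y)

theorem ae_tendsto_moll {f : E → ℝ} (hf : LocallyIntegrable f) :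
    ∀ᵐ x, Tendsto (fun k => moll k f x) atTop (𝓝 (f x)) :=
  ContDiffBump.ae_convolution_tendsto_right_of_locallyIntegrable
    (tendsto_mollBump_rOut E) (Eventually.of_forall (mollBump_rOut_le E)) hf

/-- Continuity of translations in `L²`. -/
theorem tendsto_eLpNorm_translate_sub {f : E → ℝ} (hf : MemLp f 2) :
    Tendsto (fun y => eLpNorm (fun x => f (x - y) - f x) 2) (𝓝 0) (𝓝 0) := by
  let g : E → C(E, E) := fun y => ⟨fun x => x - y, by fun_prop⟩
  have hg : Continuous g :=
    (ContinuousMap.curry ⟨fun p : E × E => p.2 - p.1, by fun_prop⟩).continuous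
  have hgm (y : E) : MeasurePreserving (g y) volume volume := measurePreserving_sub_right volume y
  have hc := (continuous_const (y := hf.toLp f)).compMeasurePreservingLp hg hgm
    ENNReal.ofNat_ne_top
  have h0 : g 0 = ContinuousMap.id E := by ext x; simp [g]
  have := (hc.tendsto 0).edist (tendsto_const_nhds (x := hf.toLp f))
  have e0 : Lp.compMeasurePreserving (g 0) (hgm 0) (hf.toLp f) = hf.toLp f := by
    refine Lp.ext ?_
    filter_upwards [Lp.coeFn_compMeasurePreserving (hf.toLp f) (hgm 0)] with x hx
    rw [hx, h0]; rfl
  rw [e0, edist_self] at this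
  refine this.congr fun y => ?_
  rw [Lp.edist_def]
  refine eLpNorm_congr_ae ?_
  filter_upwards [Lp.coeFn_compMeasurePreserving (hf.toLp f) (hgm y), hf.coeFn_toLp,
    (hgm y).quasiMeasurePreserving.ae hf.coeFn_toLp] with x h1 h2 h3
  simp only [Pi.sub_apply, h1, h2, Function.comp_apply, h3]
  rfl

theorem moll_congr_ae (k : ℕ) {f g : E → ℝ} (h : f =ᵐ[volume] g) : moll k f = moll k g := by
  funext x
  rw [moll_apply, moll_apply]
  refine integral_congr_ae ?_
  filter_upwards [h] with y hy
  rw [hy]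

/-- The mollification error at `x` is a κ-average of the translation errors f(x-y) - f(x). Jensen
moves the square inside the average, and Tonelli reduces the estimate to translations by `y` in the
support of κ. -/
theorem eLpNorm_moll_sub_sq_le (k : ℕ) {f : E → ℝ} (hf : MemLp f 2) {e : ℝ≥0∞}
    (he : ∀ y ∈ Metric.ball (0 : E) (mollBump E k).rOut,
      eLpNorm (fun x => f (x - y) - f x) 2 ≤ e) :
    eLpNorm (moll k f - f) 2 ≤ e := by
  -- Tonelli needs joint measurability of (x, y) ↦ f(x-y), so a strongly measurable representative
  -- is chosen first.
  wlog hfm : StronglyMeasurable f generalizing f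
  · have hae := hf.1.ae_eq_mk
    rw [moll_congr_ae k hae]
    refine (eLpNorm_congr_ae (EventuallyEq.rfl.sub hae)).trans_le (this ((memLp_congr_ae hae).1 hf)
      (fun y hy => (eLpNorm_congr_ae ?_).trans_le (he y hy)) hf.1.stronglyMeasurable_mk)
    filter_upwards [hae, (measurePreserving_sub_right volume y).quasiMeasurePreserving.ae hae]
      with x h1 h2
    rw [h1, h2]
  set κ : E → ℝ := (mollBump E k).normed volume with hκ
  have hκc : Continuous κ := (mollBump E k).continuous_normed
  have hκm : Measurable fun y => ENNReal.ofReal (κ y) := hκc.measurable.ennreal_ofReal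
  have hκ1 : ∫⁻ y, ENNReal.ofReal (κ y) = 1 := by
    rw [← ofReal_integral_eq_lintegral_ofReal (mollBump E k).integrable_normed
      (Eventually.of_forall (mollBump E k).nonneg_normed), (mollBump E k).integral_normed,
      ENNReal.ofReal_one]
  have hmeas : Measurable fun p : E × E => ‖f (p.1 - p.2) - f p.1‖ₑ :=
    ((hfm.measurable.comp (measurable_fst.sub measurable_snd)).sub
      (hfm.measurable.comp measurable_fst)).enorm
  have hloc := hf.locallyIntegrable (by norm_num)
  have hpt (x : E) : ‖moll k f x - f x‖ₑ
      ≤ ∫⁻ y, ENNReal.ofReal (κ y) * ‖f (x - y) - f x‖ₑ := by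
    have hi : Integrable fun y => κ y * f (x - y) :=
      ((mollBump E k).hasCompactSupport_normed.convolutionExists_left
        (ContinuousLinearMap.lsmul ℝ ℝ) hκc hloc x)
    have e : moll k f x - f x = ∫ y, κ y * (f (x - y) - f x) := by
      simp only [mul_sub]
      rw [integral_sub hi ((mollBump E k).integrable_normed.mul_const _), integral_mul_const,
        (mollBump E k).integral_normed, one_mul, moll_apply']
    rw [e]
    refine (enorm_integral_le_lintegral_enorm _).trans (lintegral_mono fun y => ?_)
    rw [enorm_mul, Real.enorm_of_nonneg ((mollBump E k).nonneg_normed y)]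
  have hsq : eLpNorm (moll k f - f) 2 ^ 2 ≤ e ^ 2 := by
    rw [eLpNorm_two_sq]
    calc ∫⁻ x, ‖(moll k f - f) x‖ₑ ^ 2
        ≤ ∫⁻ x, ∫⁻ y, ENNReal.ofReal (κ y) * ‖f (x - y) - f x‖ₑ ^ 2 := by
          refine lintegral_mono fun x => ?_
          refine le_trans ?_ (lintegral_mul_sq_le hκm.aemeasurable hκ1
            (hmeas.comp (measurable_const.prodMk measurable_id)).aemeasurable)
          exact pow_le_pow_left₀ (zero_le) (hpt x) 2
      _ = ∫⁻ y, ∫⁻ x, ENNReal.ofReal (κ y) * ‖f (x - y) - f x‖ₑ ^ 2 := by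
          refine lintegral_lintegral_swap ?_
          exact ((hκm.comp measurable_snd).mul (hmeas.pow_const 2)).aemeasurable
      _ = ∫⁻ y, ENNReal.ofReal (κ y) * eLpNorm (fun x => f (x - y) - f x) 2 ^ 2 := by
          refine lintegral_congr fun y => ?_
          have : Measurable fun x => ‖f (x - y) - f x‖ₑ ^ 2 :=
            (hmeas.comp (measurable_id.prodMk measurable_const)).pow_const 2
          rw [lintegral_const_mul _ this, eLpNorm_two_sq]
      _ ≤ ∫⁻ y, ENNReal.ofReal (κ y) * e ^ 2 := by
          refine lintegral_mono fun y => ?_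
          by_cases hy : y ∈ Metric.ball (0 : E) (mollBump E k).rOut
          · exact mul_le_mul_right (pow_le_pow_left₀ (zero_le) (he y hy) 2) _
          · have : κ y = 0 := by
              rw [← ContDiffBump.support_normed_eq (μ := volume)] at hy
              simpa using hy
            simp [this]
      _ = e ^ 2 := by rw [lintegral_mul_const _ hκm, hκ1, one_mul]
  exact (ENNReal.pow_le_pow_left_iff (by norm_num)).1 hsq

/-- Mollifications converge in `L²`. -/
theorem tendsto_eLpNorm_moll_sub {f : E → ℝ} (hf : MemLp f 2) :
    Tendsto (fun k => eLpNorm (moll k f - f) 2) atTop (𝓝 0) := by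
  rw [ENNReal.tendsto_nhds_zero]
  intro e he
  obtain ⟨r, hr, hre⟩ := Metric.eventually_nhds_iff_ball.1
    (ENNReal.tendsto_nhds_zero.1 (tendsto_eLpNorm_translate_sub hf) e he)
  filter_upwards [(tendsto_mollBump_rOut E).eventually_lt_const hr] with k hk
  exact eLpNorm_moll_sub_sq_le k hf fun y hy => hre y (Metric.ball_subset_ball hk.le hy)

/-- Here the translation error is bounded crudely by twice the norm of `f`, with no smallness. -/
theorem memLp_moll (k : ℕ) {f : E → ℝ} (hf : MemLp f 2) : MemLp (moll k f) 2 := by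
  have hb : eLpNorm (moll k f - f) 2 ≤ eLpNorm f 2 + eLpNorm f 2 := by
    refine eLpNorm_moll_sub_sq_le k hf fun y _ => ?_
    have hmp := measurePreserving_sub_right (volume : Measure E) y
    refine (eLpNorm_sub_le (hf.comp_measurePreserving hmp).1 hf.1 (by norm_num)).trans ?_
    exact add_le_add_left (eLpNorm_comp_measurePreserving hf.1 hmp).le _
  have hm : MemLp (moll k f - f) 2 :=
    ⟨((contDiff_moll k (hf.locallyIntegrable
      (by norm_num))).continuous.aestronglyMeasurable).sub hf.1,
      hb.trans_lt (ENNReal.add_lt_top.2 ⟨hf.2, hf.2⟩)⟩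
  simpa using hm.add hf

end Mollification

end

/-! ### The chain rule for a weak conservation law -/

section

theorem eLpNorm_mul_one_le {α : Type*} [MeasurableSpace α] {μ : Measure α} {f g : α → ℝ}
    (hf : AEStronglyMeasurable f μ) (hg : AEStronglyMeasurable g μ) :
    eLpNorm (fun x => f x * g x) 1 μ ≤ eLpNorm f 2 μ * eLpNorm g 2 μ :=
  (eLpNorm_le_eLpNorm_mul_eLpNorm_of_nnnorm (p := 2) (q := 2) (r := 1) hf hg (fun a b => a * b) 1
    (Eventually.of_forall fun x => by simp)).trans (by simp)

/-- Passing to the limit in a product of a bounded and two `L²`-convergent sequences. -/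
theorem tendsto_integral_mul_mul {α : Type*} [MeasurableSpace α] {μ : Measure α}
    {c f g : ℕ → α → ℝ} {c₀ f₀ g₀ : α → ℝ} {C : ℝ}
    (hcm : ∀ k, AEStronglyMeasurable (c k) μ) (hcC : ∀ k, ∀ᵐ x ∂μ, |c k x| ≤ C)
    (hc : ∀ᵐ x ∂μ, Tendsto (fun k => c k x) atTop (𝓝 (c₀ x)))
    (hf : ∀ k, MemLp (f k) 2 μ) (hf₀ : MemLp f₀ 2 μ)
    (hfl : Tendsto (fun k => eLpNorm (f k - f₀) 2 μ) atTop (𝓝 0))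
    (hg : ∀ k, MemLp (g k) 2 μ) (hg₀ : MemLp g₀ 2 μ)
    (hgl : Tendsto (fun k => eLpNorm (g k - g₀) 2 μ) atTop (𝓝 0)) :
    Tendsto (fun k => ∫ x, c k x * (f k x * g k x) ∂μ) atTop
      (𝓝 (∫ x, c₀ x * (f₀ x * g₀ x) ∂μ)) := by
  have hint {f g : α → ℝ} (hf : MemLp f 2 μ) (hg : MemLp g 2 μ) :
      Integrable (fun x => f x * g x) μ := hf.integrable_mul hg
  have hsub (k : ℕ) : Integrable (fun x => f k x * g k x - f₀ x * g₀ x) μ :=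
    (hint (hf k) (hg k)).sub (hint hf₀ hg₀)
  have hcint (k : ℕ) {h : α → ℝ} (hh : Integrable h μ) : Integrable (fun x => c k x * h x) μ :=
    hh.bdd_mul (hcm k) (c := C) (hcC k)
  -- The products converge in L¹, by f_k g_k - f₀g₀ = (f_k - f₀) g_k + f₀ (g_k - g₀), and bounded
  -- coefficients preserve convergence to zero. The coefficients converge only almost everywhere, so
  -- their own limit is taken separately against the fixed product f₀g₀.
  have l1 : Tendsto (fun k => ∫ x, c k x * (f k x * g k x - f₀ x * g₀ x) ∂μ) atTop (𝓝 0) := by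
    have hb (k : ℕ) : ‖∫ x, c k x * (f k x * g k x - f₀ x * g₀ x) ∂μ‖ₑ
        ≤ ENNReal.ofReal C * (eLpNorm (f k - f₀) 2 μ * (eLpNorm (g k - g₀) 2 μ + eLpNorm g₀ 2 μ)
          + eLpNorm f₀ 2 μ * eLpNorm (g k - g₀) 2 μ) := by
      have e1 : eLpNorm (fun x => f k x * g k x - f₀ x * g₀ x) 1 μ
          ≤ eLpNorm (f k - f₀) 2 μ * (eLpNorm (g k - g₀) 2 μ + eLpNorm g₀ 2 μ)
          + eLpNorm f₀ 2 μ * eLpNorm (g k - g₀) 2 μ := by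
        have : (fun x => f k x * g k x - f₀ x * g₀ x)
            = (fun x => (f k - f₀) x * g k x) + fun x => f₀ x * (g k - g₀) x := by
          funext x; simp only [Pi.add_apply, Pi.sub_apply]; ring
        rw [this]
        have hfk := ((hf k).sub hf₀).1
        have hgk := ((hg k).sub hg₀).1
        refine (eLpNorm_add_le (hfk.mul (hg k).1) (hf₀.1.mul hgk) le_rfl).trans ?_
        refine add_le_add ((eLpNorm_mul_one_le hfk (hg k).1).trans ?_)
          (eLpNorm_mul_one_le hf₀.1 hgk)
        gcongr
        calc eLpNorm (g k) 2 μ = eLpNorm ((g k - g₀) + g₀) 2 μ := by rw [sub_add_cancel]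
          _ ≤ _ := eLpNorm_add_le hgk hg₀.1 (by norm_num)
      refine (enorm_integral_le_lintegral_enorm _).trans ?_
      refine le_trans ?_ (mul_le_mul_right e1 (ENNReal.ofReal C))
      rw [eLpNorm_one_eq_lintegral_enorm, ← lintegral_const_mul'' _
        (hsub k).1.enorm]
      refine lintegral_mono_ae ?_
      filter_upwards [hcC k] with x hx
      rw [enorm_mul]
      gcongr
      rw [← ofReal_norm]
      exact ENNReal.ofReal_le_ofReal hx
    have hz : Tendsto (fun k => ENNReal.ofReal C * (eLpNorm (f k - f₀) 2 μ
        * (eLpNorm (g k - g₀) 2 μ + eLpNorm g₀ 2 μ)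
          + eLpNorm f₀ 2 μ * eLpNorm (g k - g₀) 2 μ)) atTop (𝓝 0) := by
      have t1 := ENNReal.Tendsto.mul hfl (Or.inr (by simpa using hg₀.2.ne))
        (hgl.add_const (eLpNorm g₀ 2 μ)) (Or.inr ENNReal.zero_ne_top)
      have t2 := ENNReal.Tendsto.const_mul hgl (a := eLpNorm f₀ 2 μ) (Or.inr hf₀.2.ne)
      have := ENNReal.Tendsto.const_mul (t1.add t2) (a := ENNReal.ofReal C)
        (Or.inr ENNReal.ofReal_ne_top)
      simpa using this
    rw [tendsto_zero_iff_enorm_tendsto_zero]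
    exact tendsto_of_tendsto_of_tendsto_of_le_of_le tendsto_const_nhds hz (fun _ => zero_le) hb
  have l2 : Tendsto (fun k => ∫ x, c k x * (f₀ x * g₀ x) ∂μ) atTop
      (𝓝 (∫ x, c₀ x * (f₀ x * g₀ x) ∂μ)) := by
    refine tendsto_integral_of_dominated_convergence (fun x => C * ‖f₀ x * g₀ x‖)
      (fun k => (hcint k (hint hf₀ hg₀)).1) ((hint hf₀ hg₀).norm.const_mul C) (fun k => ?_) ?_
    · filter_upwards [hcC k] with x hx
      rw [norm_mul]
      exact mul_le_mul_of_nonneg_right hx (norm_nonneg _)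
    · filter_upwards [hc] with x hx
      exact hx.mul_const _
  have := l1.add l2
  rw [zero_add] at this
  refine this.congr fun k => ?_
  rw [← integral_add (hcint k (hsub k)) (hcint k (hint hf₀ hg₀))]
  congr 1; funext x
  ring

section ChainRule

set_option linter.unusedSectionVars false

variable {E : Type*} [NormedAddCommGroup E] [NormedSpace ℝ E] [FiniteDimensional ℝ E]
  [MeasureSpace E] [BorelSpace E] [(volume : Measure E).IsAddHaarMeasure]

/-- `ψ ∈ C_c^∞(S)`. -/
def IsTestOn (S : Set E) (ψ : E → ℝ) : Prop :=
  ContDiff ℝ ∞ ψ ∧ HasCompactSupport ψ ∧ tsupport ψ ⊆ S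

theorem setIntegral_eq_integral_indicator_mul {S : Set E} (hS : MeasurableSet S) (f ψ : E → ℝ) :
    ∫ z in S, f z * ψ z = ∫ z, ψ z * S.indicator f z := by
  rw [← integral_indicator hS]
  congr 1; funext z
  by_cases hz : z ∈ S
  · simp [hz, mul_comm]
  · simp [hz]

/-- Pairing with y ↦ κ(z-y) evaluates a mollification at `z`; this is legitimate as long as the
kernel centred at `z` stays inside `S`. -/
theorem isTestOn_mollBump {S : Set E} {k : ℕ} {z : E}
    (hz : Metric.closedBall z (mollBump E k).rOut ⊆ S) :
    IsTestOn S fun y => (mollBump E k).normed (volume : Measure E) (z - y) := by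
  have hsupp : tsupport (fun y => (mollBump E k).normed (volume : Measure E) (z - y))
      ⊆ Metric.closedBall z (mollBump E k).rOut := by
    refine closure_minimal (fun y hy => ?_) Metric.isClosed_closedBall
    have : z - y ∈ Function.support ((mollBump E k).normed (volume : Measure E)) := hy
    rw [ContDiffBump.support_normed_eq, mem_ball_zero_iff] at this
    rw [Metric.mem_closedBall, dist_comm, dist_eq_norm]
    exact this.le
  exact ⟨(mollBump E k).contDiff_normed.comp (contDiff_const.sub contDiff_id),
    (isCompact_closedBall _ _).of_isClosed_subset (isClosed_tsupport _) hsupp, hsupp.trans hz⟩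

theorem fderiv_mollBump_sub (k : ℕ) (z y v : E) :
    fderiv ℝ (fun y => (mollBump E k).normed (volume : Measure E) (z - y)) y v
      = -fderiv ℝ ((mollBump E k).normed (volume : Measure E)) (z - y) v := by
  have hd : DifferentiableAt ℝ ((mollBump E k).normed (volume : Measure E)) (z - y) :=
    ((mollBump E k).contDiff_normed (n := 1)).differentiable one_ne_zero _
  have : HasFDerivAt (fun y => (mollBump E k).normed (volume : Measure E) (z - y)) _ y :=
    hd.hasFDerivAt.comp y ((hasFDerivAt_id y).const_sub z)
  rw [this.fderiv]
  simp

/-- The chain rule for `∂_v u = -∂_w J`, where `u` is bounded and `∂_w u = V` and `J` are square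
integrable. -/
theorem chain_rule_of_weak {S : Set E} (hS : IsOpen S) (hSfin : volume S ≠ ⊤) {v w : E}
    {u V J : E → ℝ} {M : ℝ} (hum : AEStronglyMeasurable u (volume.restrict S))
    (huM : ∀ᵐ z ∂volume.restrict S, |u z| ≤ M)
    (hV : MemLp V 2 (volume.restrict S)) (hJ : MemLp J 2 (volume.restrict S))
    (huJ : ∀ ψ, IsTestOn S ψ →
      ∫ z in S, u z * fderiv ℝ ψ z v = -∫ z in S, J z * fderiv ℝ ψ z w)
    (huV : ∀ ψ, IsTestOn S ψ → ∫ z in S, u z * fderiv ℝ ψ z w = -∫ z in S, V z * ψ z)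
    {β : ℝ → ℝ} (hβ : ContDiff ℝ 2 β) {ψ : E → ℝ} (hψ : IsTestOn S ψ) :
    ∫ z in S, β (u z) * fderiv ℝ ψ z v
      = -∫ z in S, J z * (deriv β (u z) * fderiv ℝ ψ z w + deriv (deriv β) (u z) * V z * ψ z) := by
  have hSm := hS.measurableSet
  have : IsFiniteMeasure (volume.restrict S) := ⟨by simpa using hSfin.lt_top⟩
  set U := S.indicator u with hU
  set W := S.indicator V with hW
  set I := S.indicator J with hI
  have hUi : Integrable U := (integrable_indicator_iff hSm).2
    (Integrable.of_bound hum M huM)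
  have hW2 : MemLp W 2 := (memLp_indicator_iff_restrict hSm).2 hV
  have hI2 : MemLp I 2 := (memLp_indicator_iff_restrict hSm).2 hJ
  have hUl := hUi.locallyIntegrable
  have hWl := hW2.locallyIntegrable (by norm_num)
  have hIl := hI2.locallyIntegrable (by norm_num)
  have hUM : ∀ᵐ z, |U z| ≤ |M| := by
    filter_upwards [(ae_restrict_iff' hSm).1 huM] with z hz
    by_cases hzS : z ∈ S
    · simpa [hU, hzS] using (hz hzS).trans (le_abs_self M)
    · simp [hU, hzS]
  have hβ1 : ContDiff ℝ 1 (deriv β) :=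
    ((contDiff_succ_iff_deriv (n := 1)).1 (by simpa using! hβ)).2.2
  have hβd : Differentiable ℝ β := hβ.differentiable two_ne_zero
  have hβ1d : Differentiable ℝ (deriv β) := hβ1.differentiable one_ne_zero
  have hβ2c : Continuous (deriv (deriv β)) := hβ1.continuous_deriv le_rfl
  have hψ1 : ContDiff ℝ 1 ψ := hψ.1.of_le (by simp)
  have hψc : Continuous ψ := hψ1.continuous
  have hψd : Differentiable ℝ ψ := hψ1.differentiable one_ne_zero
  have hψ'c (a : E) : Continuous fun z => fderiv ℝ ψ z a :=
    (hψ1.continuous_fderiv one_ne_zero).clm_apply continuous_const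
  have hψ's (a : E) : HasCompactSupport fun z => fderiv ℝ ψ z a := hψ.2.1.fderiv_apply ℝ a
  have hsm (k : ℕ) {f : E → ℝ} (hf : LocallyIntegrable f) : ContDiff ℝ 1 (moll k f) :=
    (contDiff_moll k hf).of_le (by simp)
  have hbd {γ : ℝ → ℝ} (hγ : Continuous γ) : ∃ C, ∀ s, |s| ≤ |M| → |γ s| ≤ C := by
    obtain ⟨C, hC⟩ := isCompact_Icc.exists_bound_of_continuousOn (hγ.continuousOn (s := Icc (-|M|) |M|))
    exact ⟨C, fun s hs => hC s (abs_le.1 hs)⟩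
  -- the identity for the mollified functions
  have hmain : ∀ᶠ k in atTop, ∫ z, β (moll k U z) * fderiv ℝ ψ z v
      = -((∫ z, deriv β (moll k U z) * (fderiv ℝ ψ z w * moll k I z))
        + ∫ z, (deriv (deriv β) (moll k U z) * ψ z) * (moll k W z * moll k I z)) := by
    obtain ⟨δ, hδ, hδS⟩ := hψ.2.1.isCompact.exists_cthickening_subset_open hS hψ.2.2
    filter_upwards [(tendsto_mollBump_rOut E).eventually_lt_const hδ] with k hk
    have hball {z : E} (hz : z ∈ tsupport ψ) : Metric.closedBall z (mollBump E k).rOut ⊆ S :=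
      (Metric.closedBall_subset_closedBall hk.le).trans
        ((Metric.closedBall_subset_cthickening hz δ).trans hδS)
    have htest {z : E} (hz : z ∈ tsupport ψ) := isTestOn_mollBump (hball hz)
    -- On the support of ψ the mollified functions satisfy ∂_v u_k = -∂_w J_k and, below, ∂_w u_k =
    -- V_k in the classical sense.
    have d1 {z : E} (hz : z ∈ tsupport ψ) :
        fderiv ℝ (moll k U) z v = -fderiv ℝ (moll k I) z w := by
      have := huJ _ (htest hz)
      rw [setIntegral_eq_integral_indicator_mul hSm, setIntegral_eq_integral_indicator_mul hSm] at this
      simp only [fderiv_mollBump_sub, neg_mul, integral_neg] at this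
      rw [fderiv_moll k hUl, fderiv_moll k hIl]
      linarith
    have d2 {z : E} (hz : z ∈ tsupport ψ) : fderiv ℝ (moll k U) z w = moll k W z := by
      have := huV _ (htest hz)
      rw [setIntegral_eq_integral_indicator_mul hSm, setIntegral_eq_integral_indicator_mul hSm] at this
      simp only [fderiv_mollBump_sub, neg_mul, integral_neg] at this
      rw [fderiv_moll k hUl, moll_apply]
      linarith
    have hUs := hsm k hUl
    have hIs := hsm k hIl
    have hWs := hsm k hWl
    have hβU : ContDiff ℝ 1 fun z => β (moll k U z) := (hβ.of_le (by norm_num)).comp hUs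
    have hβ'U : ContDiff ℝ 1 fun z => deriv β (moll k U z) := hβ1.comp hUs
    have ci {f : E → ℝ} (hf : Continuous f) (hs : HasCompactSupport f) : Integrable f :=
      hf.integrable_of_hasCompactSupport hs
    have dβ (z a : E) : fderiv ℝ (fun z => β (moll k U z)) z a
        = deriv β (moll k U z) * fderiv ℝ (moll k U) z a := by
      have : HasFDerivAt (fun z => β (moll k U z)) _ z :=
        (hβd (moll k U z)).hasDerivAt.comp_hasFDerivAt z
          (hUs.differentiable one_ne_zero z).hasFDerivAt
      rw [this.fderiv]; simp
    have dβ' (z a : E) : fderiv ℝ (fun z => deriv β (moll k U z)) z a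
        = deriv (deriv β) (moll k U z) * fderiv ℝ (moll k U) z a := by
      have : HasFDerivAt (fun z => deriv β (moll k U z)) _ z :=
        (hβ1d (moll k U z)).hasDerivAt.comp_hasFDerivAt z
          (hUs.differentiable one_ne_zero z).hasFDerivAt
      rw [this.fderiv]; simp
    have fc {f : E → ℝ} (hf : ContDiff ℝ 1 f) (a : E) : Continuous fun z => fderiv ℝ f z a :=
      (hf.continuous_fderiv one_ne_zero).clm_apply continuous_const
    have s1 : ∫ z, β (moll k U z) * fderiv ℝ ψ z v
        = -∫ z, fderiv ℝ (fun z => β (moll k U z)) z v * ψ z :=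
      integral_mul_fderiv_eq_neg_fderiv_mul_of_integrable
        (ci ((fc hβU v).mul hψc) hψ.2.1.mul_left) (ci (hβU.continuous.mul (hψ'c v)) (hψ's v).mul_left)
        (ci (hβU.continuous.mul hψc) hψ.2.1.mul_left)
        (fun z _ => hβU.differentiable one_ne_zero z) (fun z _ => hψd z)
    have hG : ContDiff ℝ 1 fun z => deriv β (moll k U z) * ψ z := hβ'U.mul hψ1
    have hGs : HasCompactSupport fun z => deriv β (moll k U z) * ψ z := hψ.2.1.mul_left
    -- This moves ∂_w off the mollified flux. The derivative of β'(u_k) produces the term with β''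
    -- and ∂_w u_k = V_k.
    have s2 : ∫ z, (deriv β (moll k U z) * ψ z) * fderiv ℝ (moll k I) z w
        = -∫ z, fderiv ℝ (fun z => deriv β (moll k U z) * ψ z) z w * moll k I z :=
      integral_mul_fderiv_eq_neg_fderiv_mul_of_integrable
        (ci ((fc hG w).mul hIs.continuous) (hGs.fderiv_apply ℝ w).mul_right)
        (ci (hG.continuous.mul (fc hIs w)) hGs.mul_right)
        (ci (hG.continuous.mul hIs.continuous) hGs.mul_right)
        (fun z _ => hG.differentiable one_ne_zero z)
        (fun z _ => hIs.differentiable one_ne_zero z)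
    have e1 : ∫ z, fderiv ℝ (fun z => β (moll k U z)) z v * ψ z
        = -∫ z, (deriv β (moll k U z) * ψ z) * fderiv ℝ (moll k I) z w := by
      rw [← integral_neg]
      congr 1; funext z
      by_cases hz : z ∈ tsupport ψ
      · rw [dβ, d1 hz]; ring
      · rw [image_eq_zero_of_notMem_tsupport hz]; ring
    rw [s1, e1, neg_neg, s2, neg_inj, ← integral_add]
    · congr 1; funext z
      have hm : fderiv ℝ (fun z => deriv β (moll k U z) * ψ z) z w
          = deriv β (moll k U z) * fderiv ℝ ψ z w
            + ψ z * (deriv (deriv β) (moll k U z) * fderiv ℝ (moll k U) z w) := by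
        rw [fderiv_fun_mul (hβ'U.differentiable one_ne_zero z) (hψd z)]
        simp [dβ']
      rw [hm]
      by_cases hz : z ∈ tsupport ψ
      · rw [d2 hz]; ring
      · rw [image_eq_zero_of_notMem_tsupport hz]; ring
    · exact ci (hβ'U.continuous.mul ((hψ'c w).mul hIs.continuous)) (hψ's w).mul_right.mul_left
    · exact ci (((hβ2c.comp hUs.continuous).mul hψc).mul (hWs.continuous.mul hIs.continuous))
        (hψ.2.1.mul_left.mul_right)
  have hUlim := ae_tendsto_moll hUl
  have hUk (k : ℕ) (z : E) : |moll k U z| ≤ |M| := abs_moll_le k hUM z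
  have hUkc (k : ℕ) : Continuous (moll k U) := (hsm k hUl).continuous
  have lim1 : Tendsto (fun k => ∫ z, β (moll k U z) * fderiv ℝ ψ z v) atTop
      (𝓝 (∫ z, β (U z) * fderiv ℝ ψ z v)) := by
    obtain ⟨C, hC⟩ := hbd hβ.continuous
    refine tendsto_integral_of_dominated_convergence (fun z => C * ‖fderiv ℝ ψ z v‖)
      (fun k => ((hβ.continuous.comp (hUkc k)).mul (hψ'c v)).aestronglyMeasurable)
      (((hψ'c v).integrable_of_hasCompactSupport (hψ's v)).norm.const_mul C)
      (fun k => Eventually.of_forall fun z => ?_) ?_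
    · rw [norm_mul]
      exact mul_le_mul_of_nonneg_right (hC _ (hUk k z)) (norm_nonneg _)
    · filter_upwards [hUlim] with z hz
      exact ((hβ.continuous.tendsto _).comp hz).mul_const _
  have hI0 := tendsto_eLpNorm_moll_sub hI2
  have lim2 : Tendsto (fun k => ∫ z, deriv β (moll k U z) * (fderiv ℝ ψ z w * moll k I z)) atTop
      (𝓝 (∫ z, deriv β (U z) * (fderiv ℝ ψ z w * I z))) := by
    obtain ⟨C, hC⟩ := hbd hβ1.continuous
    have hψ2 : MemLp (fun z => fderiv ℝ ψ z w) 2 := (hψ'c w).memLp_of_hasCompactSupport (hψ's w)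
    exact tendsto_integral_mul_mul
      (fun k => (hβ1.continuous.comp (hUkc k)).aestronglyMeasurable)
      (fun k => Eventually.of_forall fun z => hC _ (hUk k z))
      (hUlim.mono fun z hz => (hβ1.continuous.tendsto _).comp hz)
      (fun _ => hψ2) hψ2 (by simp) (fun k => memLp_moll k hI2) hI2 hI0
  -- The product V_k J_k converges only in L¹, so the argument relies on β''(u_k) ψ being uniformly
  -- bounded, which the sup bound on `u` provides.
  have lim3 : Tendsto (fun k => ∫ z, (deriv (deriv β) (moll k U z) * ψ z)
      * (moll k W z * moll k I z)) atTop
      (𝓝 (∫ z, (deriv (deriv β) (U z) * ψ z) * (W z * I z))) := by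
    obtain ⟨C, hC⟩ := hbd hβ2c
    obtain ⟨D, hD⟩ := hψ.2.1.exists_bound_of_continuous hψc
    refine tendsto_integral_mul_mul (C := C * D)
      (fun k => ((hβ2c.comp (hUkc k)).mul hψc).aestronglyMeasurable)
      (fun k => Eventually.of_forall fun z => ?_)
      (hUlim.mono fun z hz => ((hβ2c.tendsto _).comp hz).mul_const _)
      (fun k => memLp_moll k hW2) hW2 (tendsto_eLpNorm_moll_sub hW2)
      (fun k => memLp_moll k hI2) hI2 hI0
    rw [abs_mul]
    have h1 := hC _ (hUk k z)
    exact mul_le_mul h1 (hD z) (abs_nonneg _) ((abs_nonneg _).trans h1)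
  have key := tendsto_nhds_unique (lim1.congr' hmain) (lim2.add lim3).neg
  have hz0 {z : E} (hz : z ∉ S) : z ∉ tsupport ψ := fun h => hz (hψ.2.2 h)
  have hz1 {z : E} (hz : z ∉ S) (a : E) : fderiv ℝ ψ z a = 0 := by
    rw [image_eq_zero_of_notMem_tsupport fun h => hz0 hz (tsupport_fderiv_subset ℝ h)]; rfl
  have hres {F G : E → ℝ} (hFG : ∀ z ∈ S, F z = G z) (hF : ∀ z, z ∉ S → F z = 0) :
      ∫ z, F z = ∫ z in S, G z := by
    rw [← setIntegral_eq_integral_of_forall_compl_eq_zero hF]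
    exact setIntegral_congr_fun hSm hFG
  rw [hres (G := fun z => β (u z) * fderiv ℝ ψ z v) (fun z hz => by simp [hU, hz])
    (fun z hz => by simp [hz1 hz]), ← integral_add] at key
  · rw [key, neg_inj]
    refine hres (fun z hz => ?_) (fun z hz => by simp [hI, hz])
    simp only [hU, hI, hW, hz, indicator_of_mem]
    ring
  · obtain ⟨C, hC⟩ := hbd hβ1.continuous
    have hψ2 : MemLp (fun z => fderiv ℝ ψ z w) 2 := (hψ'c w).memLp_of_hasCompactSupport (hψ's w)
    exact (hψ2.integrable_mul hI2).bdd_mul (c := C)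
      (hβ1.continuous.comp_aestronglyMeasurable hUi.1)
      (hUM.mono fun z hz => hC _ hz)
  · obtain ⟨C, hC⟩ := hbd hβ2c
    obtain ⟨D, hD⟩ := hψ.2.1.exists_bound_of_continuous hψc
    refine (hW2.integrable_mul hI2).bdd_mul (c := C * D)
      ((hβ2c.comp_aestronglyMeasurable hUi.1).mul hψc.aestronglyMeasurable)
      (hUM.mono fun z hz => ?_)
    rw [norm_mul]
    have h1 := hC _ hz
    exact mul_le_mul h1 (hD z) (norm_nonneg _) ((abs_nonneg _).trans h1)

end ChainRule

end

/-! ### Growth of the entropy and its compatibility with the mobility -/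

section

section Entropy

/-- The derivative of `Bfun`. -/
def bfun (n r : ℝ) : ℝ := ∫ v in Ioi r, 1 / (v ^ (n - 1) + v ^ 2)

theorem Bfun_eq (n s : ℝ) : Bfun n s = ∫ r in (0 : ℝ)..s, bfun n r := rfl

theorem bker_nonneg (n : ℝ) {v : ℝ} (hv : 0 < v) : 0 ≤ 1 / (v ^ (n - 1) + v ^ 2) := by positivity

/-- Keeping only v² controls the tail; the companion `bker_le_rpow` keeps only v^{n-1} and controls
the behaviour near the origin. -/
theorem bker_le_rpow_neg_two (n : ℝ) {v : ℝ} (hv : 0 < v) :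
    1 / (v ^ (n - 1) + v ^ 2) ≤ v ^ (-2 : ℝ) := by
  rw [Real.rpow_neg hv.le, Real.rpow_two, one_div]
  gcongr
  linarith [Real.rpow_nonneg hv.le (n - 1)]

theorem bker_le_rpow (n : ℝ) {v : ℝ} (hv : 0 < v) :
    1 / (v ^ (n - 1) + v ^ 2) ≤ v ^ (1 - n) := by
  rw [show 1 - n = -(n - 1) by ring, Real.rpow_neg hv.le, one_div]
  gcongr
  linarith [sq_nonneg v]

theorem continuousOn_bker (n : ℝ) :
    ContinuousOn (fun v : ℝ => 1 / (v ^ (n - 1) + v ^ 2)) (Ioi 0) := by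
  refine continuousOn_const.div (ContinuousOn.add (fun v hv => ?_) (by fun_prop)) fun v hv => ?_
  · exact (Real.continuousAt_rpow_const _ _ (Or.inl (ne_of_gt hv))).continuousWithinAt
  · have : 0 < v := hv
    positivity

theorem integrableOn_bker (n : ℝ) {r : ℝ} (hr : 0 < r) :
    IntegrableOn (fun v : ℝ => 1 / (v ^ (n - 1) + v ^ 2)) (Ioi r) := by
  refine (integrableOn_Ioi_rpow_of_lt (show (-2 : ℝ) < -1 by norm_num) hr).mono'
    (((continuousOn_bker n).mono (Ioi_subset_Ioi hr.le)).aestronglyMeasurable measurableSet_Ioi) ?_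
  refine (ae_restrict_mem measurableSet_Ioi).mono fun v hv => ?_
  have hv0 : 0 < v := hr.trans hv
  rw [Real.norm_of_nonneg (bker_nonneg n hv0)]
  exact bker_le_rpow_neg_two n hv0

theorem bfun_nonneg (n : ℝ) {r : ℝ} (hr : 0 ≤ r) : 0 ≤ bfun n r :=
  setIntegral_nonneg measurableSet_Ioi fun _ hv => bker_nonneg n (lt_of_le_of_lt hr hv)

theorem bfun_le_inv (n : ℝ) {r : ℝ} (hr : 0 < r) : bfun n r ≤ 1 / r := by
  have h2 : (-2 : ℝ) < -1 := by norm_num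
  calc bfun n r ≤ ∫ v in Ioi r, v ^ (-2 : ℝ) :=
        setIntegral_mono_on (integrableOn_bker n hr) (integrableOn_Ioi_rpow_of_lt h2 hr)
          measurableSet_Ioi fun v hv => bker_le_rpow_neg_two n (hr.trans hv)
    _ = 1 / r := by
        rw [integral_Ioi_rpow_of_lt h2 hr]
        norm_num [Real.rpow_neg_one]

/-- With the upper end fixed at `s`, the dependence on `r` sits in an interval integral.
Differentiation and the estimate near 0 both start from this splitting. -/
theorem bfun_eq_add (n : ℝ) {r s : ℝ} (hr : 0 < r) (hrs : r ≤ s) :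
    bfun n r = (∫ v in r..s, 1 / (v ^ (n - 1) + v ^ 2)) + bfun n s := by
  rw [intervalIntegral.integral_of_le hrs, bfun, bfun, ← Ioc_union_Ioi_eq_Ioi hrs]
  exact setIntegral_union (Ioc_disjoint_Ioi le_rfl) measurableSet_Ioi
    ((integrableOn_bker n hr).mono_set Ioc_subset_Ioi_self)
    (integrableOn_bker n (hr.trans_le hrs))

theorem hasDerivAt_bfun (n : ℝ) {r : ℝ} (hr : 0 < r) :
    HasDerivAt (bfun n) (-(1 / (r ^ (n - 1) + r ^ 2))) r := by
  have hc := continuousOn_bker n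
  have h1 : HasDerivAt (fun x => (∫ v in x..(r + 1), 1 / (v ^ (n - 1) + v ^ 2)) + bfun n (r + 1))
      (-(1 / (r ^ (n - 1) + r ^ 2))) r := by
    refine (intervalIntegral.integral_hasDerivAt_left ?_
      (hc.stronglyMeasurableAtFilter isOpen_Ioi r hr)
      (hc.continuousAt (Ioi_mem_nhds hr))).add_const _
    refine (hc.mono fun x hx => ?_).intervalIntegrable
    rw [uIcc_of_le (by linarith)] at hx
    exact hr.trans_le hx.1
  refine h1.congr_of_eventuallyEq ?_
  filter_upwards [Ioo_mem_nhds (show 0 < r from hr) (show r < r + 1 by linarith)] with x hx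
  exact bfun_eq_add n hx.1 hx.2.le

/-- The constant in the bound for `bfun` near the origin. -/
def bconst (n : ℝ) : ℝ := (2 - 2 * n / 3)⁻¹

theorem bconst_pos {n : ℝ} (hn3 : n < 3) : 0 < bconst n := by
  rw [bconst]; apply inv_pos.2; linarith

/-- Write v^{1-n} = v^{-n/3} v^{1-2n/3}. On v ≥ r the first factor is at most r^{-n/3}, and the
second is integrable at 0 because n < 3, with integral `bconst n` over (0,1). The exponent n/3 is
below 1, which makes `bfun` integrable at 0, and below n/2, which makes b² r^n bounded there. -/
theorem bfun_le {n : ℝ} (hn0 : 0 < n) (hn3 : n < 3) {r : ℝ} (hr : 0 < r) (hr1 : r ≤ 1) :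
    bfun n r ≤ 1 + bconst n * r ^ (-(n / 3)) := by
  rw [bfun_eq_add n hr hr1, add_comm]
  refine add_le_add ((bfun_le_inv n one_pos).trans (by norm_num)) ?_
  have hα : (-1 : ℝ) < 1 - 2 * n / 3 := by linarith
  have hi : IntervalIntegrable (fun v : ℝ => v ^ (1 - 2 * n / 3)) volume 0 1 :=
    intervalIntegral.intervalIntegrable_rpow' hα
  have hi' : IntervalIntegrable (fun v : ℝ => r ^ (-(n / 3)) * v ^ (1 - 2 * n / 3)) volume r 1 :=
    (hi.mono_set (by rw [uIcc_of_le hr1, uIcc_of_le zero_le_one]; exact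
      Icc_subset_Icc_left hr.le)).const_mul _
  have hib : IntervalIntegrable (fun v : ℝ => 1 / (v ^ (n - 1) + v ^ 2)) volume r 1 := by
    refine ((continuousOn_bker n).mono fun x hx => ?_).intervalIntegrable
    rw [uIcc_of_le hr1] at hx
    exact hr.trans_le hx.1
  calc ∫ v in r..1, 1 / (v ^ (n - 1) + v ^ 2)
      ≤ ∫ v in r..1, r ^ (-(n / 3)) * v ^ (1 - 2 * n / 3) := by
        refine intervalIntegral.integral_mono_on hr1 hib hi' fun v hv => ?_
        have hv0 : 0 < v := hr.trans_le hv.1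
        refine (bker_le_rpow n hv0).trans ?_
        rw [show 1 - n = -(n / 3) + (1 - 2 * n / 3) by ring, Real.rpow_add hv0]
        refine mul_le_mul_of_nonneg_right ?_ (Real.rpow_nonneg hv0.le _)
        exact Real.rpow_le_rpow_of_nonpos hr hv.1 (by linarith)
    _ = r ^ (-(n / 3)) * ∫ v in r..1, v ^ (1 - 2 * n / 3) := by
        rw [intervalIntegral.integral_const_mul]
    _ ≤ r ^ (-(n / 3)) * ∫ v in (0 : ℝ)..1, v ^ (1 - 2 * n / 3) := by
        refine mul_le_mul_of_nonneg_left ?_ (Real.rpow_nonneg hr.le _)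
        refine intervalIntegral.integral_mono_interval hr.le hr1 le_rfl ?_ hi
        refine (ae_restrict_mem measurableSet_Ioc).mono fun v hv => ?_
        exact Real.rpow_nonneg hv.1.le _
    _ = bconst n * r ^ (-(n / 3)) := by
        rw [integral_rpow (Or.inl hα), bconst, mul_comm]
        congr 1
        rw [Real.one_rpow, Real.zero_rpow (by linarith), sub_zero, one_div]
        congr 1; ring

theorem intervalIntegrable_bfun {n : ℝ} (hn0 : 0 < n) (hn3 : n < 3) {s : ℝ} (hs : 0 ≤ s) :
    IntervalIntegrable (bfun n) volume 0 s := by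
  have hc : ContinuousOn (bfun n) (Ioi 0) := fun r hr =>
    (hasDerivAt_bfun n hr).continuousAt.continuousWithinAt
  have h1 : IntervalIntegrable (bfun n) volume 0 1 := by
    have hg : IntervalIntegrable (fun r : ℝ => 1 + bconst n * r ^ (-(n / 3))) volume 0 1 :=
      intervalIntegrable_const.add
        ((intervalIntegral.intervalIntegrable_rpow' (by linarith)).const_mul _)
    rw [intervalIntegrable_iff_integrableOn_Ioc_of_le zero_le_one] at hg ⊢
    refine hg.mono' ((hc.mono Ioc_subset_Ioi_self).aestronglyMeasurable measurableSet_Ioc) ?_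
    refine (ae_restrict_mem measurableSet_Ioc).mono fun r hr => ?_
    rw [Real.norm_of_nonneg (bfun_nonneg n hr.1.le)]
    exact bfun_le hn0 hn3 hr.1 hr.2
  rcases le_total 1 s with h | h
  · refine h1.trans ((hc.mono fun x hx => ?_).intervalIntegrable)
    rw [uIcc_of_le h] at hx
    exact one_pos.trans_le hx.1
  · refine h1.mono_set ?_
    rw [uIcc_of_le hs, uIcc_of_le zero_le_one]
    exact Icc_subset_Icc_right h

theorem Bfun_nonneg (n : ℝ) {s : ℝ} (hs : 0 ≤ s) : 0 ≤ Bfun n s :=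
  intervalIntegral.integral_nonneg hs fun _ hr => bfun_nonneg n hr.1

theorem Bfun_mono {n : ℝ} (hn0 : 0 < n) (hn3 : n < 3) {s t : ℝ} (hs : 0 ≤ s) (hst : s ≤ t) :
    Bfun n s ≤ Bfun n t := by
  refine intervalIntegral.integral_mono_interval le_rfl hs hst ?_
    (intervalIntegrable_bfun hn0 hn3 (hs.trans hst))
  exact (ae_restrict_mem measurableSet_Ioc).mono fun v hv => bfun_nonneg n hv.1.le

theorem continuousOn_Bfun {n : ℝ} (hn0 : 0 < n) (hn3 : n < 3) :
    ContinuousOn (Bfun n) (Ici 0) := by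
  intro s hs
  have hs0 : (0 : ℝ) ≤ s := hs
  have hi := intervalIntegrable_bfun hn0 hn3 (show 0 ≤ s + 1 by linarith)
  have hc : ContinuousOn (Bfun n) (Icc 0 (s + 1)) := by
    have := intervalIntegral.continuousOn_primitive_interval' hi left_mem_uIcc
    rwa [uIcc_of_le (by linarith)] at this
  refine (hc s ⟨hs, by linarith⟩).mono_of_mem_nhdsWithin ?_
  rw [← Ici_inter_Iic]
  exact inter_mem self_mem_nhdsWithin (mem_nhdsWithin_of_mem_nhds (Iic_mem_nhds (by linarith)))

/-- Beyond 1 the derivative is at most 1/r. This logarithmic growth is what the normalising factor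
|ln ε|⁻¹ compensates. -/
theorem Bfun_le_log {n : ℝ} (hn0 : 0 < n) (hn3 : n < 3) {s : ℝ} (hs : 1 ≤ s) :
    Bfun n s ≤ Bfun n 1 + Real.log s := by
  have hi1 := intervalIntegrable_bfun hn0 hn3 zero_le_one
  have his := intervalIntegrable_bfun hn0 hn3 (zero_le_one.trans hs)
  have hi1s := hi1.symm.trans his
  rw [Bfun_eq, Bfun_eq, ← intervalIntegral.integral_add_adjacent_intervals hi1 hi1s]
  refine add_le_add_right ?_ _
  have h0 : (0 : ℝ) ∉ uIcc 1 s := by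
    rw [uIcc_of_le hs]; exact fun h => absurd h.1 (by norm_num)
  calc ∫ r in (1 : ℝ)..s, bfun n r ≤ ∫ r in (1 : ℝ)..s, 1 / r := by
        refine intervalIntegral.integral_mono_on hs hi1s ?_ fun r hr =>
          bfun_le_inv n (one_pos.trans_le hr.1)
        exact intervalIntegral.intervalIntegrable_one_div (fun x hx h => h0 (h ▸ hx)) continuousOn_id
    _ = Real.log s := by rw [integral_one_div h0, div_one]

/-- The constant in `bfun_sq_mul_le`. -/
def bconst' (n : ℝ) : ℝ := 2 + (1 + bconst n) ^ 2

/-- For r ≥ 1 one has r^n ≤ r³, and b ≤ 1/r leaves a factor r. For r ≤ 1 the singularity r^{-n/3} of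
b is absorbed by r^{n/2}. -/
theorem bfun_sq_mul_le {n : ℝ} (hn0 : 0 < n) (hn3 : n < 3) {r : ℝ} (hr : 0 < r) :
    bfun n r ^ 2 * (r ^ n + r ^ 3) ≤ bconst' n * (1 + r) := by
  have hC := bconst_pos hn3
  have hb0 := bfun_nonneg n hr.le
  have hb1 := bfun_le_inv n hr
  have h3 : bfun n r ^ 2 * r ^ 3 ≤ r := by
    calc bfun n r ^ 2 * r ^ 3 ≤ (1 / r) ^ 2 * r ^ 3 := by gcongr
      _ = r := by field_simp
  have hC' : 2 ≤ bconst' n := by rw [bconst']; linarith [sq_nonneg (1 + bconst n)]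
  rcases le_total 1 r with h | h
  · have : bfun n r ^ 2 * r ^ n ≤ bfun n r ^ 2 * r ^ 3 := by
      gcongr
      rw [← Real.rpow_natCast]
      exact Real.rpow_le_rpow_of_exponent_le h (by norm_num; exact hn3.le)
    nlinarith
  · have hp : r ^ n = (r ^ (n / 2)) ^ 2 := by
      rw [← Real.rpow_natCast, ← Real.rpow_mul hr.le]; congr 1; push_cast; ring
    have h1 : bfun n r * r ^ (n / 2) ≤ 1 + bconst n := by
      have e1 : r ^ (n / 2) ≤ 1 := Real.rpow_le_one hr.le h (by linarith)
      have e2 : r ^ (-(n / 3)) * r ^ (n / 2) ≤ 1 := by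
        rw [← Real.rpow_add hr]; exact Real.rpow_le_one hr.le h (by linarith)
      calc bfun n r * r ^ (n / 2) ≤ (1 + bconst n * r ^ (-(n / 3))) * r ^ (n / 2) :=
            mul_le_mul_of_nonneg_right (bfun_le hn0 hn3 hr h) (Real.rpow_nonneg hr.le _)
        _ = r ^ (n / 2) + bconst n * (r ^ (-(n / 3)) * r ^ (n / 2)) := by ring
        _ ≤ 1 + bconst n * 1 := by gcongr
        _ = 1 + bconst n := by ring
    have h2 : bfun n r ^ 2 * r ^ n ≤ (1 + bconst n) ^ 2 := by
      rw [hp, ← mul_pow]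
      exact pow_le_pow_left₀ (mul_nonneg hb0 (Real.rpow_nonneg hr.le _)) h1 2
    rw [mul_add, bconst']
    nlinarith [sq_nonneg (1 + bconst n)]

/-- The derivative of `Beps`. -/
def beps (n ε s : ℝ) : ℝ := |Real.log ε|⁻¹ * (ε⁻¹ * bfun n (s / ε))

variable {n ε : ℝ}

theorem beps_nonneg (n : ℝ) (hε : 0 < ε) {s : ℝ} (hs : 0 ≤ s) : 0 ≤ beps n ε s := by
  have := bfun_nonneg n (div_nonneg hs hε.le)
  rw [beps]; positivity

theorem Beps_eq_integral (n : ℝ) (hε : 0 < ε) (s : ℝ) :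
    Beps n ε s = ∫ σ in (0 : ℝ)..s, beps n ε σ := by
  simp only [beps]
  rw [intervalIntegral.integral_const_mul, intervalIntegral.integral_const_mul,
    intervalIntegral.integral_comp_div _ hε.ne', zero_div, smul_eq_mul, inv_mul_cancel_left₀ hε.ne']
  rfl

theorem intervalIntegrable_beps (hn0 : 0 < n) (hn3 : n < 3) (hε : 0 < ε) {s : ℝ} (hs : 0 ≤ s) :
    IntervalIntegrable (beps n ε) volume 0 s := by
  have := (intervalIntegrable_bfun hn0 hn3 (div_nonneg hs hε.le)).comp_mul_right (c := ε⁻¹)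
  rw [zero_div, div_inv_eq_mul, div_mul_cancel₀ _ hε.ne'] at this
  exact (this.const_mul ε⁻¹).const_mul _

theorem mobility_pos {s : ℝ} (hε : 0 < ε) (hs : 0 < s) : 0 < mobility n ε s := by
  have := Real.rpow_pos_of_pos hε (3 - n)
  have := Real.rpow_pos_of_pos hs n
  rw [mobility]; positivity

theorem mobility_nonneg {s : ℝ} (hε : 0 < ε) (hs : 0 ≤ s) : 0 ≤ mobility n ε s := by
  have := Real.rpow_nonneg hε.le (3 - n)
  have := Real.rpow_nonneg hs n
  rw [mobility]; positivity

/-- The power ε^{3-n} is chosen so that in the variable s/ε the mobility is ε³ times a function free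
of ε; estimates for general ε reduce to those for `bfun`. -/
theorem mobility_eq (n : ℝ) (hε : 0 < ε) {s : ℝ} (hs : 0 < s) :
    mobility n ε s = ε ^ 3 * ((s / ε) ^ n + (s / ε) ^ 3) := by
  rw [mobility, Real.div_rpow hs.le hε.le, Real.rpow_sub hε, mul_add]
  have := Real.rpow_pos_of_pos hε n
  congr 1
  · rw [show (3 : ℝ) = ((3 : ℕ) : ℝ) by norm_num, Real.rpow_natCast]
    field_simp
  · field_simp

/-- Since 1/(r^{n-1}+r²) = r/(r^n+r³), the second derivative of B^ε is -|ln ε|⁻¹ s/m(s). Multiplied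
by the flux it cancels the mobility and leaves -u u_xxx. -/
theorem hasDerivAt_beps (n : ℝ) (hε : 0 < ε) {s : ℝ} (hs : 0 < s) :
    HasDerivAt (beps n ε) (-(|Real.log ε|⁻¹ * (s / mobility n ε s))) s := by
  have hr : 0 < s / ε := div_pos hs hε
  have h1 : HasDerivAt (fun σ => bfun n (σ / ε)) _ s :=
    HasDerivAt.comp s (hasDerivAt_bfun n hr) ((hasDerivAt_id s).div_const ε)
  have h2 := (h1.const_mul ε⁻¹).const_mul |Real.log ε|⁻¹
  refine h2.congr_deriv ?_
  rw [mobility_eq n hε hs]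
  have e : (s / ε) ^ n = (s / ε) ^ (n - 1) * (s / ε) := by
    rw [← Real.rpow_add_one hr.ne']; congr 1; ring
  have hp := Real.rpow_pos_of_pos hr (n - 1)
  rw [e]
  generalize (s / ε) ^ (n - 1) = p at hp
  have : p * (s / ε) + (s / ε) ^ 3 = (p + (s / ε) ^ 2) * (s / ε) := by ring
  rw [this]
  field_simp

/-- This is the half of Young's inequality that complements the energy dissipation in the bound of
b(u) J. After scaling, the factor ε (1 + s/ε) = ε + s remains, and it is at most 1 + s. -/
theorem beps_sq_mul_mobility_le (hn0 : 0 < n) (hn3 : n < 3) (hε : 0 < ε) (hε1 : ε < 1) {s : ℝ}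
    (hs : 0 < s) :
    |Real.log ε| * (beps n ε s ^ 2 * mobility n ε s) ≤ |Real.log ε|⁻¹ * (bconst' n * (1 + s)) := by
  have hL : 0 < |Real.log ε| := abs_pos.2 (Real.log_neg hε hε1).ne
  have hb := bfun_sq_mul_le hn0 hn3 (div_pos hs hε)
  have hC : 0 < bconst' n := by rw [bconst']; positivity
  rw [mobility_eq n hε hs, beps]
  calc |Real.log ε| * ((|Real.log ε|⁻¹ * (ε⁻¹ * bfun n (s / ε))) ^ 2
        * (ε ^ 3 * ((s / ε) ^ n + (s / ε) ^ 3)))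
      = |Real.log ε|⁻¹ * (ε * (bfun n (s / ε) ^ 2 * ((s / ε) ^ n + (s / ε) ^ 3))) := by
        field_simp
    _ ≤ |Real.log ε|⁻¹ * (ε * (bconst' n * (1 + s / ε))) := by gcongr
    _ = |Real.log ε|⁻¹ * (bconst' n * (ε + s)) := by field_simp
    _ ≤ |Real.log ε|⁻¹ * (bconst' n * (1 + s)) := by gcongr

theorem Beps_nonneg (n : ℝ) (hε : 0 < ε) {s : ℝ} (hs : 0 ≤ s) : 0 ≤ Beps n ε s :=
  mul_nonneg (by positivity) (Bfun_nonneg n (div_nonneg hs hε.le))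

theorem continuousOn_Beps (hn0 : 0 < n) (hn3 : n < 3) (hε : 0 < ε) :
    ContinuousOn (Beps n ε) (Ici 0) :=
  continuousOn_const.mul ((continuousOn_Bfun hn0 hn3).comp (by fun_prop)
    fun _ hs => div_nonneg hs hε.le)

/-- Replacing `s` by 1 + M makes the argument (1+M)/ε at least 1, so the logarithmic bound applies.
Its contribution -ln ε is normalised to 1, and the rest is largest at ε = ε₀. -/
theorem Beps_le (hn0 : 0 < n) (hn3 : n < 3) {ε₀ M : ℝ} (hε : 0 < ε) (hεε₀ : ε ≤ ε₀) (hε₀ : ε₀ < 1)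
    {s : ℝ} (hs : 0 ≤ s) (hsM : s ≤ M) :
    Beps n ε s ≤ |Real.log ε₀|⁻¹ * (Bfun n 1 + Real.log (1 + M)) + 1 := by
  have hM : 0 ≤ M := hs.trans hsM
  have hlog : 0 < -Real.log ε₀ := neg_pos.2 (Real.log_neg (hε.trans_le hεε₀) hε₀)
  have hlog' : -Real.log ε₀ ≤ -Real.log ε := neg_le_neg (Real.log_le_log hε hεε₀)
  have h1 : Bfun n (s / ε) ≤ Bfun n ((1 + M) / ε) :=
    Bfun_mono hn0 hn3 (by positivity) (by gcongr; linarith)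
  have h2 : Bfun n ((1 + M) / ε) ≤ Bfun n 1 + Real.log ((1 + M) / ε) :=
    Bfun_le_log hn0 hn3 (by rw [le_div_iff₀ hε]; linarith)
  rw [Real.log_div (by positivity) hε.ne'] at h2
  have hB1 := Bfun_nonneg n zero_le_one
  have hlM : 0 ≤ Real.log (1 + M) := Real.log_nonneg (by linarith)
  rw [Beps, abs_of_neg (by linarith), abs_of_neg (by linarith)]
  have hL : 0 < -Real.log ε := by linarith
  calc (-Real.log ε)⁻¹ * Bfun n (s / ε)
      ≤ (-Real.log ε)⁻¹ * ((Bfun n 1 + Real.log (1 + M)) + -Real.log ε) := by gcongr; linarith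
    _ = (-Real.log ε)⁻¹ * (Bfun n 1 + Real.log (1 + M)) + 1 := by
        rw [mul_add, inv_mul_cancel₀ hL.ne']
    _ ≤ (-Real.log ε₀)⁻¹ * (Bfun n 1 + Real.log (1 + M)) + 1 := by gcongr

end Entropy

end

/-! ### Cutoffs near zero and the approximate entropy -/

section

section Cutoff

/-- A smooth cutoff that vanishes for `s ≤ δ` and equals `1` for `s ≥ 2δ`. -/
def cut (δ s : ℝ) : ℝ := Real.smoothTransition (s / δ - 1)

theorem contDiff_cut (δ : ℝ) : ContDiff ℝ ∞ (cut δ) :=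
  Real.smoothTransition.contDiff.comp ((contDiff_id.div_const δ).sub contDiff_const)

theorem cut_nonneg (δ s : ℝ) : 0 ≤ cut δ s := Real.smoothTransition.nonneg _

theorem cut_le_one (δ s : ℝ) : cut δ s ≤ 1 := Real.smoothTransition.le_one _

variable {δ : ℝ}

theorem cut_eq_zero (hδ : 0 < δ) {s : ℝ} (hs : s ≤ δ) : cut δ s = 0 :=
  Real.smoothTransition.zero_of_nonpos (by rw [sub_nonpos, div_le_one hδ]; exact hs)

theorem cut_eq_one (hδ : 0 < δ) {s : ℝ} (hs : 2 * δ ≤ s) : cut δ s = 1 :=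
  Real.smoothTransition.one_of_one_le (by
    rw [le_sub_iff_add_le, le_div_iff₀ hδ]; linarith)

theorem deriv_cut_eq_zero_of_lt (hδ : 0 < δ) {s : ℝ} (hs : s < δ) : deriv (cut δ) s = 0 := by
  have : cut δ =ᶠ[𝓝 s] fun _ => 0 := by
    filter_upwards [Iio_mem_nhds hs] with x hx
    exact cut_eq_zero hδ (le_of_lt hx)
  rw [this.deriv_eq, deriv_const]

theorem deriv_cut_eq_zero_of_gt (hδ : 0 < δ) {s : ℝ} (hs : 2 * δ < s) : deriv (cut δ) s = 0 := by
  have : cut δ =ᶠ[𝓝 s] fun _ => 1 := by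
    filter_upwards [Ioi_mem_nhds hs] with x hx
    exact cut_eq_one hδ (le_of_lt hx)
  rw [this.deriv_eq, deriv_const]

theorem deriv_cut (δ s : ℝ) : deriv (cut δ) s = deriv Real.smoothTransition (s / δ - 1) / δ := by
  have h1 : HasDerivAt Real.smoothTransition (deriv Real.smoothTransition (s / δ - 1)) (s / δ - 1) :=
    ((Real.smoothTransition.contDiff (n := 1)).differentiable one_ne_zero _).hasDerivAt
  have h2 := h1.comp s (((hasDerivAt_id s).div_const δ).sub_const 1)
  have : HasDerivAt (cut δ) (deriv Real.smoothTransition (s / δ - 1) * (1 / δ)) s := h2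
  rw [this.deriv]; ring

theorem deriv_cut_nonneg (hδ : 0 < δ) (s : ℝ) : 0 ≤ deriv (cut δ) s := by
  rw [deriv_cut]
  exact div_nonneg Real.smoothTransition.monotone.deriv_nonneg hδ.le

/-- The derivative of the cutoff is O(1/δ) and lives on δ ≤ s ≤ 2δ, so its product with `s` is
invariant under scaling and bounded independently of δ. -/
theorem exists_mul_deriv_cut_le : ∃ K : ℝ, 0 ≤ K ∧ ∀ δ : ℝ, 0 < δ → ∀ s, 0 ≤ s →
    s * deriv (cut δ) s ≤ K := by
  obtain ⟨C, hC⟩ := isCompact_Icc.exists_bound_of_continuousOn (s := Icc (0 : ℝ) 1)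
    ((Real.smoothTransition.contDiff (n := 1)).continuous_deriv le_rfl).continuousOn
  have hC0 : 0 ≤ C := (norm_nonneg _).trans (hC 0 ⟨le_rfl, zero_le_one⟩)
  refine ⟨2 * C, by positivity, fun δ hδ s hs => ?_⟩
  rcases lt_or_ge s δ with h | h
  · rw [deriv_cut_eq_zero_of_lt hδ h, mul_zero]; positivity
  rcases lt_or_ge (2 * δ) s with h' | h'
  · rw [deriv_cut_eq_zero_of_gt hδ h', mul_zero]; positivity
  · have h2 : s / δ ≤ 2 := by rw [div_le_iff₀ hδ]; exact h'
    have h1 : 1 ≤ s / δ := by rw [le_div_iff₀ hδ]; linarith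
    rw [deriv_cut, mul_div_assoc', mul_comm, mul_div_assoc, mul_comm]
    exact mul_le_mul h2 ((le_abs_self _).trans (hC _ ⟨by linarith, by linarith⟩))
      Real.smoothTransition.monotone.deriv_nonneg zero_le_two

/-- A smooth approximation of the identity on `[0, ∞)` that vanishes near the origin. -/
def idcut (δ s : ℝ) : ℝ := s * cut δ s

theorem contDiff_idcut (δ : ℝ) : ContDiff ℝ ∞ (idcut δ) := contDiff_id.mul (contDiff_cut δ)

theorem deriv_idcut (δ s : ℝ) : deriv (idcut δ) s = cut δ s + s * deriv (cut δ) s := by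
  have := (hasDerivAt_id s).mul ((contDiff_cut δ).differentiable (by simp) s).hasDerivAt
  have h : HasDerivAt (idcut δ) (1 * cut δ s + s * deriv (cut δ) s) s := this
  rw [h.deriv, one_mul]

theorem idcut_eq_zero (hδ : 0 < δ) {s : ℝ} (hs : s ≤ δ) : idcut δ s = 0 := by
  rw [idcut, cut_eq_zero hδ hs, mul_zero]

theorem idcut_eq_self (hδ : 0 < δ) {s : ℝ} (hs : 2 * δ ≤ s) : idcut δ s = s := by
  rw [idcut, cut_eq_one hδ hs, mul_one]

theorem idcut_nonneg {s : ℝ} (hs : 0 ≤ s) : 0 ≤ idcut δ s := mul_nonneg hs (cut_nonneg _ _)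

theorem idcut_le_self {s : ℝ} (hs : 0 ≤ s) : idcut δ s ≤ s :=
  mul_le_of_le_one_right hs (cut_le_one _ _)

theorem deriv_idcut_eq_one (hδ : 0 < δ) {s : ℝ} (hs : 2 * δ < s) : deriv (idcut δ) s = 1 := by
  rw [deriv_idcut, cut_eq_one hδ hs.le, deriv_cut_eq_zero_of_gt hδ hs, mul_zero, add_zero]

theorem cut_le_deriv_idcut (hδ : 0 < δ) {s : ℝ} (hs : 0 ≤ s) : cut δ s ≤ deriv (idcut δ) s := by
  rw [deriv_idcut]
  linarith [mul_nonneg hs (deriv_cut_nonneg hδ s)]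

/-- Uniformity in δ supplies the dominating constant when the cutoff is removed from the term with
u_x² u_xx. -/
theorem exists_abs_deriv_idcut_le : ∃ K : ℝ, ∀ δ : ℝ, 0 < δ → ∀ s, 0 ≤ s →
    |deriv (idcut δ) s| ≤ K := by
  obtain ⟨K, _, hK⟩ := exists_mul_deriv_cut_le
  refine ⟨1 + K, fun δ hδ s hs => ?_⟩
  rw [abs_of_nonneg ((cut_nonneg δ s).trans (cut_le_deriv_idcut hδ hs)), deriv_idcut]
  exact add_le_add (cut_le_one _ _) (hK δ hδ s hs)

end Cutoff

section ApproxEntropy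

variable {n ε M δ : ℝ}

theorem continuousOn_mobility (n ε : ℝ) : ContinuousOn (mobility n ε) (Ioi 0) := by
  refine (continuousOn_const.mul fun s hs => ?_).add (by fun_prop)
  exact (Real.continuousAt_rpow_const _ _ (Or.inl (ne_of_gt hs))).continuousWithinAt

/-- Minus the second derivative of the approximate entropy. -/
def kcut (n ε δ s : ℝ) : ℝ := |Real.log ε|⁻¹ * (idcut δ s / mobility n ε s)

theorem continuous_kcut (n : ℝ) (hε : 0 < ε) (hδ : 0 < δ) : Continuous (kcut n ε δ) := by
  rw [continuous_iff_continuousAt]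
  intro s
  rcases lt_or_ge s δ with h | h
  · refine (continuousAt_const (y := (0 : ℝ))).congr ?_
    filter_upwards [Iio_mem_nhds h] with x hx
    rw [kcut, idcut_eq_zero hδ (le_of_lt hx), zero_div, mul_zero]
  · have hs : 0 < s := hδ.trans_le h
    refine continuousAt_const.mul (((contDiff_idcut δ).continuous.continuousAt).div
      ((continuousOn_mobility n ε).continuousAt (Ioi_mem_nhds hs)) (mobility_pos hε hs).ne')

theorem kcut_nonneg (hε : 0 < ε) {s : ℝ} (hs : 0 ≤ s) : 0 ≤ kcut n ε δ s :=
  mul_nonneg (by positivity) (div_nonneg (idcut_nonneg hs) (mobility_nonneg hε hs))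

/-- The cancellation of the mobility survives the cutoff: the factor `s` merely becomes `idcut δ s`.
-/
theorem kcut_mul_mobility (hε : 0 < ε) {s : ℝ} (hs : 0 < s) :
    kcut n ε δ s * mobility n ε s = |Real.log ε|⁻¹ * idcut δ s := by
  rw [kcut, mul_assoc, div_mul_cancel₀ _ (mobility_pos hε hs).ne']

/-- The first derivative of the approximate entropy. -/
def dbeta (n ε M δ s : ℝ) : ℝ := beps n ε M + ∫ σ in s..M, kcut n ε δ σ

/-- The approximate entropy, obtained from `Beps` by cutting off its second derivative near the
origin. -/
def betaApprox (n ε M δ s : ℝ) : ℝ := ∫ σ in (0 : ℝ)..s, dbeta n ε M δ σ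

theorem hasDerivAt_dbeta (hε : 0 < ε) (hδ : 0 < δ) (s : ℝ) :
    HasDerivAt (dbeta n ε M δ) (-kcut n ε δ s) s := by
  have hc := continuous_kcut n hε hδ
  exact (intervalIntegral.integral_hasDerivAt_left (hc.intervalIntegrable _ _)
    hc.stronglyMeasurable.stronglyMeasurableAtFilter hc.continuousAt).const_add _

theorem continuous_dbeta (hε : 0 < ε) (hδ : 0 < δ) : Continuous (dbeta n ε M δ) :=
  continuous_iff_continuousAt.2 fun s => (hasDerivAt_dbeta hε hδ s).continuousAt

theorem hasDerivAt_betaApprox (hε : 0 < ε) (hδ : 0 < δ) (s : ℝ) :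
    HasDerivAt (betaApprox n ε M δ) (dbeta n ε M δ s) s :=
  ((continuous_dbeta hε hδ).integral_hasStrictDerivAt 0 s).hasDerivAt

theorem deriv_betaApprox (hε : 0 < ε) (hδ : 0 < δ) :
    deriv (betaApprox n ε M δ) = dbeta n ε M δ :=
  funext fun s => (hasDerivAt_betaApprox hε hδ s).deriv

theorem deriv_dbeta (hε : 0 < ε) (hδ : 0 < δ) :
    deriv (dbeta n ε M δ) = fun s => -kcut n ε δ s :=
  funext fun s => (hasDerivAt_dbeta hε hδ s).deriv

theorem contDiff_betaApprox (hε : 0 < ε) (hδ : 0 < δ) : ContDiff ℝ 2 (betaApprox n ε M δ) := by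
  have h1 : ContDiff ℝ 1 (dbeta n ε M δ) := by
    rw [contDiff_one_iff_deriv, deriv_dbeta hε hδ]
    exact ⟨fun s => (hasDerivAt_dbeta hε hδ s).differentiableAt, (continuous_kcut n hε hδ).neg⟩
  have : ContDiff ℝ (1 + 1) (betaApprox n ε M δ) := by
    rw [contDiff_succ_iff_deriv, deriv_betaApprox hε hδ]
    exact ⟨fun s => (hasDerivAt_betaApprox hε hδ s).differentiableAt, by simp, h1⟩
  simpa [one_add_one_eq_two] using this

/-- This puts `beps` into the form defining `dbeta`, with the same value at M and an explicit second
derivative, so that the two are compared through their integrands on [s, M]. -/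
theorem beps_eq_add (n : ℝ) (hε : 0 < ε) {s : ℝ} (hs : 0 < s) (hsM : s ≤ M) :
    beps n ε s = beps n ε M + ∫ σ in s..M, |Real.log ε|⁻¹ * (σ / mobility n ε σ) := by
  have hpos {σ : ℝ} (hσ : σ ∈ uIcc s M) : 0 < σ := by
    rw [uIcc_of_le hsM] at hσ; exact hs.trans_le hσ.1
  have hc : ContinuousOn (fun σ => -(|Real.log ε|⁻¹ * (σ / mobility n ε σ))) (uIcc s M) :=
    (continuousOn_const.mul (continuousOn_id.div ((continuousOn_mobility n ε).mono fun _ hσ =>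
      hpos hσ) fun σ hσ => (mobility_pos hε (hpos hσ)).ne')).neg
  have := intervalIntegral.integral_eq_sub_of_hasDerivAt
    (fun σ hσ => hasDerivAt_beps n hε (hpos hσ)) hc.intervalIntegrable
  rw [intervalIntegral.integral_neg] at this
  linarith

theorem dbeta_nonneg (hε : 0 < ε) {s : ℝ} (hs : 0 ≤ s) (hsM : s ≤ M) : 0 ≤ dbeta n ε M δ s :=
  add_nonneg (beps_nonneg n hε (hs.trans hsM))
    (intervalIntegral.integral_nonneg hsM fun _ hσ => kcut_nonneg hε (hs.trans hσ.1))

theorem dbeta_le (hε : 0 < ε) (hδ : 0 < δ) {s : ℝ} (hs : 0 < s) (hsM : s ≤ M) :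
    dbeta n ε M δ s ≤ beps n ε s := by
  rw [beps_eq_add n hε hs hsM, dbeta]
  refine add_le_add_right ?_ _
  have hc : ContinuousOn (fun σ => |Real.log ε|⁻¹ * (σ / mobility n ε σ)) (uIcc s M) := by
    rw [uIcc_of_le hsM]
    exact continuousOn_const.mul (continuousOn_id.div ((continuousOn_mobility n ε).mono fun _ hσ =>
      hs.trans_le hσ.1) fun σ hσ => (mobility_pos hε (hs.trans_le hσ.1)).ne')
  refine intervalIntegral.integral_mono_on hsM ((continuous_kcut n hε hδ).intervalIntegrable _ _)
    hc.intervalIntegrable fun σ hσ => ?_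
  have hσ0 : 0 < σ := hs.trans_le hσ.1
  have := mobility_pos (n := n) hε hσ0
  rw [kcut]
  gcongr
  exact idcut_le_self hσ0.le

/-- Because both functions are anchored at M rather than at 0, cutting off near the origin changes
nothing above 2δ. At a fixed positive `s` the approximation is thus eventually exact. -/
theorem dbeta_eq (hε : 0 < ε) (hδ : 0 < δ) {s : ℝ} (hs : 2 * δ ≤ s) (hsM : s ≤ M) :
    dbeta n ε M δ s = beps n ε s := by
  rw [beps_eq_add n hε (by linarith) hsM, dbeta]
  congr 1
  refine intervalIntegral.integral_congr fun σ hσ => ?_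
  rw [uIcc_of_le hsM] at hσ
  simp only [kcut]
  rw [idcut_eq_self hδ (hs.trans hσ.1)]

theorem betaApprox_nonneg (hε : 0 < ε) {s : ℝ} (hs : 0 ≤ s) (hsM : s ≤ M) :
    0 ≤ betaApprox n ε M δ s :=
  intervalIntegral.integral_nonneg hs fun _ hσ => dbeta_nonneg hε hσ.1 (hσ.2.trans hsM)

theorem betaApprox_le (hn0 : 0 < n) (hn3 : n < 3) (hε : 0 < ε) (hδ : 0 < δ) {s : ℝ} (hs : 0 ≤ s)
    (hsM : s ≤ M) : betaApprox n ε M δ s ≤ Beps n ε s := by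
  rw [Beps_eq_integral n hε, betaApprox]
  refine intervalIntegral.integral_mono_on_of_le_Ioo hs
    ((continuous_dbeta hε hδ).intervalIntegrable _ _) (intervalIntegrable_beps hn0 hn3 hε hs)
    fun σ hσ => dbeta_le hε hδ hσ.1 (hσ.2.le.trans hsM)

theorem tendsto_dbeta (hε : 0 < ε) {d : ℕ → ℝ} (hd : ∀ j, 0 < d j) (hd0 : Tendsto d atTop (𝓝 0))
    {s : ℝ} (hs : 0 < s) (hsM : s ≤ M) :
    Tendsto (fun j => dbeta n ε M (d j) s) atTop (𝓝 (beps n ε s)) := by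
  refine tendsto_const_nhds.congr' ?_
  filter_upwards [hd0.eventually_lt_const (half_pos hs)] with j hj
  rw [dbeta_eq hε (hd j) (by linarith) hsM]

/-- The derivatives lie between 0 and `beps`, which is integrable at 0 for n < 3; dominated
convergence applies. -/
theorem tendsto_betaApprox (hn0 : 0 < n) (hn3 : n < 3) (hε : 0 < ε) {d : ℕ → ℝ}
    (hd : ∀ j, 0 < d j) (hd0 : Tendsto d atTop (𝓝 0)) {s : ℝ} (hs : 0 ≤ s) (hsM : s ≤ M) :
    Tendsto (fun j => betaApprox n ε M (d j) s) atTop (𝓝 (Beps n ε s)) := by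
  rw [Beps_eq_integral n hε]
  refine intervalIntegral.tendsto_integral_filter_of_dominated_convergence (beps n ε)
    (Eventually.of_forall fun j => (continuous_dbeta hε (hd j)).aestronglyMeasurable)
    (Eventually.of_forall fun j => Eventually.of_forall fun σ hσ => ?_)
    (intervalIntegrable_beps hn0 hn3 hε hs) (Eventually.of_forall fun σ hσ => ?_)
  all_goals rw [uIoc_of_le hs] at hσ
  · rw [Real.norm_of_nonneg (dbeta_nonneg hε hσ.1.le (hσ.2.trans hsM))]
    exact dbeta_le hε (hd j) hσ.1 (hσ.2.trans hsM)
  · exact tendsto_dbeta hε hd hd0 hσ.1 (hσ.2.trans hsM)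

end ApproxEntropy

end

/-! ### Integration by parts on the positivity set at fixed time -/

section

section Slice

variable {a b : ℝ} {u ux uxx uxxx : ℝ → ℝ}

theorem posSet_subset (a b : ℝ) (u : ℝ → ℝ) : posSet a b u ⊆ Ioo a b := fun _ hx => hx.1

theorem isOpen_posSet (hc : ContinuousOn u (Icc a b)) : IsOpen (posSet a b u) :=
  (hc.mono Ioo_subset_Icc_self).isOpen_inter_preimage isOpen_Ioo isOpen_Ioi

/-- Twice continuously differentiable representatives on the positivity set. -/
theorem exists_slice_representatives (hc : ContinuousOn u (Icc a b))
    (h1 : HasWeakDerivOn (Ioo a b) u ux) (h2 : HasWeakDerivOn (posSet a b u) ux uxx)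
    (h3 : HasWeakDerivOn (posSet a b u) uxx uxxx) :
    ∃ v w : ℝ → ℝ, (∀ x ∈ posSet a b u, HasDerivAt u (v x) x) ∧
      (∀ x ∈ posSet a b u, HasDerivAt v (w x) x) ∧ ContinuousOn w (posSet a b u) ∧
      (∀ᵐ x, x ∈ posSet a b u → ux x = v x) ∧ (∀ᵐ x, x ∈ posSet a b u → uxx x = w x) := by
  have hP := isOpen_posSet hc
  obtain ⟨w, hw, hwi⟩ := h3.exists_representative hP
  obtain ⟨v, hv, hvi⟩ := h2.exists_representative hP
  have hwc := continuousOn_of_sub_eq_integral hP h3.2.1 hwi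
  -- `w` is continuous because it is a primitive of `uxxx`; `v`, a primitive of it, is therefore C¹.
  have hvd : ∀ x ∈ posSet a b u, HasDerivAt v (w x) x := fun x hx =>
    hasDerivAt_of_sub_eq_integral hP hwc (fun s t hst => by
      rw [hvi s t hst]
      refine intervalIntegral.integral_congr_ae ?_
      filter_upwards [hw] with x hx hxst
      exact (hx (hst (uIoc_subset_uIcc hxst))).symm) hx
  have hvc : ContinuousOn v (posSet a b u) := fun x hx => (hvd x hx).continuousAt.continuousWithinAt
  obtain ⟨U, hU, hUi⟩ := h1.exists_representative isOpen_Ioo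
  have hUc := continuousOn_of_sub_eq_integral isOpen_Ioo h1.2.1 hUi
  -- Two continuous functions that agree almost everywhere on an open interval agree everywhere, so
  -- `u` itself is the representative.
  have hUu : ∀ x ∈ Ioo a b, U x = u x :=
    Measure.eqOn_open_of_ae_eq ((ae_restrict_iff' measurableSet_Ioo).2 hU) isOpen_Ioo hUc
      (hc.mono Ioo_subset_Icc_self)
  refine ⟨v, w, fun x hx => ?_, hvd, hwc, hv.mono fun x h hx => (h hx).symm,
    hw.mono fun x h hx => (h hx).symm⟩
  refine hasDerivAt_of_sub_eq_integral hP hvc (fun s t hst => ?_) hx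
  rw [← hUu _ (hst right_mem_uIcc).1, ← hUu _ (hst left_mem_uIcc).1,
    hUi s t (hst.trans (posSet_subset a b u))]
  refine intervalIntegral.integral_congr_ae ?_
  filter_upwards [hv] with x hx hxst
  exact (hx (hst (uIoc_subset_uIcc hxst))).symm

/-- A test function times a function of `u` that vanishes for u ≤ δ is zero off this set. For δ > 0
the set is a compact part of {u > 0}, away from the free boundary. -/
theorem isCompact_tsupport_inter_le (hc : ContinuousOn u (Icc a b)) {φ : ℝ → ℝ}
    (hφ : IsTestFun (Ioo a b) φ) (δ : ℝ) : IsCompact (tsupport φ ∩ {x | δ ≤ u x}) := by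
  have : IsClosed (tsupport φ ∩ u ⁻¹' Ici δ) :=
    (hc.mono (hφ.2.2.trans Ioo_subset_Icc_self)).preimage_isClosed_of_isClosed (isClosed_tsupport _)
      isClosed_Ici
  exact hφ.2.1.isCompact.of_isClosed_subset this inter_subset_left

theorem tsupport_inter_le_subset {φ : ℝ → ℝ} (hφ : IsTestFun (Ioo a b) φ) {δ : ℝ} (hδ : 0 < δ) :
    tsupport φ ∩ {x | δ ≤ u x} ⊆ posSet a b u :=
  fun _ hx => ⟨hφ.2.2 hx.1, hδ.trans_le hx.2⟩

/-- Integration by parts on the positivity set. -/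
theorem slice_integral_by_parts (hc : ContinuousOn u (Icc a b))
    (h1 : HasWeakDerivOn (Ioo a b) u ux) (h2 : HasWeakDerivOn (posSet a b u) ux uxx)
    (h3 : HasWeakDerivOn (posSet a b u) uxx uxxx) {G : ℝ → ℝ} (hG : ContDiff ℝ 1 G) {δ : ℝ}
    (hδ : 0 < δ) (hGδ : ∀ s ≤ δ, G s = 0) {φ : ℝ → ℝ} (hφ : IsTestFun (Ioo a b) φ) :
    ∫ x in posSet a b u, φ x * G (u x) * ux x * uxxx x
      = -∫ x in posSet a b u, (deriv φ x * G (u x) * ux x * uxx x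
          + φ x * deriv G (u x) * ux x ^ 2 * uxx x + φ x * G (u x) * uxx x ^ 2) := by
  have hP := isOpen_posSet hc
  obtain ⟨v, w, huv, hvw, hwc, hv, hw⟩ := exists_slice_representatives hc h1 h2 h3
  have huc : ContinuousOn u (posSet a b u) := fun x hx => (huv x hx).continuousAt.continuousWithinAt
  have hvc : ContinuousOn v (posSet a b u) := fun x hx => (hvw x hx).continuousAt.continuousWithinAt
  have hG' := hG.continuous_deriv le_rfl
  have hder (x) (hx : x ∈ posSet a b u) : HasDerivAt (fun x => φ x * G (u x) * v x)
      ((deriv φ x * G (u x) + φ x * (deriv G (u x) * v x)) * v x + φ x * G (u x) * w x) x :=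
    ((hφ.differentiable x).hasDerivAt.mul
      ((hG.differentiable one_ne_zero (u x)).hasDerivAt.comp x (huv x hx))).mul (hvw x hx)
  -- φ G(u) u_x, extended by zero, is a C¹ function compactly supported in {u > 0}; it is used as
  -- test function for the weak derivative `uxxx` of `uxx`.
  obtain ⟨hF, hF', hFs, hFP⟩ := contDiff_one_indicator hP
    (isCompact_tsupport_inter_le hc hφ δ) (tsupport_inter_le_subset hφ hδ) hder
    (by
      have c1 := hφ.continuous_deriv.continuousOn (s := posSet a b u)
      have c2 := hφ.continuous.continuousOn (s := posSet a b u)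
      have c3 : ContinuousOn (fun x => G (u x)) (posSet a b u) := hG.continuous.comp_continuousOn huc
      have c4 : ContinuousOn (fun x => deriv G (u x)) (posSet a b u) := hG'.comp_continuousOn huc
      exact (((c1.mul c3).add (c2.mul (c4.mul hvc))).mul hvc).add ((c2.mul c3).mul hwc))
    (fun x hx hxK => by
      by_cases hxφ : x ∈ tsupport φ
      · have : u x ≤ δ := le_of_not_ge fun h => hxK ⟨hxφ, h⟩
        rw [hGδ _ this]; ring
      · rw [image_eq_zero_of_notMem_tsupport hxφ]; ring)
  have key := h3.integral_deriv_smul hP hF hFs hFP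
  rw [hF', ← neg_eq_iff_eq_neg] at key
  have e1 : ∫ x in posSet a b u, φ x * G (u x) * ux x * uxxx x
      = ∫ x in posSet a b u, (posSet a b u).indicator (fun x => φ x * G (u x) * v x) x • uxxx x := by
    refine setIntegral_congr_ae hP.measurableSet ?_
    filter_upwards [hv] with x hx hxP
    rw [indicator_of_mem hxP, hx hxP, smul_eq_mul]
  rw [e1, ← key, neg_inj]
  refine setIntegral_congr_ae hP.measurableSet ?_
  filter_upwards [hv, hw] with x hx hx' hxP
  rw [indicator_of_mem hxP, hx hxP, hx' hxP, smul_eq_mul]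
  ring

/-- Integration by parts for `u_x²u_xx` if `u_x⁴/u` is integrable. -/
theorem slice_cube_of_integrable (hc : ContinuousOn u (Icc a b))
    (h1 : HasWeakDerivOn (Ioo a b) u ux) (h2 : HasWeakDerivOn (posSet a b u) ux uxx)
    (h3 : HasWeakDerivOn (posSet a b u) uxx uxxx)
    (hi1 : IntegrableOn (fun x => ux x ^ 2 * uxx x) (posSet a b u))
    (hi2 : IntegrableOn (fun x => ux x ^ 4 / u x) (posSet a b u))
    (hi3 : IntegrableOn (fun x => ux x ^ 3) (posSet a b u))
    {φ : ℝ → ℝ} (hφ : IsTestFun (Ioo a b) φ) :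
    ∫ x in posSet a b u, φ x * (ux x ^ 2 * uxx x)
      = -∫ x in posSet a b u, deriv φ x * (ux x ^ 3 / 3) := by
  have hP := isOpen_posSet hc
  obtain ⟨v, w, huv, hvw, hwc, hv, hw⟩ := exists_slice_representatives hc h1 h2 h3
  have huc : ContinuousOn u (posSet a b u) := fun x hx => (huv x hx).continuousAt.continuousWithinAt
  have hvc : ContinuousOn v (posSet a b u) := fun x hx => (hvw x hx).continuousAt.continuousWithinAt
  obtain ⟨C, hC⟩ := hφ.2.1.exists_bound_of_continuous hφ.continuous
  obtain ⟨C', hC'⟩ := hφ.2.1.deriv.exists_bound_of_continuous hφ.continuous_deriv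
  obtain ⟨K, hK0, hK⟩ := exists_mul_deriv_cut_le
  have hC0 : 0 ≤ C := (norm_nonneg _).trans (hC 0)
  set d : ℕ → ℝ := fun j => 1 / ((j : ℝ) + 1) with hd
  have hd0 (j : ℕ) : 0 < d j := by positivity
  have hdl : Tendsto d atTop (𝓝 0) := tendsto_one_div_add_atTop_nhds_zero_nat
  have hev {s : ℝ} (hs : 0 < s) : ∀ᶠ j in atTop, 2 * d j < s := by
    filter_upwards [hdl.eventually_lt_const (half_pos hs)] with j hj
    linarith
  have hcutm (j : ℕ) : ContinuousOn (fun x => cut (d j) (u x)) (posSet a b u) :=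
    (contDiff_cut (d j)).continuous.comp_continuousOn huc
  have hcutm' (j : ℕ) : ContinuousOn (fun x => deriv (cut (d j)) (u x)) (posSet a b u) :=
    ((contDiff_cut (d j)).continuous_deriv (by simp)).comp_continuousOn huc
  have hφm := hφ.continuous.continuousOn (s := posSet a b u)
  have hφm' := hφ.continuous_deriv.continuousOn (s := posSet a b u)
  have asm {f : ℝ → ℝ} (hf : ContinuousOn f (posSet a b u)) :
      AEStronglyMeasurable f (volume.restrict (posSet a b u)) :=
    hf.aestronglyMeasurable hP.measurableSet
  -- integrands
  set A : ℕ → ℝ → ℝ := fun j x => deriv φ x * cut (d j) (u x) * (ux x ^ 3) with hA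
  set B : ℕ → ℝ → ℝ := fun j x => φ x * (u x * deriv (cut (d j)) (u x)) * (ux x ^ 4 / u x) with hB
  set D : ℕ → ℝ → ℝ := fun j x => φ x * cut (d j) (u x) * (ux x ^ 2 * uxx x) with hD
  have habs (j : ℕ) (s : ℝ) : |cut (d j) s| ≤ 1 := by
    rw [abs_of_nonneg (cut_nonneg _ _)]; exact cut_le_one _ _
  have bA (j : ℕ) : ∀ x, ‖A j x‖ ≤ C' * ‖ux x ^ 3‖ := fun x => by
    rw [hA, norm_mul, norm_mul]
    refine mul_le_mul_of_nonneg_right ?_ (norm_nonneg _)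
    exact (mul_le_of_le_one_right (norm_nonneg _) (habs j _)).trans (hC' x)
  have bB (j : ℕ) : ∀ x ∈ posSet a b u, ‖B j x‖ ≤ C * K * ‖ux x ^ 4 / u x‖ := fun x hx => by
    rw [hB, norm_mul, norm_mul]
    refine mul_le_mul_of_nonneg_right (mul_le_mul (hC x) ?_ (norm_nonneg _) hC0) (norm_nonneg _)
    rw [Real.norm_of_nonneg (mul_nonneg hx.2.le (deriv_cut_nonneg (hd0 j) _))]
    exact hK _ (hd0 j) _ hx.2.le
  have bD (j : ℕ) : ∀ x, ‖D j x‖ ≤ C * ‖ux x ^ 2 * uxx x‖ := fun x => by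
    rw [hD, norm_mul, norm_mul]
    refine mul_le_mul_of_nonneg_right ?_ (norm_nonneg _)
    exact (mul_le_of_le_one_right (norm_nonneg _) (habs j _)).trans (hC x)
  have mA (j : ℕ) : AEStronglyMeasurable (A j) (volume.restrict (posSet a b u)) :=
    ((asm hφm').mul (asm (hcutm j))).mul hi3.1
  have mB (j : ℕ) : AEStronglyMeasurable (B j) (volume.restrict (posSet a b u)) :=
    ((asm hφm).mul ((asm huc).mul (asm (hcutm' j)))).mul hi2.1
  have mD (j : ℕ) : AEStronglyMeasurable (D j) (volume.restrict (posSet a b u)) :=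
    ((asm hφm).mul (asm (hcutm j))).mul hi1.1
  have iA (j : ℕ) : IntegrableOn (A j) (posSet a b u) :=
    (hi3.norm.const_mul C').mono' (mA j) (Eventually.of_forall (bA j))
  have iB (j : ℕ) : IntegrableOn (B j) (posSet a b u) :=
    (hi2.norm.const_mul (C * K)).mono' (mB j)
      ((ae_restrict_mem hP.measurableSet).mono (bB j))
  have iD (j : ℕ) : IntegrableOn (D j) (posSet a b u) :=
    (hi1.norm.const_mul C).mono' (mD j) (Eventually.of_forall (bD j))
  -- The derivative of φ · cut(u) · u_x³ integrates to zero. `B` collects the part where the cutoff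
  -- is differentiated, rewritten as u cut'(u) times u_x⁴/u so that its first factor is bounded
  -- uniformly in `j`.
  have hzero (j : ℕ) : (∫ x in posSet a b u, A j x) + (∫ x in posSet a b u, B j x)
      + 3 * ∫ x in posSet a b u, D j x = 0 := by
    have hder (x) (hx : x ∈ posSet a b u) : HasDerivAt (fun x => φ x * cut (d j) (u x) * v x ^ 3)
        ((deriv φ x * cut (d j) (u x) + φ x * (deriv (cut (d j)) (u x) * v x)) * v x ^ 3
          + φ x * cut (d j) (u x) * (3 * v x ^ 2 * w x)) x := by
      have := ((hφ.differentiable x).hasDerivAt.mul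
        (((contDiff_cut (d j)).differentiable (by simp) (u x)).hasDerivAt.comp x (huv x hx))).mul
          ((hvw x hx).pow 3)
      refine this.congr_deriv ?_
      norm_num
    have := setIntegral_deriv_eq_zero hP
      (isCompact_tsupport_inter_le hc hφ (d j)) (tsupport_inter_le_subset hφ (hd0 j)) hder
      (by have := hcutm j; have := hcutm' j; fun_prop)
      (fun x hx hxK => by
        by_cases hxφ : x ∈ tsupport φ
        · have : u x ≤ d j := le_of_not_ge fun h => hxK ⟨hxφ, h⟩
          rw [cut_eq_zero (hd0 j) this]; ring
        · rw [image_eq_zero_of_notMem_tsupport hxφ]; ring)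
    have iAB : IntegrableOn (fun x => A j x + B j x) (posSet a b u) := (iA j).add (iB j)
    rw [← this, ← integral_const_mul, ← integral_add (iA j) (iB j),
      ← integral_add iAB ((iD j).const_mul 3)]
    refine setIntegral_congr_ae hP.measurableSet ?_
    filter_upwards [hv, hw] with x hx hx' hxP
    have hu0 : u x ≠ 0 := ne_of_gt hxP.2
    simp only [hA, hB, hD]
    rw [hx hxP, hx' hxP]
    field_simp
  have lA : Tendsto (fun j => ∫ x in posSet a b u, A j x) atTop
      (𝓝 (∫ x in posSet a b u, deriv φ x * ux x ^ 3)) := by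
    refine tendsto_integral_of_dominated_convergence _ mA (hi3.norm.const_mul C')
      (fun j => Eventually.of_forall (bA j)) ((ae_restrict_mem hP.measurableSet).mono fun x hx => ?_)
    refine tendsto_const_nhds.congr' ?_
    filter_upwards [hev hx.2] with j hj
    simp only [hA]; rw [cut_eq_one (hd0 j) hj.le, mul_one]
  -- At each point of positivity the derivative of the cutoff is eventually zero; integrability of
  -- u_x⁴/u provides the domination.
  have lB : Tendsto (fun j => ∫ x in posSet a b u, B j x) atTop (𝓝 0) := by
    rw [← integral_zero ℝ ℝ (μ := volume.restrict (posSet a b u))]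
    refine tendsto_integral_of_dominated_convergence _ mB (hi2.norm.const_mul (C * K))
      (fun j => (ae_restrict_mem hP.measurableSet).mono (bB j))
      ((ae_restrict_mem hP.measurableSet).mono fun x hx => ?_)
    refine tendsto_const_nhds.congr' ?_
    filter_upwards [hev hx.2] with j hj
    simp only [hB]; rw [deriv_cut_eq_zero_of_gt (hd0 j) hj]; ring
  have lD : Tendsto (fun j => ∫ x in posSet a b u, D j x) atTop
      (𝓝 (∫ x in posSet a b u, φ x * (ux x ^ 2 * uxx x))) := by
    refine tendsto_integral_of_dominated_convergence _ mD (hi1.norm.const_mul C)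
      (fun j => Eventually.of_forall (bD j)) ((ae_restrict_mem hP.measurableSet).mono fun x hx => ?_)
    refine tendsto_const_nhds.congr' ?_
    filter_upwards [hev hx.2] with j hj
    simp only [hD]; rw [cut_eq_one (hd0 j) hj.le, mul_one]
  have := tendsto_nhds_unique ((lA.add lB).add (lD.const_mul 3))
    (tendsto_const_nhds.congr fun j => (hzero j).symm)
  have e : ∫ x in posSet a b u, deriv φ x * (ux x ^ 3 / 3)
      = (∫ x in posSet a b u, deriv φ x * ux x ^ 3) / 3 := by
    rw [← integral_div]; congr 1; funext x; ring
  rw [e]; linarith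

/-- Integration by parts for `u_x²u_xx` if `u_x` has a weak derivative on the whole interval. -/
theorem slice_cube_of_weakDeriv (hc : ContinuousOn u (Icc a b)) (h0 : ∀ x ∈ Icc a b, 0 ≤ u x)
    (h1 : HasWeakDerivOn (Ioo a b) u ux) (h2 : HasWeakDerivOn (posSet a b u) ux uxx)
    {w : ℝ → ℝ} (hw : HasWeakDerivOn (Ioo a b) ux w)
    {φ : ℝ → ℝ} (hφ : IsTestFun (Ioo a b) φ) :
    ∫ x in posSet a b u, φ x * (ux x ^ 2 * uxx x)
      = -∫ x in posSet a b u, deriv φ x * (ux x ^ 3 / 3) := by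
  have hP := isOpen_posSet hc
  rcases (Ioo a b).eq_empty_or_nonempty with hemp | ⟨x₀, hx₀⟩
  · have : posSet a b u = ∅ := subset_eq_empty (posSet_subset a b u) hemp
    simp [this]
  obtain ⟨v, hv, hvi⟩ := hw.exists_representative isOpen_Ioo
  have hvc := continuousOn_of_sub_eq_integral isOpen_Ioo hw.2.1 hvi
  obtain ⟨U, hU, hUi⟩ := h1.exists_representative isOpen_Ioo
  have hUc := continuousOn_of_sub_eq_integral isOpen_Ioo h1.2.1 hUi
  have hUu : ∀ x ∈ Ioo a b, U x = u x :=
    Measure.eqOn_open_of_ae_eq ((ae_restrict_iff' measurableSet_Ioo).2 hU) isOpen_Ioo hUc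
      (hc.mono Ioo_subset_Icc_self)
  have hud (x) (hx : x ∈ Ioo a b) : HasDerivAt u (v x) x := by
    have : HasDerivAt U (v x) x := by
      refine hasDerivAt_of_sub_eq_integral isOpen_Ioo hvc (fun s t hst => ?_) hx
      rw [hUi s t hst]
      refine intervalIntegral.integral_congr_ae ?_
      filter_upwards [hv] with x hx hxst
      exact (hx (hst (uIoc_subset_uIcc hxst))).symm
    refine this.congr_of_eventuallyEq ?_
    filter_upwards [isOpen_Ioo.mem_nhds hx] with y hy
    exact (hUu y hy).symm
  -- At a zero of the non-negative, differentiable function `u` there is a local minimum, so u_x =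
  -- 0. Integrals over {u > 0} containing u_x may therefore be extended to the whole interval.
  have hv0 (x) (hx : x ∈ Ioo a b) (hxP : x ∉ posSet a b u) : v x = 0 := by
    have hux : u x = 0 := le_antisymm (not_lt.1 fun h => hxP ⟨hx, h⟩) (h0 x (Ioo_subset_Icc_self hx))
    refine IsLocalMin.hasDerivAt_eq_zero ?_ (hud x hx)
    filter_upwards [isOpen_Ioo.mem_nhds hx] with y hy
    rw [hux]; exact h0 y (Ioo_subset_Icc_self hy)
  have hwxx : ∀ᵐ x, x ∈ posSet a b u → uxx x = w x :=
    h2.ae_eq hP (hw.mono (posSet_subset a b u)) (Eventually.of_forall fun _ _ => rfl)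
  -- a compact interval containing the support of the test function
  obtain ⟨c, d, hcd, hcdI, hφcd⟩ : ∃ c d, c ≤ d ∧ Icc c d ⊆ Ioo a b ∧ tsupport φ ⊆ Ioo c d := by
    rcases (tsupport φ).eq_empty_or_nonempty with he | hne
    · exact ⟨x₀, x₀, le_rfl, by simpa using hx₀, by simp [he]⟩
    · obtain ⟨m, hm, hm'⟩ := hφ.2.1.isCompact.exists_isLeast hne
      obtain ⟨l, hl, hl'⟩ := hφ.2.1.isCompact.exists_isGreatest hne
      have h1 := hφ.2.2 hm
      have h2 := hφ.2.2 hl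
      have h3 : m ≤ l := hm' hl
      refine ⟨(a + m) / 2, (l + b) / 2, by linarith [h1.1, h2.2], fun x hx => ?_, fun x hx => ?_⟩
      · exact ⟨by linarith [hx.1, h1.1], by linarith [hx.2, h2.2]⟩
      · exact ⟨by linarith [hm' hx, h1.1], by linarith [hl' hx, h2.2]⟩
  have hwi : IntervalIntegrable w volume c d :=
    intervalIntegrable_of_uIcc_subset hw.2.1 (by rwa [uIcc_of_le hcd])
  -- The second derivative is only integrable, so u_x is absolutely continuous and not necessarily
  -- C¹; integration by parts for absolutely continuous functions replaces the classical one.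
  set V : ℝ → ℝ := fun x => v c + ∫ t in c..x, w t with hVdef
  have hVv (x) (hx : x ∈ Icc c d) : V x = v x := by
    rw [hVdef]; simp only
    rw [← hvi c x (by rw [uIcc_of_le hx.1]; exact (Icc_subset_Icc_right hx.2).trans hcdI),
      add_sub_cancel]
  have hVac : AbsolutelyContinuousOnInterval V c d :=
    (contDiff_const (n := 1)).contDiffOn.absolutelyContinuousOnInterval.add
      (hwi.absolutelyContinuousOnInterval_intervalIntegral left_mem_uIcc)
  have hφac : AbsolutelyContinuousOnInterval φ c d :=
    (hφ.1.of_le (by simp)).contDiffOn.absolutelyContinuousOnInterval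
  have hibp := hφac.integral_mul_deriv_eq_deriv_mul (hVac.mul (hVac.mul hVac))
  have hφz {x : ℝ} (hx : x ∉ Ioo c d) : φ x = 0 :=
    image_eq_zero_of_notMem_tsupport fun h => hx (hφcd h)
  have hφz' {x : ℝ} (hx : x ∉ Ioo c d) : deriv φ x = 0 :=
    image_eq_zero_of_notMem_tsupport fun h => hx (hφcd (tsupport_deriv_subset h))
  rw [hφz (x := c) (by simp), hφz (x := d) (by simp), zero_mul, zero_mul, sub_zero, zero_sub,
    intervalIntegral.integral_of_le hcd, intervalIntegral.integral_of_le hcd] at hibp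
  have hIoc : Ioc c d ⊆ Ioo a b := Ioc_subset_Icc_self.trans hcdI
  have e1 : ∫ x in posSet a b u, φ x * (ux x ^ 2 * uxx x)
      = ∫ x in Ioo a b, φ x * (v x ^ 2 * w x) := by
    rw [setIntegral_congr_ae (g := fun x => φ x * (v x ^ 2 * w x)) hP.measurableSet]
    · refine (setIntegral_eq_of_subset_of_forall_sdiff_eq_zero measurableSet_Ioo
        (posSet_subset a b u) fun x hx => ?_).symm
      rw [hv0 x hx.1 hx.2]; ring
    · filter_upwards [hwxx, hv] with x hx hx' hxP
      rw [hx hxP, hx' hxP.1]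
  have e2 : ∫ x in Ioo a b, φ x * (v x ^ 2 * w x) = ∫ x in Ioc c d, φ x * (v x ^ 2 * w x) :=
    setIntegral_eq_of_subset_of_forall_sdiff_eq_zero measurableSet_Ioo hIoc fun x hx => by
      rw [hφz fun h => hx.2 (Ioo_subset_Ioc_self h), zero_mul]
  have e3 : ∫ x in posSet a b u, deriv φ x * (ux x ^ 3 / 3)
      = ∫ x in Ioo a b, deriv φ x * (v x ^ 3 / 3) := by
    rw [setIntegral_congr_ae (g := fun x => deriv φ x * (v x ^ 3 / 3)) hP.measurableSet]
    · refine (setIntegral_eq_of_subset_of_forall_sdiff_eq_zero measurableSet_Ioo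
        (posSet_subset a b u) fun x hx => ?_).symm
      rw [hv0 x hx.1 hx.2]; ring
    · filter_upwards [hv] with x hx' hxP
      rw [hx' hxP.1]
  have e4 : ∫ x in Ioo a b, deriv φ x * (v x ^ 3 / 3) = ∫ x in Ioc c d, deriv φ x * (v x ^ 3 / 3) :=
    setIntegral_eq_of_subset_of_forall_sdiff_eq_zero measurableSet_Ioo hIoc fun x hx => by
      rw [hφz' fun h => hx.2 (Ioo_subset_Ioc_self h), zero_mul]
  have e5 : ∫ x in Ioc c d, φ x * deriv (V * (V * V)) x
      = 3 * ∫ x in Ioc c d, φ x * (v x ^ 2 * w x) := by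
    rw [← integral_const_mul]
    refine setIntegral_congr_ae measurableSet_Ioc ?_
    filter_upwards [hwi.ae_hasDerivAt_integral] with x hx hxI
    have hxI' : x ∈ Icc c d := Ioc_subset_Icc_self hxI
    have hd : HasDerivAt V (w x) x :=
      (hx (by rwa [uIcc_of_le hcd]) c left_mem_uIcc).const_add (v c)
    rw [(hd.mul (hd.mul hd)).deriv, Pi.mul_apply, hVv x hxI']
    ring
  have e6 : ∫ x in Ioc c d, deriv φ x * (V * (V * V)) x
      = 3 * ∫ x in Ioc c d, deriv φ x * (v x ^ 3 / 3) := by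
    rw [← integral_const_mul]
    refine setIntegral_congr_fun measurableSet_Ioc fun x hxI => ?_
    simp only [Pi.mul_apply]
    rw [hVv x (Ioc_subset_Icc_self hxI)]
    ring
  rw [e5, e6] at hibp
  rw [e1, e2, e3, e4]
  linarith

end Slice

end

/-! ### The Neumann condition and the cubic estimate -/

section

/-- y|y| is a differentiable, signed version of y²; with it the derivative of u u_x|u_x| contains
|u_x|³ instead of the sign-changing u_x³. -/
theorem hasDerivAt_mul_abs (y : ℝ) : HasDerivAt (fun y : ℝ => y * |y|) (2 * |y|) y := by
  rcases lt_trichotomy y 0 with h | h | h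
  · have := (hasDerivAt_id y).mul (hasDerivAt_abs_neg h)
    refine (this.congr_deriv ?_)
    rw [abs_of_neg h]; simp only [id]; ring
  · subst h
    rw [hasDerivAt_iff_tendsto_slope_zero]
    have h1 : Tendsto (fun t : ℝ => |t|) (𝓝[≠] 0) (𝓝 0) := by
      have : Tendsto (fun t : ℝ => |t|) (𝓝 0) (𝓝 |0|) := continuous_abs.tendsto 0
      rw [abs_zero] at this
      exact this.mono_left nhdsWithin_le_nhds
    rw [abs_zero, show (2 : ℝ) * 0 = 0 from mul_zero 2]
    refine h1.congr' ?_
    filter_upwards [self_mem_nhdsWithin] with t ht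
    have ht' : t ≠ 0 := ht
    simp only [zero_add, mul_zero, sub_zero, smul_eq_mul]
    field_simp
  · have := (hasDerivAt_id y).mul (hasDerivAt_abs_pos h)
    refine (this.congr_deriv ?_)
    rw [abs_of_pos h]; simp only [id]; ring

section Endpoint

variable {a b : ℝ} {u v w : ℝ → ℝ}

theorem exists_pos_le_of_continuousOn_left (hab : a < b) (hc : ContinuousOn u (Icc a b))
    (hua : 0 < u a) : ∃ m c, 0 < m ∧ a < c ∧ c < b ∧ ∀ x ∈ Icc a c, m ≤ u x := by
  have h := (hc a (left_mem_Icc.2 hab.le)).eventually (lt_mem_nhds (half_lt_self hua))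
  rw [nhdsWithin_Icc_eq_nhdsGE hab] at h
  obtain ⟨c, hc, hc'⟩ := (mem_nhdsGE_iff_exists_Icc_subset).1 h
  have hca : a < c := hc
  refine ⟨u a / 2, min c ((a + b) / 2), half_pos hua, lt_min hca (by linarith),
    (min_le_right _ _).trans_lt (by linarith), fun x hx => ?_⟩
  have : x ∈ Icc a c := ⟨hx.1, hx.2.trans (min_le_left _ _)⟩
  exact le_of_lt (hc' this)

/-- Near an endpoint where `u` is bounded below, integrability of u u_xx² makes u_xx integrable, so
u_x has a one-sided limit. This limit is the one-sided derivative of `u`, which the Neumann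
condition sets to zero. -/
theorem tendsto_deriv_left (hab : a < b) (hc : ContinuousOn u (Icc a b)) (hua : 0 < u a)
    (huv : ∀ x ∈ posSet a b u, HasDerivAt u (v x) x)
    (hvw : ∀ x ∈ posSet a b u, HasDerivAt v (w x) x) (hwc : ContinuousOn w (posSet a b u))
    (hi : IntegrableOn (fun x => u x * w x ^ 2) (posSet a b u))
    (hN : HasDerivWithinAt u 0 (Icc a b) a) : Tendsto v (𝓝[>] a) (𝓝 0) := by
  obtain ⟨m, c, hm, hac, hcb, hmu⟩ := exists_pos_le_of_continuousOn_left hab hc hua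
  have hsub : Ioc a c ⊆ posSet a b u := fun x hx =>
    ⟨⟨hx.1, hx.2.trans_lt hcb⟩, hm.trans_le (hmu x (Ioc_subset_Icc_self hx))⟩
  have hwi : IntegrableOn w (Ioc a c) := by
    have h2 : IntegrableOn (fun x => 1 + m⁻¹ * (u x * w x ^ 2)) (Ioc a c) :=
      (integrableOn_const (by simp)).add ((hi.mono_set hsub).const_mul _)
    refine h2.mono' ((hwc.mono hsub).aestronglyMeasurable measurableSet_Ioc)
      ((ae_restrict_mem measurableSet_Ioc).mono fun x hx => ?_)
    have h3 : m * w x ^ 2 ≤ u x * w x ^ 2 :=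
      mul_le_mul_of_nonneg_right (hmu x (Ioc_subset_Icc_self hx)) (sq_nonneg _)
    have h4 : w x ^ 2 ≤ m⁻¹ * (u x * w x ^ 2) := by
      rw [le_inv_mul_iff₀ hm]; exact h3
    rw [Real.norm_eq_abs]
    nlinarith [sq_nonneg (|w x| - 1), sq_abs (w x), abs_nonneg (w x)]
  have hwi' : IntervalIntegrable w volume a c := (intervalIntegrable_iff_integrableOn_Ioc_of_le hac.le).2 hwi
  set l := v c - ∫ t in a..c, w t
  have hlim : Tendsto v (𝓝[>] a) (𝓝 l) := by
    have hint : Tendsto (fun x => ∫ t in x..c, w t) (𝓝[>] a) (𝓝 (∫ t in a..c, w t)) := by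
      have := intervalIntegral.continuousOn_primitive_interval_left (μ := volume) (f := w) (a := a) (b := c)
        (by rw [uIcc_of_le hac.le, integrableOn_Icc_iff_integrableOn_Ioc]; exact hwi)
      have := (this a left_mem_uIcc)
      rw [uIcc_of_le hac.le] at this
      exact this.tendsto.mono_left (by
        rw [nhdsWithin_Icc_eq_nhdsGE hac]; exact nhdsWithin_mono _ Ioi_subset_Ici_self)
    refine (hint.const_sub (v c)).congr' ?_
    filter_upwards [Ioo_mem_nhdsGT hac] with x hx
    rw [intervalIntegral.integral_eq_sub_of_hasDerivAt, sub_sub_cancel]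
    · intro y hy
      rw [uIcc_of_le hx.2.le] at hy
      exact hvw y (hsub ⟨hx.1.trans_le hy.1, hy.2⟩)
    · exact hwi'.mono_set (by
        rw [uIcc_of_le hx.2.le, uIcc_of_le hac.le]; exact Icc_subset_Icc_left hx.1.le)
  have hd : HasDerivWithinAt u l (Ici a) a := by
    refine hasDerivWithinAt_Ici_of_tendsto_deriv (s := Ioo a c) (fun x hx =>
      (huv x (hsub (Ioo_subset_Ioc_self hx))).differentiableAt.differentiableWithinAt)
      ((hc a (left_mem_Icc.2 hab.le)).mono (fun x hx => ⟨hx.1.le, hx.2.le.trans hcb.le⟩))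
      (Ioo_mem_nhdsGT hac) (hlim.congr' ?_)
    filter_upwards [Ioo_mem_nhdsGT hac] with x hx
    exact ((huv x (hsub (Ioo_subset_Ioc_self hx))).deriv).symm
  have hd' : HasDerivWithinAt u 0 (Ici a) a :=
    hN.mono_of_mem_nhdsWithin (Icc_mem_nhdsGE hab)
  rwa [(uniqueDiffWithinAt_Ici a).eq_deriv _ hd hd'] at hlim

/-- The left endpoint case applied to the reflection x ↦ u(-x). -/
theorem tendsto_deriv_right (hab : a < b) (hc : ContinuousOn u (Icc a b)) (hub : 0 < u b)
    (huv : ∀ x ∈ posSet a b u, HasDerivAt u (v x) x)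
    (hvw : ∀ x ∈ posSet a b u, HasDerivAt v (w x) x) (hwc : ContinuousOn w (posSet a b u))
    (hi : IntegrableOn (fun x => u x * w x ^ 2) (posSet a b u))
    (hN : HasDerivWithinAt u 0 (Icc a b) b) : Tendsto v (𝓝[<] b) (𝓝 0) := by
  have hP {x : ℝ} (hx : x ∈ posSet (-b) (-a) fun x => u (-x)) : -x ∈ posSet a b u :=
    ⟨⟨by linarith [hx.1.2], by linarith [hx.1.1]⟩, hx.2⟩
  have hPeq : (posSet (-b) (-a) fun x => u (-x)) = Neg.neg ⁻¹' posSet a b u := by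
    ext x
    refine ⟨fun hx => hP hx, fun hx => ⟨⟨?_, ?_⟩, hx.2⟩⟩ <;> linarith [hx.1.1, hx.1.2]
  have hmaps : MapsTo (fun x : ℝ => -x) (Icc (-b) (-a)) (Icc a b) := fun x hx =>
    ⟨by linarith [hx.2], by linarith [hx.1]⟩
  have key := tendsto_deriv_left (u := fun x => u (-x)) (v := fun x => -v (-x))
    (w := fun x => w (-x)) (neg_lt_neg hab) (hc.comp continuous_neg.continuousOn hmaps)
    (by simpa using hub)
    (fun x hx => by
      have := (huv _ (hP hx)).comp x (hasDerivAt_neg x)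
      exact this.congr_deriv (by ring))
    (fun x hx => by
      have := ((hvw _ (hP hx)).comp x (hasDerivAt_neg x)).neg
      exact this.congr_deriv (by ring))
    (hwc.comp continuous_neg.continuousOn fun x hx => hP hx)
    (by
      rw [hPeq]
      exact ((Measure.measurePreserving_neg (volume : Measure ℝ)).integrableOn_comp_preimage
        (MeasurableEquiv.neg ℝ).measurableEmbedding).2 hi)
    (by
      have h1 : HasDerivWithinAt u 0 (Icc a b) (- -b) := by rwa [neg_neg]
      have := h1.comp (-b) (hasDerivAt_neg (-b)).hasDerivWithinAt hmaps
      exact this.congr_deriv (by ring))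
  have h2 : Tendsto (fun x : ℝ => -x) (𝓝[<] b) (𝓝[>] (-b)) := tendsto_neg_nhdsLT
  have := (key.comp h2).neg
  simpa [Function.comp_def] using this

/-- Near a zero of `u` one has u < δ, so the function already vanishes there and its extension by
zero creates no jump. -/
theorem continuousOn_indicator_posSet (hc : ContinuousOn u (Icc a b)) {f : ℝ → ℝ}
    (hf : ContinuousOn f (posSet a b u)) {δ : ℝ} (hδ : 0 < δ)
    (hz : ∀ x ∈ posSet a b u, u x ≤ δ → f x = 0) :
    ContinuousOn ((posSet a b u).indicator f) (Ioo a b) := by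
  have hP := isOpen_posSet hc
  intro x hx
  refine ContinuousAt.continuousWithinAt ?_
  by_cases hxP : x ∈ posSet a b u
  · refine (hf.continuousAt (hP.mem_nhds hxP)).congr ?_
    filter_upwards [hP.mem_nhds hxP] with y hy
    rw [indicator_of_mem hy]
  · have hux : u x < δ := lt_of_not_ge fun h => hxP ⟨hx, hδ.trans_le h⟩
    have hcx : ContinuousAt u x := hc.continuousAt (Icc_mem_nhds hx.1 hx.2)
    have : (fun _ => (0 : ℝ)) =ᶠ[𝓝 x] (posSet a b u).indicator f := by
      filter_upwards [hcx.eventually (gt_mem_nhds hux)] with y hy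
      by_cases hyP : y ∈ posSet a b u
      · rw [indicator_of_mem hyP, hz y hyP (le_of_lt hy)]
      · rw [indicator_of_notMem hyP]
    exact continuousAt_const.congr this

theorem hasDerivAt_indicator_posSet (hc : ContinuousOn u (Icc a b)) {f f' : ℝ → ℝ}
    (hf : ∀ x ∈ posSet a b u, HasDerivAt f (f' x) x) {δ : ℝ} (hδ : 0 < δ)
    (hz : ∀ x ∈ posSet a b u, u x ≤ δ → f x = 0) {x : ℝ} (hx : x ∈ Ioo a b) :
    HasDerivAt ((posSet a b u).indicator f) ((posSet a b u).indicator f' x) x := by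
  have hP := isOpen_posSet hc
  by_cases hxP : x ∈ posSet a b u
  · rw [indicator_of_mem hxP]
    refine (hf x hxP).congr_of_eventuallyEq ?_
    filter_upwards [hP.mem_nhds hxP] with y hy
    rw [indicator_of_mem hy]
  · have hux : u x < δ := lt_of_not_ge fun h => hxP ⟨hx, hδ.trans_le h⟩
    have hcx : ContinuousAt u x := hc.continuousAt (Icc_mem_nhds hx.1 hx.2)
    rw [indicator_of_notMem hxP]
    refine (hasDerivAt_const x (0 : ℝ)).congr_of_eventuallyEq ?_
    filter_upwards [hcx.eventually (gt_mem_nhds hux)] with y hy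
    by_cases hyP : y ∈ posSet a b u
    · rw [indicator_of_mem hyP, hz y hyP (le_of_lt hy)]
    · rw [indicator_of_notMem hyP]

/-- Integrate (u v|v|)' = |v|³ + 2u|v|w over (a,b). Replacing the factor `u` by `idcut δ u` removes
the contributions of interior zeros. At an endpoint the boundary term vanishes either because u < δ
nearby or because v → 0. Finally δ → 0 while compact subintervals exhaust (a,b). -/
theorem lintegral_abs_deriv_cube_le_of_representatives (hab : a < b)
    (hc : ContinuousOn u (Icc a b))
    (huv : ∀ x ∈ posSet a b u, HasDerivAt u (v x) x)
    (hvw : ∀ x ∈ posSet a b u, HasDerivAt v (w x) x) (hwc : ContinuousOn w (posSet a b u))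
    (hA : IntegrableOn (fun x => u x * |v x| * |w x|) (posSet a b u))
    (hl : 0 < u a → Tendsto v (𝓝[>] a) (𝓝 0)) (hr : 0 < u b → Tendsto v (𝓝[<] b) (𝓝 0)) :
    ∫⁻ x in posSet a b u, ENNReal.ofReal (|v x| ^ 3)
      ≤ 2 * ∫⁻ x in posSet a b u, ENNReal.ofReal (u x * |v x| * |w x|) := by
  have hP := isOpen_posSet hc
  set P := posSet a b u with hPdef
  have huc : ContinuousOn u P := fun x hx => (huv x hx).continuousAt.continuousWithinAt
  have hvc : ContinuousOn v P := fun x hx => (hvw x hx).continuousAt.continuousWithinAt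
  set A := ∫ x in P, u x * |v x| * |w x| with hAdef
  have hA0 : ∀ x ∈ P, 0 ≤ u x * |v x| * |w x| := fun x hx =>
    mul_nonneg (mul_nonneg hx.2.le (abs_nonneg _)) (abs_nonneg _)
  have hAl : ∫⁻ x in P, ENNReal.ofReal (u x * |v x| * |w x|) = ENNReal.ofReal A :=
    (ofReal_integral_eq_lintegral_ofReal hA ((ae_restrict_mem hP.measurableSet).mono hA0)).symm
  have hid (δ : ℝ) : Continuous (idcut δ) := (contDiff_idcut δ).continuous
  have hid' (δ : ℝ) : Continuous (deriv (idcut δ)) :=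
    (contDiff_idcut δ).continuous_deriv (by simp)
  set H : ℝ → ℝ → ℝ := fun δ => P.indicator fun x => idcut δ (u x) * (v x * |v x|) with hH
  -- boundary values
  have hHlim {δ : ℝ} (hδ : 0 < δ) {e : ℝ} {F : Filter ℝ} (he : Tendsto u F (𝓝 e))
      (hv0 : 0 < e → Tendsto v F (𝓝 0)) : Tendsto (H δ) F (𝓝 0) := by
    rcases lt_or_ge e δ with h | h
    · refine tendsto_const_nhds.congr' ?_
      filter_upwards [he.eventually (gt_mem_nhds h)] with y hy
      by_cases hyP : y ∈ P
      · rw [hH]; simp only; rw [indicator_of_mem hyP, idcut_eq_zero hδ (le_of_lt hy), zero_mul]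
      · rw [hH]; simp only; rw [indicator_of_notMem hyP]
    · have h0 := hv0 (hδ.trans_le h)
      have h1 : Tendsto (fun x => idcut δ (u x) * (v x * |v x|)) F
          (𝓝 (idcut δ e * (0 * |0|))) :=
        (((hid δ).tendsto e).comp he).mul (h0.mul h0.abs)
      rw [zero_mul, mul_zero] at h1
      refine squeeze_zero_norm (fun x => ?_) (tendsto_zero_iff_norm_tendsto_zero.1 h1)
      exact norm_indicator_le_norm_self _ _
  have hua : Tendsto u (𝓝[>] a) (𝓝 (u a)) := by
    have := (hc a (left_mem_Icc.2 hab.le)).tendsto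
    rw [nhdsWithin_Icc_eq_nhdsGE hab] at this
    exact this.mono_left (nhdsWithin_mono _ Ioi_subset_Ici_self)
  have hub : Tendsto u (𝓝[<] b) (𝓝 (u b)) := by
    have := (hc b (right_mem_Icc.2 hab.le)).tendsto
    rw [nhdsWithin_Icc_eq_nhdsLE hab] at this
    exact this.mono_left (nhdsWithin_mono _ Iio_subset_Iic_self)
  -- the estimate on compact subintervals
  have hcomp {δ : ℝ} (hδ : 0 < δ) {c d : ℝ} (hcd : c ≤ d) (hcdI : Icc c d ⊆ Ioo a b) :
      ∫⁻ x in P ∩ Ioc c d, ENNReal.ofReal (cut δ (u x) * |v x| ^ 3)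
        ≤ ENNReal.ofReal (|H δ c| + |H δ d| + 2 * A) := by
    set G₁ : ℝ → ℝ := P.indicator fun x => deriv (idcut δ) (u x) * |v x| ^ 3 with hG₁
    set G₂ : ℝ → ℝ := P.indicator fun x => 2 * (idcut δ (u x) * |v x| * w x) with hG₂
    have c0 : ContinuousOn (fun x => idcut δ (u x)) P := (hid δ).comp_continuousOn huc
    have c1 : ContinuousOn (fun x => deriv (idcut δ) (u x)) P := (hid' δ).comp_continuousOn huc
    -- At s = δ itself `idcut` is not locally zero; the value there follows from continuity of its
    -- derivative.
    have hz' {s : ℝ} (hs : s ≤ δ) : deriv (idcut δ) s = 0 := by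
      rcases hs.lt_or_eq with h | h
      · have : idcut δ =ᶠ[𝓝 s] fun _ => 0 := by
          filter_upwards [gt_mem_nhds h] with y hy
          exact idcut_eq_zero hδ (le_of_lt hy)
        rw [this.deriv_eq]; simp
      · have hcl : IsClosed {y | deriv (idcut δ) y = 0} := isClosed_eq (hid' δ) continuous_const
        have : Iio δ ⊆ {y | deriv (idcut δ) y = 0} := fun y hy => by
          have : idcut δ =ᶠ[𝓝 y] fun _ => 0 := by
            filter_upwards [gt_mem_nhds hy] with y hy
            exact idcut_eq_zero hδ (le_of_lt hy)
          change deriv (idcut δ) y = 0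
          rw [this.deriv_eq]; simp
        have h2 := closure_minimal this hcl
        rw [closure_Iio] at h2
        exact h2 h.le
    have hG₁c : ContinuousOn G₁ (Ioo a b) := continuousOn_indicator_posSet hc
      (c1.mul (hvc.abs.pow 3)) hδ fun x _ hx => by rw [hz' hx, zero_mul]
    have hG₂c : ContinuousOn G₂ (Ioo a b) := continuousOn_indicator_posSet hc
      (continuousOn_const.mul ((c0.mul hvc.abs).mul hwc)) hδ
      fun x _ hx => by rw [idcut_eq_zero hδ hx]; ring
    have hHd : ∀ x ∈ Ioo a b, HasDerivAt (H δ) (G₁ x + G₂ x) x := fun x hx => by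
      have := hasDerivAt_indicator_posSet hc
        (f := fun x => idcut δ (u x) * (v x * |v x|))
        (f' := fun x => deriv (idcut δ) (u x) * |v x| ^ 3 + 2 * (idcut δ (u x) * |v x| * w x))
        (fun x hx => by
          have h1 : HasDerivAt (fun x => idcut δ (u x)) _ x :=
            ((contDiff_idcut δ).differentiable (by simp) (u x)).hasDerivAt.comp x (huv x hx)
          have h2 : HasDerivAt (fun x => v x * |v x|) (2 * |v x| * w x) x :=
            (hasDerivAt_mul_abs (v x)).comp x (hvw x hx)
          refine (h1.mul h2).congr_deriv ?_
          have : |v x| ^ 3 = v x * (v x * |v x|) := by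
            rw [pow_succ, sq_abs]; ring
          rw [this]; ring) hδ
        (fun x _ hx => by rw [idcut_eq_zero hδ hx, zero_mul]) hx
      refine this.congr_deriv ?_
      simp only [hG₁, hG₂]
      by_cases hxP : x ∈ P
      · simp only [indicator_of_mem hxP]; rw [indicator_of_mem hxP]
      · simp only [indicator_of_notMem hxP]; rw [indicator_of_notMem hxP, add_zero]
    have i1 : IntegrableOn G₁ (Ioc c d) :=
      ((hG₁c.mono hcdI).integrableOn_compact isCompact_Icc).mono_set Ioc_subset_Icc_self
    have i2 : IntegrableOn G₂ (Ioc c d) :=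
      ((hG₂c.mono hcdI).integrableOn_compact isCompact_Icc).mono_set Ioc_subset_Icc_self
    have hftc : (∫ x in Ioc c d, G₁ x) + ∫ x in Ioc c d, G₂ x = H δ d - H δ c := by
      rw [← integral_add i1 i2, ← intervalIntegral.integral_of_le hcd]
      refine intervalIntegral.integral_eq_sub_of_hasDerivAt (fun x hx => ?_) ?_
      · rw [uIcc_of_le hcd] at hx; exact hHd x (hcdI hx)
      · rw [intervalIntegrable_iff_integrableOn_Ioc_of_le hcd]; exact i1.add i2
    have hG₂A : -(2 * A) ≤ ∫ x in Ioc c d, G₂ x := by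
      have h1 : |∫ x in Ioc c d, G₂ x| ≤ ∫ x in Ioc c d, 2 * P.indicator (fun x => u x * |v x| * |w x|) x := by
        refine norm_integral_le_of_norm_le (f := G₂) (((hA.integrable_indicator hP.measurableSet).integrableOn).const_mul 2)
          (Eventually.of_forall fun x => ?_)
        by_cases hxP : x ∈ P
        · rw [hG₂, indicator_of_mem hxP, indicator_of_mem hxP, norm_mul, norm_mul, norm_mul,
            Real.norm_of_nonneg (idcut_nonneg hxP.2.le), Real.norm_of_nonneg (zero_le_two)]
          simp only [Real.norm_eq_abs, abs_abs]
          gcongr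
          exact idcut_le_self hxP.2.le
        · rw [hG₂, indicator_of_notMem hxP, indicator_of_notMem hxP]; simp
      have h2 : ∫ x in Ioc c d, 2 * P.indicator (fun x => u x * |v x| * |w x|) x ≤ 2 * A := by
        rw [integral_const_mul, hAdef, ← integral_indicator hP.measurableSet]
        refine mul_le_mul_of_nonneg_left ?_ zero_le_two
        exact setIntegral_le_integral (hA.integrable_indicator hP.measurableSet)
          (Eventually.of_forall fun x => indicator_nonneg hA0 x)
      linarith [neg_abs_le (∫ x in Ioc c d, G₂ x)]
    have hG₁nn : ∀ x, 0 ≤ G₁ x := fun x => indicator_nonneg (fun x hx =>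
      mul_nonneg ((cut_nonneg _ _).trans (cut_le_deriv_idcut hδ hx.2.le)) (by positivity)) x
    calc ∫⁻ x in P ∩ Ioc c d, ENNReal.ofReal (cut δ (u x) * |v x| ^ 3)
        ≤ ∫⁻ x in P ∩ Ioc c d, ENNReal.ofReal (G₁ x) := by
          refine setLIntegral_mono' (hP.measurableSet.inter measurableSet_Ioc) fun x hx => ?_
          rw [hG₁, indicator_of_mem hx.1]
          exact ENNReal.ofReal_le_ofReal (mul_le_mul_of_nonneg_right
            (cut_le_deriv_idcut hδ hx.1.2.le) (by positivity))
      _ ≤ ∫⁻ x in Ioc c d, ENNReal.ofReal (G₁ x) := lintegral_mono_set inter_subset_right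
      _ = ENNReal.ofReal (∫ x in Ioc c d, G₁ x) :=
          (ofReal_integral_eq_lintegral_ofReal i1 (Eventually.of_forall hG₁nn)).symm
      _ ≤ ENNReal.ofReal (|H δ c| + |H δ d| + 2 * A) := by
          refine ENNReal.ofReal_le_ofReal ?_
          linarith [le_abs_self (H δ d), neg_abs_le (H δ c)]
  -- the limit
  have hcd (k : ℕ) : ∃ c d, c ≤ d ∧ Icc c d ⊆ Ioo a b ∧ c < a + 1 / ((k : ℝ) + 1) ∧
      b - 1 / ((k : ℝ) + 1) < d ∧ |H (1 / ((k : ℝ) + 1)) c| < 1 / ((k : ℝ) + 1) ∧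
      |H (1 / ((k : ℝ) + 1)) d| < 1 / ((k : ℝ) + 1) := by
    have hk : 0 < 1 / ((k : ℝ) + 1) := by positivity
    obtain ⟨c, hc1, hc2, hc3⟩ := (((hHlim hk hua hl).abs.eventually
      (gt_mem_nhds (by rw [abs_zero]; exact hk))).and
      (Ioo_mem_nhdsGT (show a < min ((a + b) / 2) (a + 1 / ((k : ℝ) + 1)) from
        lt_min (by linarith) (by linarith)))).exists
    obtain ⟨d, hd1, hd2, hd3⟩ := (((hHlim hk hub hr).abs.eventually
      (gt_mem_nhds (by rw [abs_zero]; exact hk))).and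
      (Ioo_mem_nhdsLT (show max ((a + b) / 2) (b - 1 / ((k : ℝ) + 1)) < b from
        max_lt (by linarith) (by linarith)))).exists
    have e1 := lt_min_iff.1 hc3
    have e2 := max_lt_iff.1 hd2
    exact ⟨c, d, by linarith [e1.1, e2.1], fun x hx => ⟨hc2.trans_le hx.1, hx.2.trans_lt hd3⟩,
      e1.2, e2.2, hc1, hd1⟩
  choose c d hcd1 hcd2 hcd3 hcd4 hcd5 hcd6 using hcd
  have hk0 : Tendsto (fun k : ℕ => 1 / ((k : ℝ) + 1)) atTop (𝓝 0) :=
    tendsto_one_div_add_atTop_nhds_zero_nat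
  have hkpos (k : ℕ) : 0 < 1 / ((k : ℝ) + 1) := by positivity
  rw [hAl]
  set F : ℕ → ℝ → ℝ≥0∞ := fun k => (Ioc (c k) (d k)).indicator
    fun x => ENNReal.ofReal (cut (1 / ((k : ℝ) + 1)) (u x) * |v x| ^ 3) with hF
  have hFm (k : ℕ) : AEMeasurable (F k) (volume.restrict P) := by
    refine AEMeasurable.indicator ?_ measurableSet_Ioc
    have : ContinuousOn (fun x => cut (1 / ((k : ℝ) + 1)) (u x) * |v x| ^ 3) P :=
      ((contDiff_cut _).continuous.comp_continuousOn huc).mul (hvc.abs.pow 3)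
    exact (this.aemeasurable hP.measurableSet).ennreal_ofReal
  -- Integrability of |v|³ is not known beforehand, so the limit is taken with Fatou's lemma.
  calc ∫⁻ x in P, ENNReal.ofReal (|v x| ^ 3) ≤ ∫⁻ x in P, liminf (fun k => F k x) atTop := by
        refine setLIntegral_mono' hP.measurableSet fun x hx => ?_
        refine le_of_eq (Tendsto.liminf_eq (tendsto_const_nhds.congr' ?_)).symm
        have e1 := hk0.eventually_lt_const (half_pos hx.2)
        have e2 := hk0.eventually_lt_const (sub_pos.2 hx.1.1)
        have e3 := hk0.eventually_lt_const (sub_pos.2 hx.1.2)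
        filter_upwards [e1, e2, e3] with k h1 h2 h3
        have hxcd : x ∈ Ioc (c k) (d k) := ⟨by linarith [hcd3 k], by linarith [hcd4 k]⟩
        simp only [hF]
        rw [indicator_of_mem hxcd, cut_eq_one (hkpos k) (by linarith), one_mul]
    _ ≤ liminf (fun k => ∫⁻ x in P, F k x) atTop := lintegral_liminf_le' hFm
    _ ≤ liminf (fun k : ℕ => ENNReal.ofReal (2 * (1 / ((k : ℝ) + 1)) + 2 * A)) atTop := by
        refine liminf_le_liminf (Eventually.of_forall fun k => ?_)
        have := hcomp (hkpos k) (hcd1 k) (hcd2 k)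
        simp only [hF]
        rw [lintegral_indicator measurableSet_Ioc, Measure.restrict_restrict measurableSet_Ioc,
          inter_comm]
        exact this.trans (ENNReal.ofReal_le_ofReal (by linarith [hcd5 k, hcd6 k]))
    _ = ENNReal.ofReal (2 * 0 + 2 * A) :=
        ((ENNReal.continuous_ofReal.tendsto _).comp ((hk0.const_mul 2).add_const _)).liminf_eq
    _ = 2 * ENNReal.ofReal A := by
        rw [mul_zero, zero_add, ENNReal.ofReal_mul zero_le_two]; simp

end Endpoint

/-- Under the boundary condition `u_x = 0`, the integral of `|u_x|³` is controlled by that of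
`u|u_x||u_xx|`. -/
theorem slice_lintegral_abs_cube_le {a b : ℝ} {u ux uxx uxxx : ℝ → ℝ} (hab : a < b)
    (hc : ContinuousOn u (Icc a b))
    (h1 : HasWeakDerivOn (Ioo a b) u ux) (h2 : HasWeakDerivOn (posSet a b u) ux uxx)
    (h3 : HasWeakDerivOn (posSet a b u) uxx uxxx)
    (hNa : HasDerivWithinAt u 0 (Icc a b) a) (hNb : HasDerivWithinAt u 0 (Icc a b) b)
    (hi : IntegrableOn (fun x => u x * uxx x ^ 2) (posSet a b u))
    (hA : IntegrableOn (fun x => u x * |ux x| * |uxx x|) (posSet a b u)) :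
    ∫⁻ x in posSet a b u, ENNReal.ofReal (|ux x| ^ 3)
      ≤ 2 * ∫⁻ x in posSet a b u, ENNReal.ofReal (u x * |ux x| * |uxx x|) := by
  have hP := isOpen_posSet hc
  obtain ⟨v, w, huv, hvw, hwc, hv, hw⟩ := exists_slice_representatives hc h1 h2 h3
  rw [← ae_restrict_iff' hP.measurableSet] at hv hw
  have e1 : ∫⁻ x in posSet a b u, ENNReal.ofReal (|ux x| ^ 3)
      = ∫⁻ x in posSet a b u, ENNReal.ofReal (|v x| ^ 3) :=
    lintegral_congr_ae (hv.mono fun x hx => by simp only [hx])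
  have e2 : ∫⁻ x in posSet a b u, ENNReal.ofReal (u x * |ux x| * |uxx x|)
      = ∫⁻ x in posSet a b u, ENNReal.ofReal (u x * |v x| * |w x|) := by
    refine lintegral_congr_ae ?_
    filter_upwards [hv, hw] with x hx hx'
    simp only [hx, hx']
  have hi' : IntegrableOn (fun x => u x * w x ^ 2) (posSet a b u) :=
    hi.congr (hw.mono fun x hx => by simp only [hx])
  have hA' : IntegrableOn (fun x => u x * |v x| * |w x|) (posSet a b u) := by
    refine hA.congr ?_
    filter_upwards [hv, hw] with x hx hx'
    simp only [hx, hx']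
  rw [e1, e2]
  exact lintegral_abs_deriv_cube_le_of_representatives hab hc huv hvw hwc hA'
    (fun h => tendsto_deriv_left hab hc h huv hvw hwc hi' hNa)
    (fun h => tendsto_deriv_right hab hc h huv hvw hwc hi' hNb)

end

/-! ### One-dimensional Sobolev bounds and slicing of space-time integrals -/

section

theorem HasWeakDerivOn.sub_eq_integral {a b : ℝ} {f g : ℝ → ℝ} (h : HasWeakDerivOn (Ioo a b) f g)
    (hf : ContinuousOn f (Ioo a b)) {s t : ℝ} (hst : uIcc s t ⊆ Ioo a b) :
    f t - f s = ∫ r in s..t, g r := by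
  obtain ⟨F, hF, hFi⟩ := h.exists_representative isOpen_Ioo
  have hFc := continuousOn_of_sub_eq_integral isOpen_Ioo h.2.1 hFi
  have : ∀ x ∈ Ioo a b, F x = f x :=
    Measure.eqOn_open_of_ae_eq ((ae_restrict_iff' measurableSet_Ioo).2 hF) isOpen_Ioo hFc hf
  rw [← this _ (hst right_mem_uIcc), ← this _ (hst left_mem_uIcc), hFi s t hst]

theorem HasWeakDerivOn.abs_sub_le {a b : ℝ} {f g : ℝ → ℝ} (h : HasWeakDerivOn (Ioo a b) f g)
    (hf : ContinuousOn f (Ioo a b)) (hg : IntegrableOn g (Ioo a b)) {x y : ℝ}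
    (hx : x ∈ Ioo a b) (hy : y ∈ Ioo a b) : |f x - f y| ≤ ∫ r in Ioo a b, |g r| := by
  have hxy : uIcc y x ⊆ Ioo a b := by
    rw [uIcc]; exact Icc_subset_Ioo (lt_min hy.1 hx.1) (max_lt hy.2 hx.2)
  rw [h.sub_eq_integral hf hxy]
  refine (intervalIntegral.norm_integral_le_integral_norm_uIoc (f := g) (μ := volume)).trans ?_
  exact setIntegral_mono_set hg.norm (Eventually.of_forall fun _ => norm_nonneg _)
    (uIoc_subset_uIcc.trans hxy).eventuallyLE

section FixedTime

variable {a b : ℝ} {f g : ℝ → ℝ}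

theorem integrable_sq_of_lintegral_le {μ : Measure ℝ} (hg : AEStronglyMeasurable g μ) {E : ℝ}
    (hE : ∫⁻ x, ENNReal.ofReal (g x ^ 2 / 2) ∂μ ≤ ENNReal.ofReal E) (hE0 : 0 ≤ E) :
    Integrable (fun x => g x ^ 2) μ ∧ ∫ x, g x ^ 2 ∂μ ≤ 2 * E := by
  have hm : AEStronglyMeasurable (fun x => g x ^ 2 / 2) μ := by
    simpa only [div_eq_mul_inv, Pi.pow_apply] using (hg.pow 2).mul_const (2⁻¹ : ℝ)
  have hi : Integrable (fun x => g x ^ 2 / 2) μ := by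
    refine ⟨hm, ?_⟩
    rw [hasFiniteIntegral_iff_ofReal (Eventually.of_forall fun x => by positivity)]
    exact hE.trans_lt ENNReal.ofReal_lt_top
  have h2 : (fun x => g x ^ 2) = fun x => 2 * (g x ^ 2 / 2) := by funext x; ring
  refine ⟨by rw [h2]; exact hi.const_mul 2, ?_⟩
  rw [h2, integral_const_mul]
  refine mul_le_mul_of_nonneg_left ?_ zero_le_two
  rw [integral_eq_lintegral_of_nonneg_ae (Eventually.of_forall fun x => by positivity) hm]
  exact ENNReal.toReal_le_of_le_ofReal hE0 hE

/-- A bound for a non-negative function in terms of its mean and its Dirichlet energy. -/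
theorem HasWeakDerivOn.le_mass_add_energy (hab : a < b) (h : HasWeakDerivOn (Ioo a b) f g)
    (hf : ContinuousOn f (Icc a b)) {E : ℝ} (hE0 : 0 ≤ E)
    (hE : ∫⁻ x in Ioo a b, ENNReal.ofReal (g x ^ 2 / 2) ≤ ENNReal.ofReal E)
    (hgm : AEStronglyMeasurable g (volume.restrict (Ioo a b))) {x : ℝ}
    (hx : x ∈ Ioo a b) :
    f x ≤ (∫ y in Ioo a b, f y) / (b - a) + ((b - a) / 2 + E) := by
  have hba : 0 < b - a := sub_pos.2 hab
  obtain ⟨hi, hi'⟩ := integrable_sq_of_lintegral_le hgm hE hE0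
  have hc1 : Integrable (fun _ : ℝ => (1 : ℝ) / 2) (volume.restrict (Ioo a b)) :=
    integrable_const _
  have hbd : Integrable (fun x => 1 / 2 + 1 / 2 * g x ^ 2) (volume.restrict (Ioo a b)) :=
    hc1.add (hi.const_mul _)
  -- Young's inequality in place of Cauchy–Schwarz; integrated, it bounds the oscillation of `f` by
  -- the additive constant (b-a)/2 + E.
  have hle : ∀ x, ‖g x‖ ≤ 1 / 2 + 1 / 2 * g x ^ 2 := fun x => by
    rw [Real.norm_eq_abs]
    nlinarith [sq_nonneg (|g x| - 1), sq_abs (g x)]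
  have hgi : IntegrableOn g (Ioo a b) := hbd.mono' hgm (Eventually.of_forall hle)
  have hK : ∫ r in Ioo a b, |g r| ≤ (b - a) / 2 + E := by
    refine (integral_mono hgi.norm hbd hle).trans ?_
    rw [integral_add hc1 (hi.const_mul _), integral_const_mul, setIntegral_const]
    simp only [Real.volume_real_Ioo_of_le hab.le, smul_eq_mul]
    linarith
  have hfi : IntegrableOn f (Ioo a b) := (hf.integrableOn_compact isCompact_Icc).mono_set
    Ioo_subset_Icc_self
  have h1 : ∀ y ∈ Ioo a b, f x - ((b - a) / 2 + E) ≤ f y := fun y hy => by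
    have := (h.abs_sub_le (hf.mono Ioo_subset_Icc_self) hgi hx hy).trans hK
    linarith [le_abs_self (f x - f y)]
  have h2 := setIntegral_mono_on (integrableOn_const (by simp)) hfi measurableSet_Ioo h1
  rw [setIntegral_const, Real.volume_real_Ioo_of_le hab.le, smul_eq_mul] at h2
  rw [← sub_le_iff_le_add, le_div_iff₀ hba]
  linarith

/-- A bound for the supremum of a function by `L²` norms. -/
theorem HasWeakDerivOn.ae_sq_le (hab : a < b) (h : HasWeakDerivOn (Ioo a b) f g)
    (hf : MemLp f 2 (volume.restrict (Ioo a b)))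
    (hg : MemLp g 2 (volume.restrict (Ioo a b))) :
    ∀ᵐ x, x ∈ Ioo a b → f x ^ 2 ≤ 2 / (b - a) * (∫ y in Ioo a b, f y ^ 2)
      + 2 * (b - a) * ∫ y in Ioo a b, g y ^ 2 := by
  have hba : 0 < b - a := sub_pos.2 hab
  obtain ⟨F, hF, hFi⟩ := h.exists_representative isOpen_Ioo
  have hFc := continuousOn_of_sub_eq_integral isOpen_Ioo h.2.1 hFi
  have hg1 : IntegrableOn g (Ioo a b) := hg.integrable one_le_two
  have hg2 : IntegrableOn (fun y => g y ^ 2) (Ioo a b) := hg.integrable_sq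
  have hf2 : IntegrableOn (fun y => f y ^ 2) (Ioo a b) := hf.integrable_sq
  set G := ∫ y in Ioo a b, |g y| with hG
  have hG0 : 0 ≤ G := integral_nonneg fun _ => abs_nonneg _
  have hG2 : G ^ 2 ≤ (b - a) * ∫ y in Ioo a b, g y ^ 2 := by
    -- integrate the inequality `2 |g| G ≤ G² / (b - a) + (b - a) g²`
    have h1 : ∫ y in Ioo a b, 2 * G * |g y| ≤ ∫ y in Ioo a b, (G ^ 2 / (b - a) + (b - a) * g y ^ 2) := by
      refine integral_mono (hg1.norm.const_mul _)
        ((integrable_const _).add (hg2.const_mul _)) fun y => ?_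
      have : 0 ≤ (G / (b - a) - |g y|) ^ 2 * (b - a) := by positivity
      have e : (G / (b - a) - |g y|) ^ 2 * (b - a)
          = G ^ 2 / (b - a) + (b - a) * g y ^ 2 - 2 * G * |g y| := by
        rw [← sq_abs (g y)]; field_simp; ring
      simp only
      linarith
    rw [integral_const_mul, integral_add (integrable_const _) (hg2.const_mul _),
      integral_const_mul, setIntegral_const, Real.volume_real_Ioo_of_le hab.le, smul_eq_mul,
      mul_div_cancel₀ _ hba.ne', ← hG] at h1
    nlinarith
  have hweak : HasWeakDerivOn (Ioo a b) F g := by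
    refine ⟨hFc.locallyIntegrableOn measurableSet_Ioo, h.2.1, fun φ hφ => ?_⟩
    rw [← h.2.2 φ hφ]
    refine setIntegral_congr_ae measurableSet_Ioo (hF.mono fun x hx hxI => by rw [hx hxI])
  filter_upwards [hF] with x hx hxI
  have h3 : ∀ᵐ y ∂volume.restrict (Ioo a b), f x ^ 2 ≤ 2 * f y ^ 2 + 2 * ((b - a) * ∫ y in Ioo a b, g y ^ 2) := by
    rw [ae_restrict_iff' measurableSet_Ioo]
    filter_upwards [hF] with y hy hyI
    rw [← hy hyI, ← hx hxI]
    have := hweak.abs_sub_le hFc hg1 hxI hyI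
    rw [← hG] at this
    have h4 : (F x - F y) ^ 2 ≤ G ^ 2 := sq_le_sq' (by linarith [neg_abs_le (F x - F y)])
      ((le_abs_self _).trans this)
    -- 2F(y)² + 2(F(x)-F(y))² - F(x)² = (F(x) - 2F(y))².
    nlinarith [sq_nonneg (F x - 2 * F y)]
  have h5 := integral_mono_ae (integrable_const _)
    ((hf2.const_mul 2).add (integrable_const (2 * ((b - a) * ∫ y in Ioo a b, g y ^ 2)))) h3
  rw [integral_add' (hf2.const_mul 2) (integrable_const _), integral_const_mul, setIntegral_const,
    setIntegral_const, Real.volume_real_Ioo_of_le hab.le, smul_eq_mul, smul_eq_mul] at h5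
  have : f x ^ 2 ≤ (2 * (∫ y in Ioo a b, f y ^ 2)
      + (b - a) * (2 * ((b - a) * ∫ y in Ioo a b, g y ^ 2))) / (b - a) := by
    rw [le_div_iff₀ hba]; linarith
  refine this.trans (le_of_eq ?_)
  field_simp

end FixedTime

section SpaceTime

/-- The function `f` on `{u > 0}`, extended by zero, as a function of `(t,x)`. -/
def onPos (u f : ℝ → ℝ → ℝ) : ℝ × ℝ → ℝ :=
  {z : ℝ × ℝ | 0 < u z.1 z.2}.indicator fun z => f z.1 z.2

variable {a b T : ℝ} {u f : ℝ → ℝ → ℝ}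

theorem onPos_of_pos {t x : ℝ} (h : 0 < u t x) : onPos u f (t, x) = f t x :=
  indicator_of_mem (s := {z : ℝ × ℝ | 0 < u z.1 z.2}) (a := (t, x)) h _

theorem onPos_of_not_pos {t x : ℝ} (h : ¬0 < u t x) : onPos u f (t, x) = 0 :=
  indicator_of_notMem (s := {z : ℝ × ℝ | 0 < u z.1 z.2}) (a := (t, x)) h _

theorem aestronglyMeasurable_onPos {μ : Measure (ℝ × ℝ)}
    (hu : AEStronglyMeasurable (fun z : ℝ × ℝ => u z.1 z.2) μ)
    (hf : AEStronglyMeasurable (fun z : ℝ × ℝ => f z.1 z.2) μ) :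
    AEStronglyMeasurable (onPos u f) μ :=
  hf.indicator₀ (nullMeasurableSet_lt aemeasurable_const hu.aemeasurable)

theorem volume_restrict_prod (s t : Set ℝ) :
    (volume : Measure (ℝ × ℝ)).restrict (s ×ˢ t)
      = (volume.restrict s).prod (volume.restrict t) := by
  rw [Measure.volume_eq_prod, Measure.prod_restrict]

theorem setLIntegral_posSet {w : ℝ → ℝ} (hP : MeasurableSet (posSet a b w)) {G : ℝ → ℝ≥0∞}
    (hG : ∀ x ∈ Ioo a b, ¬0 < w x → G x = 0) :
    ∫⁻ x in posSet a b w, G x = ∫⁻ x in Ioo a b, G x := by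
  rw [← lintegral_indicator hP, ← lintegral_indicator measurableSet_Ioo]
  congr 1
  funext x
  by_cases hx : x ∈ Ioo a b
  · by_cases hw : 0 < w x
    · rw [indicator_of_mem hx, indicator_of_mem (show x ∈ posSet a b w from ⟨hx, hw⟩)]
    · rw [indicator_of_mem hx, indicator_of_notMem (fun h => hw h.2), hG x hx hw]
  · rw [indicator_of_notMem hx, indicator_of_notMem (fun h => hx h.1)]

theorem setIntegral_posSet {w : ℝ → ℝ} {G : ℝ → ℝ}
    (hG : ∀ x ∈ Ioo a b, ¬0 < w x → G x = 0) :
    ∫ x in posSet a b w, G x = ∫ x in Ioo a b, G x :=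
  (setIntegral_eq_of_subset_of_forall_sdiff_eq_zero measurableSet_Ioo (posSet_subset a b w)
    fun x hx => hG x hx.1 fun h => hx.2 ⟨hx.1, h⟩).symm

theorem lintegral_spaceTime {F : ℝ × ℝ → ℝ≥0∞}
    (hF : AEMeasurable F (volume.restrict (Ioo 0 T ×ˢ Ioo a b))) :
    ∫⁻ z in Ioo 0 T ×ˢ Ioo a b, F z = ∫⁻ t in Ioo 0 T, ∫⁻ x in Ioo a b, F (t, x) := by
  rw [volume_restrict_prod] at hF ⊢
  exact lintegral_prod _ hF

theorem integral_spaceTime {F : ℝ × ℝ → ℝ}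
    (hF : IntegrableOn F (Ioo 0 T ×ˢ Ioo a b)) :
    ∫ z in Ioo 0 T ×ˢ Ioo a b, F z = ∫ t in Ioo 0 T, ∫ x in Ioo a b, F (t, x) := by
  rw [IntegrableOn, volume_restrict_prod] at hF
  rw [volume_restrict_prod]
  exact integral_prod _ hF

theorem ae_slice_integrable {F : ℝ × ℝ → ℝ} (hF : IntegrableOn F (Ioo 0 T ×ˢ Ioo a b)) :
    ∀ᵐ t ∂volume.restrict (Ioo 0 T), IntegrableOn (fun x => F (t, x)) (Ioo a b) := by
  rw [IntegrableOn, volume_restrict_prod] at hF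
  exact hF.prod_right_ae

theorem ae_slice {p : ℝ × ℝ → Prop} (hp : ∀ᵐ z ∂volume.restrict (Ioo 0 T ×ˢ Ioo a b), p z) :
    ∀ᵐ t ∂volume.restrict (Ioo 0 T), ∀ᵐ x ∂volume.restrict (Ioo a b), p (t, x) := by
  rw [volume_restrict_prod] at hp
  exact Measure.ae_ae_of_ae_prod hp

/-- A property of a measurable kind holds almost everywhere if it does so on almost every slice. -/
theorem ae_of_ae_slice {p : ℝ × ℝ → Prop}
    (hpm : NullMeasurableSet {z | p z} (volume.restrict (Ioo 0 T ×ˢ Ioo a b)))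
    (hp : ∀ᵐ t ∂volume.restrict (Ioo 0 T), ∀ᵐ x ∂volume.restrict (Ioo a b), p (t, x)) :
    ∀ᵐ z ∂volume.restrict (Ioo 0 T ×ˢ Ioo a b), p z := by
  rw [volume_restrict_prod] at hpm ⊢
  obtain ⟨s, hs, hps⟩ := hpm
  have hps' := hps.mem_iff
  have h1 : ∀ᵐ t ∂volume.restrict (Ioo 0 T), ∀ᵐ x ∂volume.restrict (Ioo a b), (t, x) ∈ s := by
    filter_upwards [hp, Measure.ae_ae_of_ae_prod hps'] with t ht ht'
    filter_upwards [ht, ht'] with x hx hx'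
    exact hx'.1 hx
  filter_upwards [(Measure.ae_prod_iff_ae_ae (p := fun z => z ∈ s) hs).2 h1, hps'] with z hz hz'
  exact hz'.2 hz

end SpaceTime

end

/-! ### A priori bounds in space-time -/

section

theorem integrable_of_lintegral_ofReal_le {α : Type*} [MeasurableSpace α] {μ : Measure α}
    {F : α → ℝ} (hm : AEStronglyMeasurable F μ) (h0 : 0 ≤ᵐ[μ] F) {C : ℝ} (hC : 0 ≤ C)
    (h : ∫⁻ z, ENNReal.ofReal (F z) ∂μ ≤ ENNReal.ofReal C) :
    Integrable F μ ∧ ∫ z, F z ∂μ ≤ C := by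
  refine ⟨⟨hm, ?_⟩, ?_⟩
  · rw [hasFiniteIntegral_iff_ofReal h0]
    exact h.trans_lt ENNReal.ofReal_lt_top
  · rw [integral_eq_lintegral_of_nonneg_ae h0 hm]
    exact ENNReal.toReal_le_of_le_ofReal hC h

theorem measurable_indicator_beps (n : ℝ) {ε : ℝ} (hε : 0 < ε) :
    Measurable ((Ioi (0 : ℝ)).indicator (beps n ε)) := by
  have hc : ContinuousOn (beps n ε) (Ioi 0) := fun s hs =>
    (hasDerivAt_beps n hε hs).continuousAt.continuousWithinAt
  rw [← piecewise_eq_indicator]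
  exact hc.measurable_piecewise continuousOn_const measurableSet_Ioi

/-- The flux `|ln ε| (ε^{3-n}u^n + u³) u_xxx`. -/
def thinFlux (n ε : ℝ) (u uxxx : ℝ → ℝ → ℝ) (z : ℝ × ℝ) : ℝ :=
  |Real.log ε| * mobility n ε (u z.1 z.2) * onPos u uxxx z

/-- The distribution `∂ₜ ρ^ε` is `rhoSource + ∂ₓ rhoFlux`. -/
def rhoSource (u uxx : ℝ → ℝ → ℝ) (z : ℝ × ℝ) : ℝ := u z.1 z.2 * onPos u uxx z ^ 2

/-- The distribution `∂ₜ ρ^ε` is `rhoSource + ∂ₓ rhoFlux`. -/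
def rhoFlux (n ε : ℝ) (u ux uxx uxxx : ℝ → ℝ → ℝ) (z : ℝ × ℝ) : ℝ :=
  -((Ioi (0 : ℝ)).indicator (beps n ε) (u z.1 z.2) * thinFlux n ε u uxxx z
    + u z.1 z.2 * onPos u ux z * onPos u uxx z - onPos u ux z ^ 3 / 3)

namespace IsThinFilmSolutionWith

variable {a b n ε : ℝ} {uin uin' : ℝ → ℝ} {u ux uxx uxxx : ℝ → ℝ → ℝ} {E M R T : ℝ}

theorem aesm {f : ℝ → ℝ → ℝ} (hf : AEStronglyMeasurable (fun z : ℝ × ℝ => f z.1 z.2)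
    (volume.restrict (Ioi 0 ×ˢ Ioo a b))) :
    AEStronglyMeasurable (fun z : ℝ × ℝ => f z.1 z.2) (volume.restrict (Ioo 0 T ×ˢ Ioo a b)) :=
  hf.mono_measure (Measure.restrict_mono (prod_mono Ioo_subset_Ioi_self subset_rfl) le_rfl)

theorem ae_Ioo {p : ℝ → Prop} (hp : ∀ᵐ t ∂volume.restrict (Ioi (0 : ℝ)), p t) :
    ∀ᵐ t ∂volume.restrict (Ioo 0 T), p t :=
  ae_restrict_of_ae_restrict_of_subset Ioo_subset_Ioi_self hp

/-- The conserved mass fixes the mean of u(t,·), and the energy controls its deviation from the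
mean. -/
theorem le_bound (h : IsThinFilmSolutionWith a b n ε uin uin' u ux uxx uxxx) (hab : a < b)
    (hE0 : 0 ≤ E) (hE : ∫⁻ x in Ioo a b, ENNReal.ofReal (uin' x ^ 2 / 2) ≤ ENNReal.ofReal E)
    {t x : ℝ} (ht : 0 < t) (hx : x ∈ Ioo a b) :
    u t x ≤ (∫ y in Ioo a b, uin y) / (b - a) + ((b - a) / 2 + E) := by
  rw [← h.mass t ht]
  exact (h.weakDeriv_ux t ht).le_mass_add_energy hab (h.continuousOn t ht.le) hE0
    ((le_add_right le_rfl).trans ((h.energy t ht).trans hE)) (h.memLp_ux t ht).1 hx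


theorem ae_mem_spaceTime (a b T : ℝ) :
    ∀ᵐ z ∂(volume : Measure (ℝ × ℝ)).restrict (Ioo 0 T ×ˢ Ioo a b), z ∈ Ioo 0 T ×ˢ Ioo a b :=
  ae_restrict_mem (measurableSet_Ioo.prod measurableSet_Ioo)

theorem mobility_le (hn0 : 0 < n) (hε : 0 < ε) {s : ℝ} (hs : 0 ≤ s) (hsM : s ≤ M) :
    mobility n ε s ≤ mobility n ε M := by
  unfold mobility
  gcongr

theorem measurable_mobility (hn0 : 0 < n) : Measurable (mobility n ε) := by
  unfold mobility
  exact (((Real.continuous_rpow_const hn0.le).measurable.const_mul _)).add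
    (measurable_id.pow_const 3)

/-- Space-time bounds. -/
theorem integrable_ux_sq (h : IsThinFilmSolutionWith a b n ε uin uin' u ux uxx uxxx)
    (hT : 0 < T) (hE0 : 0 ≤ E)
    (hE : ∫⁻ x in Ioo a b, ENNReal.ofReal (uin' x ^ 2 / 2) ≤ ENNReal.ofReal E) :
    IntegrableOn (fun z : ℝ × ℝ => ux z.1 z.2 ^ 2) (Ioo 0 T ×ˢ Ioo a b) ∧
      ∫ z in Ioo 0 T ×ˢ Ioo a b, ux z.1 z.2 ^ 2 ≤ 2 * E * T := by
  have hm : AEStronglyMeasurable (fun z : ℝ × ℝ => ux z.1 z.2 ^ 2 / 2)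
      (volume.restrict (Ioo 0 T ×ˢ Ioo a b)) := by
    simpa only [div_eq_mul_inv, Pi.pow_apply] using ((aesm h.measurable_ux).pow 2).mul_const (2⁻¹ : ℝ)
  have key := integrable_of_lintegral_ofReal_le hm (Eventually.of_forall fun z => by positivity)
    (C := E * T) (by positivity) (by
      rw [lintegral_spaceTime hm.aemeasurable.ennreal_ofReal]
      calc ∫⁻ t in Ioo 0 T, ∫⁻ x in Ioo a b, ENNReal.ofReal (ux t x ^ 2 / 2)
          ≤ ∫⁻ _ in Ioo 0 T, ENNReal.ofReal E :=
            setLIntegral_mono' measurableSet_Ioo fun t ht =>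
              (le_add_right le_rfl).trans ((h.energy t ht.1).trans hE)
        _ = ENNReal.ofReal (E * T) := by
            rw [setLIntegral_const, Real.volume_Ioo, sub_zero, ENNReal.ofReal_mul hE0])
  have e : (fun z : ℝ × ℝ => ux z.1 z.2 ^ 2) = fun z => 2 * (ux z.1 z.2 ^ 2 / 2) := by
    funext z; ring
  rw [e]
  refine ⟨key.1.const_mul 2, ?_⟩
  rw [integral_const_mul]
  linarith [key.2]

theorem isOpen_pos (h : IsThinFilmSolutionWith a b n ε uin uin' u ux uxx uxxx) {t : ℝ}
    (ht : 0 ≤ t) : IsOpen (posSet a b (u t)) := isOpen_posSet (h.continuousOn t ht)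

/-- Passing from iterated integrals over the positivity sets to space-time integrals. -/
theorem lintegral_eq_posSet (h : IsThinFilmSolutionWith a b n ε uin uin' u ux uxx uxxx)
    {F : ℝ × ℝ → ℝ} (hF : AEStronglyMeasurable F (volume.restrict (Ioo 0 T ×ˢ Ioo a b)))
    {G : ℝ → ℝ → ℝ} (hF0 : ∀ t x, ¬0 < u t x → F (t, x) = 0)
    (hFG : ∀ t x, 0 < u t x → F (t, x) = G t x) :
    ∫⁻ z in Ioo 0 T ×ˢ Ioo a b, ENNReal.ofReal (F z)
      = ∫⁻ t in Ioo 0 T, ∫⁻ x in posSet a b (u t), ENNReal.ofReal (G t x) := by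
  rw [lintegral_spaceTime hF.aemeasurable.ennreal_ofReal]
  refine setLIntegral_congr_fun measurableSet_Ioo fun t ht => ?_
  have hP := (h.isOpen_pos (le_of_lt ht.1)).measurableSet
  rw [← setLIntegral_posSet hP fun x _ hx => by rw [hF0 t x hx, ENNReal.ofReal_zero]]
  exact setLIntegral_congr_fun hP fun x hx => by rw [hFG t x hx.2]

theorem aesm_thinFlux (h : IsThinFilmSolutionWith a b n ε uin uin' u ux uxx uxxx) (hn0 : 0 < n) :
    AEStronglyMeasurable (thinFlux n ε u uxxx) (volume.restrict (Ioo 0 T ×ˢ Ioo a b)) := by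
  have h1 : AEStronglyMeasurable (fun z : ℝ × ℝ => |Real.log ε| * mobility n ε (u z.1 z.2))
      (volume.restrict (Ioo 0 T ×ˢ Ioo a b)) :=
    (((measurable_mobility hn0).comp_aemeasurable
      (aesm h.measurable_u).aemeasurable).const_mul _).aestronglyMeasurable
  exact h1.mul (aestronglyMeasurable_onPos (aesm h.measurable_u) (aesm h.measurable_uxxx))

/-- The product J u_xxx is exactly the dissipation density in the energy inequality. -/
theorem integrable_dissipation (h : IsThinFilmSolutionWith a b n ε uin uin' u ux uxx uxxx)
    (hn0 : 0 < n) (hε : 0 < ε) (hT : 0 < T) (hE0 : 0 ≤ E)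
    (hE : ∫⁻ x in Ioo a b, ENNReal.ofReal (uin' x ^ 2 / 2) ≤ ENNReal.ofReal E) :
    IntegrableOn (fun z : ℝ × ℝ => thinFlux n ε u uxxx z * onPos u uxxx z)
      (Ioo 0 T ×ˢ Ioo a b) ∧
      ∫ z in Ioo 0 T ×ˢ Ioo a b, thinFlux n ε u uxxx z * onPos u uxxx z ≤ E := by
  have hm : AEStronglyMeasurable (fun z : ℝ × ℝ => thinFlux n ε u uxxx z * onPos u uxxx z)
      (volume.restrict (Ioo 0 T ×ˢ Ioo a b)) :=
    (h.aesm_thinFlux hn0).mul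
      (aestronglyMeasurable_onPos (aesm h.measurable_u) (aesm h.measurable_uxxx))
  refine integrable_of_lintegral_ofReal_le hm ?_ hE0 ?_
  · filter_upwards [ae_mem_spaceTime a b T] with z hz
    have hu := h.nonneg z.1 hz.1.1.le z.2 (Ioo_subset_Icc_self hz.2)
    have := mobility_nonneg (n := n) hε hu
    simp only [thinFlux, Pi.zero_apply]
    rw [mul_assoc]
    exact mul_nonneg (by positivity) (mul_self_nonneg _)
  · rw [h.lintegral_eq_posSet hm (G := fun t x => |Real.log ε| * mobility n ε (u t x) * uxxx t x ^ 2)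
      (fun t x hx => by rw [onPos_of_not_pos hx, mul_zero])
      (fun t x hx => by rw [thinFlux, onPos_of_pos hx]; ring)]
    exact (le_add_left le_rfl).trans ((h.energy T hT).trans hE)

/-- J² is |ln ε| m(u) times the dissipation density, and m(u) ≤ m(M). The bound involves |ln ε| and
is not meant to be uniform; it only makes the chain rule applicable for each ε. -/
theorem memLp_thinFlux (h : IsThinFilmSolutionWith a b n ε uin uin' u ux uxx uxxx)
    (hn0 : 0 < n) (hε : 0 < ε) (hT : 0 < T) (hE0 : 0 ≤ E)
    (hE : ∫⁻ x in Ioo a b, ENNReal.ofReal (uin' x ^ 2 / 2) ≤ ENNReal.ofReal E)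
    (hM : ∀ t, 0 < t → ∀ x ∈ Ioo a b, u t x ≤ M) :
    MemLp (thinFlux n ε u uxxx) 2 (volume.restrict (Ioo 0 T ×ˢ Ioo a b)) := by
  rw [memLp_two_iff_integrable_sq (h.aesm_thinFlux hn0)]
  refine ((h.integrable_dissipation hn0 hε hT hE0 hE).1.const_mul
    (|Real.log ε| * mobility n ε M)).mono' ((h.aesm_thinFlux hn0).pow 2) ?_
  filter_upwards [ae_mem_spaceTime a b T] with z hz
  have hu := h.nonneg z.1 hz.1.1.le z.2 (Ioo_subset_Icc_self hz.2)
  have h1 := mobility_nonneg (n := n) hε hu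
  have h2 := mobility_le hn0 hε hu (hM z.1 hz.1.1 z.2 hz.2)
  rw [Real.norm_of_nonneg (sq_nonneg _)]
  simp only [thinFlux]
  have e1 : (|Real.log ε| * mobility n ε (u z.1 z.2) * onPos u uxxx z) ^ 2
    = |Real.log ε| * mobility n ε (u z.1 z.2) * (|Real.log ε| * mobility n ε (u z.1 z.2) * onPos u uxxx z ^ 2) := by ring
  have e2 : |Real.log ε| * mobility n ε M * (|Real.log ε| * mobility n ε (u z.1 z.2) * onPos u uxxx z * onPos u uxxx z)
    = |Real.log ε| * mobility n ε M * (|Real.log ε| * mobility n ε (u z.1 z.2) * onPos u uxxx z ^ 2) := by ring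
  rw [e1, e2]
  gcongr

theorem aesm_rhoSource (h : IsThinFilmSolutionWith a b n ε uin uin' u ux uxx uxxx) :
    AEStronglyMeasurable (rhoSource u uxx) (volume.restrict (Ioo 0 T ×ˢ Ioo a b)) :=
  (aesm h.measurable_u).mul
    ((aestronglyMeasurable_onPos (aesm h.measurable_u) (aesm h.measurable_uxx)).pow 2)

/-- In the entropy inequality the initial entropy is non-negative and is dropped; the entropy at
time T is at most R(b-a). -/
theorem integrable_rhoSource (h : IsThinFilmSolutionWith a b n ε uin uin' u ux uxx uxxx)
    (hab : a < b) (hT : 0 < T) (hR0 : 0 ≤ R)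
    (hR : ∀ t, 0 < t → ∀ x ∈ Ioo a b, rhoEps n ε u t x ≤ R) :
    IntegrableOn (rhoSource u uxx) (Ioo 0 T ×ˢ Ioo a b) ∧
      ∫ z in Ioo 0 T ×ˢ Ioo a b, rhoSource u uxx z ≤ R * (b - a) := by
  refine integrable_of_lintegral_ofReal_le h.aesm_rhoSource ?_ (mul_nonneg hR0 (sub_pos.2 hab).le) ?_
  · filter_upwards [ae_mem_spaceTime a b T] with z hz
    exact mul_nonneg (h.nonneg z.1 hz.1.1.le z.2 (Ioo_subset_Icc_self hz.2)) (sq_nonneg _)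
  · rw [h.lintegral_eq_posSet h.aesm_rhoSource (G := fun t x => u t x * uxx t x ^ 2)
      (fun t x hx => by rw [rhoSource, onPos_of_not_pos hx]; ring)
      (fun t x hx => by rw [rhoSource, onPos_of_pos hx])]
    refine ((le_add_right le_rfl).trans (h.entropy T hT)).trans ?_
    calc ∫⁻ x in Ioo a b, ENNReal.ofReal (rhoEps n ε u T x) ≤ ∫⁻ _ in Ioo a b, ENNReal.ofReal R :=
          setLIntegral_mono' measurableSet_Ioo fun x hx => ENNReal.ofReal_le_ofReal (hR T hT x hx)
      _ = ENNReal.ofReal (R * (b - a)) := by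
          rw [setLIntegral_const, Real.volume_Ioo, ENNReal.ofReal_mul hR0]

theorem abs_onPos_le (u f : ℝ → ℝ → ℝ) (z : ℝ × ℝ) : |onPos u f z| ≤ |f z.1 z.2| :=
  norm_indicator_le_norm_self (fun z : ℝ × ℝ => f z.1 z.2) z

/-- Young's inequality: u|u_x||u_xx| ≤ (u u_xx² + M u_x²)/2. -/
theorem integrable_mixed (h : IsThinFilmSolutionWith a b n ε uin uin' u ux uxx uxxx)
    (hab : a < b) (hT : 0 < T) (hE0 : 0 ≤ E)
    (hE : ∫⁻ x in Ioo a b, ENNReal.ofReal (uin' x ^ 2 / 2) ≤ ENNReal.ofReal E)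
    (hM : ∀ t, 0 < t → ∀ x ∈ Ioo a b, u t x ≤ M) (hM0 : 0 ≤ M) (hR0 : 0 ≤ R)
    (hR : ∀ t, 0 < t → ∀ x ∈ Ioo a b, rhoEps n ε u t x ≤ R) :
    IntegrableOn (fun z : ℝ × ℝ => u z.1 z.2 * onPos u ux z * onPos u uxx z) (Ioo 0 T ×ˢ Ioo a b) ∧
      ∫ z in Ioo 0 T ×ˢ Ioo a b, |u z.1 z.2 * onPos u ux z * onPos u uxx z|
        ≤ (R * (b - a) + M * (2 * E * T)) / 2 := by
  obtain ⟨i1, b1⟩ := h.integrable_rhoSource hab hT hR0 hR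
  obtain ⟨i2, b2⟩ := h.integrable_ux_sq hT hE0 hE
  have hm : AEStronglyMeasurable (fun z : ℝ × ℝ => u z.1 z.2 * onPos u ux z * onPos u uxx z)
      (volume.restrict (Ioo 0 T ×ˢ Ioo a b)) :=
    ((aesm h.measurable_u).mul (aestronglyMeasurable_onPos (aesm h.measurable_u)
      (aesm h.measurable_ux))).mul
      (aestronglyMeasurable_onPos (aesm h.measurable_u) (aesm h.measurable_uxx))
  have i3 : IntegrableOn (fun z : ℝ × ℝ => (rhoSource u uxx z + M * ux z.1 z.2 ^ 2) / 2)
      (Ioo 0 T ×ˢ Ioo a b) := (i1.add (i2.const_mul M)).div_const 2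
  have hle : ∀ᵐ z ∂(volume : Measure (ℝ × ℝ)).restrict (Ioo 0 T ×ˢ Ioo a b),
      ‖u z.1 z.2 * onPos u ux z * onPos u uxx z‖ ≤ (rhoSource u uxx z + M * ux z.1 z.2 ^ 2) / 2 := by
    filter_upwards [ae_mem_spaceTime a b T] with z hz
    have hu := h.nonneg z.1 hz.1.1.le z.2 (Ioo_subset_Icc_self hz.2)
    have huM := hM z.1 hz.1.1 z.2 hz.2
    have hp := abs_onPos_le u ux z
    rw [Real.norm_eq_abs, abs_mul, abs_mul, abs_of_nonneg hu, rhoSource, ← sq_abs (onPos u uxx z),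
      ← sq_abs (ux z.1 z.2)]
    have h1 : u z.1 z.2 * |onPos u ux z| ^ 2 ≤ M * |ux z.1 z.2| ^ 2 := by gcongr
    nlinarith [mul_nonneg hu (sq_nonneg (|onPos u ux z| - |onPos u uxx z|))]
  refine ⟨i3.mono' hm hle, ?_⟩
  have h4 : ∫ z in Ioo 0 T ×ˢ Ioo a b, |u z.1 z.2 * onPos u ux z * onPos u uxx z|
      ≤ ∫ z in Ioo 0 T ×ˢ Ioo a b, (rhoSource u uxx z + M * ux z.1 z.2 ^ 2) / 2 :=
    integral_mono_ae (i3.mono' hm hle).norm i3 hle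
  refine h4.trans ?_
  rw [integral_div, integral_add i1 (i2.const_mul M), integral_const_mul]
  gcongr

/-- Young's inequality with weight |ln ε| m(u): b|J| ≤ |ln ε| m (b² + u_xxx²)/2. The first part is
bounded pointwise by `beps_sq_mul_mobility_le`, the second is the dissipation. -/
theorem integrable_drive (h : IsThinFilmSolutionWith a b n ε uin uin' u ux uxx uxxx)
    (hab : a < b) (hn0 : 0 < n) (hn3 : n < 3) (hε : 0 < ε) (hε1 : ε < 1) (hT : 0 < T) (hE0 : 0 ≤ E)
    (hE : ∫⁻ x in Ioo a b, ENNReal.ofReal (uin' x ^ 2 / 2) ≤ ENNReal.ofReal E)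
    (hM : ∀ t, 0 < t → ∀ x ∈ Ioo a b, u t x ≤ M) :
    IntegrableOn (fun z : ℝ × ℝ => (Ioi (0 : ℝ)).indicator (beps n ε) (u z.1 z.2)
        * thinFlux n ε u uxxx z) (Ioo 0 T ×ˢ Ioo a b) ∧
      ∫ z in Ioo 0 T ×ˢ Ioo a b, |(Ioi (0 : ℝ)).indicator (beps n ε) (u z.1 z.2)
        * thinFlux n ε u uxxx z|
        ≤ (|Real.log ε|⁻¹ * (bconst' n * (1 + M)) * (T * (b - a)) + E) / 2 := by
  obtain ⟨i1, b1⟩ := h.integrable_dissipation hn0 hε hT hE0 hE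
  have hm : AEStronglyMeasurable (fun z : ℝ × ℝ => (Ioi (0 : ℝ)).indicator (beps n ε) (u z.1 z.2)
        * thinFlux n ε u uxxx z) (volume.restrict (Ioo 0 T ×ˢ Ioo a b)) :=
    (((measurable_indicator_beps n hε).comp_aemeasurable
      (aesm h.measurable_u).aemeasurable).aestronglyMeasurable).mul (h.aesm_thinFlux hn0)
  set c := |Real.log ε|⁻¹ * (bconst' n * (1 + M)) with hc
  have hfin : (volume : Measure (ℝ × ℝ)) (Ioo 0 T ×ˢ Ioo a b) ≠ ⊤ := by
    rw [Measure.volume_eq_prod, Measure.prod_prod]; simp [ENNReal.mul_ne_top]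
  have ic : IntegrableOn (fun _ : ℝ × ℝ => c) (Ioo 0 T ×ˢ Ioo a b) := integrableOn_const hfin
  have i3 : IntegrableOn (fun z : ℝ × ℝ => (c + thinFlux n ε u uxxx z * onPos u uxxx z) / 2)
      (Ioo 0 T ×ˢ Ioo a b) := (ic.add i1).div_const 2
  have hbc : 0 ≤ bconst' n := by unfold bconst'; positivity
  have hle : ∀ᵐ z ∂(volume : Measure (ℝ × ℝ)).restrict (Ioo 0 T ×ˢ Ioo a b),
      ‖(Ioi (0 : ℝ)).indicator (beps n ε) (u z.1 z.2) * thinFlux n ε u uxxx z‖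
        ≤ (c + thinFlux n ε u uxxx z * onPos u uxxx z) / 2 := by
    filter_upwards [ae_mem_spaceTime a b T] with z hz
    have hu := h.nonneg z.1 hz.1.1.le z.2 (Ioo_subset_Icc_self hz.2)
    have huM := hM z.1 hz.1.1 z.2 hz.2
    have hc0 : 0 ≤ c := by
      have : 0 ≤ 1 + M := by linarith
      positivity
    rcases hu.eq_or_lt with hu0 | hu0
    · have h1 : ¬0 < u z.1 z.2 := by rw [← hu0]; exact lt_irrefl _
      have h2 : onPos u uxxx z = 0 := onPos_of_not_pos h1
      rw [thinFlux, h2]; simp; linarith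
    · rw [indicator_of_mem (show u z.1 z.2 ∈ Ioi 0 from hu0), thinFlux]
      have h1 := beps_sq_mul_mobility_le hn0 hn3 hε hε1 hu0
      have h2 : |Real.log ε|⁻¹ * (bconst' n * (1 + u z.1 z.2)) ≤ c := by rw [hc]; gcongr
      have h3 := mobility_nonneg (n := n) hε hu
      have h4 := beps_nonneg n hε hu
      rw [Real.norm_eq_abs, abs_mul, abs_mul, abs_of_nonneg h4, abs_of_nonneg (mul_nonneg (abs_nonneg _) h3)]
      have h5 : 0 ≤ |Real.log ε| * mobility n ε (u z.1 z.2)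
          * (beps n ε (u z.1 z.2) - |onPos u uxxx z|) ^ 2 := by positivity
      have h6 : |Real.log ε| * mobility n ε (u z.1 z.2) * onPos u uxxx z * onPos u uxxx z
          = |Real.log ε| * mobility n ε (u z.1 z.2) * |onPos u uxxx z| ^ 2 := by
        rw [sq_abs]; ring
      rw [h6]
      linarith
  refine ⟨i3.mono' hm hle, ?_⟩
  have h4 : ∫ z in Ioo 0 T ×ˢ Ioo a b, |(Ioi (0 : ℝ)).indicator (beps n ε) (u z.1 z.2)
        * thinFlux n ε u uxxx z|
      ≤ ∫ z in Ioo 0 T ×ˢ Ioo a b, (c + thinFlux n ε u uxxx z * onPos u uxxx z) / 2 :=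
    integral_mono_ae (i3.mono' hm hle).norm i3 hle
  refine h4.trans ?_
  have hvol : (volume : Measure (ℝ × ℝ)).real (Ioo 0 T ×ˢ Ioo a b) = T * (b - a) := by
    rw [measureReal_def, Measure.volume_eq_prod, Measure.prod_prod, ENNReal.toReal_mul, Real.volume_Ioo, Real.volume_Ioo,
      ENNReal.toReal_ofReal (by linarith), ENNReal.toReal_ofReal (by linarith), sub_zero]
  rw [integral_div, integral_add ic i1, setIntegral_const, hvol, smul_eq_mul, mul_comm _ c]
  gcongr

end IsThinFilmSolutionWith

end

/-! ### The cubic flux term and integrability of u_x² u_xx -/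

section

namespace IsThinFilmSolutionWith

variable {a b n ε : ℝ} {uin uin' : ℝ → ℝ} {u ux uxx uxxx : ℝ → ℝ → ℝ} {E M R T : ℝ}

theorem integrableOn_posSet_of_slice (h : IsThinFilmSolutionWith a b n ε uin uin' u ux uxx uxxx)
    {t : ℝ} (ht : 0 ≤ t) {F : ℝ × ℝ → ℝ} {G : ℝ → ℝ}
    (hF : IntegrableOn (fun x => F (t, x)) (Ioo a b)) (hFG : ∀ x, 0 < u t x → F (t, x) = G x) :
    IntegrableOn G (posSet a b (u t)) :=
  (hF.mono_set (posSet_subset a b (u t))).congr_fun (fun x hx => hFG x hx.2)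
    (h.isOpen_pos ht).measurableSet

theorem aesm_onPos_ux (h : IsThinFilmSolutionWith a b n ε uin uin' u ux uxx uxxx) :
    AEStronglyMeasurable (onPos u ux) (volume.restrict (Ioo 0 T ×ˢ Ioo a b)) :=
  aestronglyMeasurable_onPos (aesm h.measurable_u) (aesm h.measurable_ux)

theorem aesm_onPos_uxx (h : IsThinFilmSolutionWith a b n ε uin uin' u ux uxx uxxx) :
    AEStronglyMeasurable (onPos u uxx) (volume.restrict (Ioo 0 T ×ˢ Ioo a b)) :=
  aestronglyMeasurable_onPos (aesm h.measurable_u) (aesm h.measurable_uxx)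

/-- The Neumann estimate on almost every time slice, integrated in time, bounds |u_x|³ by twice the
mixed term. -/
theorem integrable_cube (h : IsThinFilmSolutionWith a b n ε uin uin' u ux uxx uxxx)
    (hab : a < b) (hT : 0 < T) (hE0 : 0 ≤ E)
    (hE : ∫⁻ x in Ioo a b, ENNReal.ofReal (uin' x ^ 2 / 2) ≤ ENNReal.ofReal E)
    (hM : ∀ t, 0 < t → ∀ x ∈ Ioo a b, u t x ≤ M) (hM0 : 0 ≤ M) (hR0 : 0 ≤ R)
    (hR : ∀ t, 0 < t → ∀ x ∈ Ioo a b, rhoEps n ε u t x ≤ R) :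
    IntegrableOn (fun z => onPos u ux z ^ 3) (Ioo 0 T ×ˢ Ioo a b) ∧
      ∫ z in Ioo 0 T ×ˢ Ioo a b, |onPos u ux z ^ 3| ≤ R * (b - a) + M * (2 * E * T) := by
  obtain ⟨i1, -⟩ := h.integrable_rhoSource hab hT hR0 hR
  obtain ⟨i2, b2⟩ := h.integrable_mixed hab hT hE0 hE hM hM0 hR0 hR
  have hm3 : AEStronglyMeasurable (fun z => onPos u ux z ^ 3)
    (volume.restrict (Ioo 0 T ×ˢ Ioo a b)) := h.aesm_onPos_ux.pow 3
  have hm : AEStronglyMeasurable (fun z => |onPos u ux z ^ 3|)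
    (volume.restrict (Ioo 0 T ×ˢ Ioo a b)) := hm3.norm
  have key := integrable_of_lintegral_ofReal_le hm (Eventually.of_forall fun z => abs_nonneg _)
    (C := R * (b - a) + M * (2 * E * T))
    (add_nonneg (mul_nonneg hR0 (sub_pos.2 hab).le) (by positivity)) (by
      rw [h.lintegral_eq_posSet hm (G := fun t x => |ux t x| ^ 3)
        (fun t x hx => by rw [onPos_of_not_pos hx]; simp)
        (fun t x hx => by rw [onPos_of_pos hx, abs_pow])]
      calc ∫⁻ t in Ioo 0 T, ∫⁻ x in posSet a b (u t), ENNReal.ofReal (|ux t x| ^ 3)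
          ≤ ∫⁻ t in Ioo 0 T, 2 * ∫⁻ x in posSet a b (u t),
              ENNReal.ofReal (u t x * |ux t x| * |uxx t x|) := by
            refine lintegral_mono_ae ?_
            filter_upwards [ae_slice_integrable i1, ae_slice_integrable i2, ae_Ioo h.weakDeriv_uxx,
              ae_Ioo h.weakDeriv_uxxx, ae_Ioo h.neumann, ae_restrict_mem measurableSet_Ioo]
              with t h1 h2 h3 h4 h5 ht
            refine slice_lintegral_abs_cube_le hab (h.continuousOn t ht.1.le) (h.weakDeriv_ux t ht.1)
              h3 h4 h5.1 h5.2 ?_ ?_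
            · exact h.integrableOn_posSet_of_slice ht.1.le h1 fun x hx => by
                rw [rhoSource, onPos_of_pos hx]
            · exact h.integrableOn_posSet_of_slice (F := fun z =>
                |u z.1 z.2 * onPos u ux z * onPos u uxx z|) ht.1.le h2.norm fun x hx => by
                simp only
                rw [onPos_of_pos hx, onPos_of_pos hx, abs_mul, abs_mul, abs_of_pos hx]
        _ = 2 * ∫⁻ t in Ioo 0 T, ∫⁻ x in posSet a b (u t),
              ENNReal.ofReal (u t x * |ux t x| * |uxx t x|) := lintegral_const_mul' _ _ (by simp)
        _ = 2 * ∫⁻ z in Ioo 0 T ×ˢ Ioo a b,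
              ENNReal.ofReal |u z.1 z.2 * onPos u ux z * onPos u uxx z| := by
            have hm' : AEStronglyMeasurable (fun z : ℝ × ℝ =>
              |u z.1 z.2 * onPos u ux z * onPos u uxx z|)
              (volume.restrict (Ioo 0 T ×ˢ Ioo a b)) := i2.1.norm
            rw [h.lintegral_eq_posSet hm' (G := fun t x => u t x * |ux t x| * |uxx t x|)
              (fun t x hx => by rw [onPos_of_not_pos hx]; simp)
              (fun t x hx => by
                simp only
                rw [onPos_of_pos hx, onPos_of_pos hx, abs_mul, abs_mul, abs_of_pos hx])]
        _ = 2 * ENNReal.ofReal (∫ z in Ioo 0 T ×ˢ Ioo a b,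
              |u z.1 z.2 * onPos u ux z * onPos u uxx z|) := by
            have i2' : IntegrableOn (fun z : ℝ × ℝ =>
              |u z.1 z.2 * onPos u ux z * onPos u uxx z|) (Ioo 0 T ×ˢ Ioo a b) := i2.norm
            rw [ofReal_integral_eq_lintegral_ofReal i2' (Eventually.of_forall fun z => abs_nonneg _)]
        _ ≤ 2 * ENNReal.ofReal ((R * (b - a) + M * (2 * E * T)) / 2) := by gcongr
        _ = ENNReal.ofReal (R * (b - a) + M * (2 * E * T)) := by
            rw [show (2 : ℝ≥0∞) = ENNReal.ofReal 2 by simp, ← ENNReal.ofReal_mul zero_le_two,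
              mul_div_cancel₀ _ two_ne_zero])
  exact ⟨(integrable_norm_iff hm3).1 key.1, key.2⟩

theorem integrable_rhoFlux (h : IsThinFilmSolutionWith a b n ε uin uin' u ux uxx uxxx)
    (hab : a < b) (hn0 : 0 < n) (hn3 : n < 3) (hε : 0 < ε) (hε1 : ε < 1) (hT : 0 < T) (hE0 : 0 ≤ E)
    (hE : ∫⁻ x in Ioo a b, ENNReal.ofReal (uin' x ^ 2 / 2) ≤ ENNReal.ofReal E)
    (hM : ∀ t, 0 < t → ∀ x ∈ Ioo a b, u t x ≤ M) (hM0 : 0 ≤ M) (hR0 : 0 ≤ R)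
    (hR : ∀ t, 0 < t → ∀ x ∈ Ioo a b, rhoEps n ε u t x ≤ R) :
    IntegrableOn (rhoFlux n ε u ux uxx uxxx) (Ioo 0 T ×ˢ Ioo a b) ∧
      ∫ z in Ioo 0 T ×ˢ Ioo a b, |rhoFlux n ε u ux uxx uxxx z|
        ≤ (|Real.log ε|⁻¹ * (bconst' n * (1 + M)) * (T * (b - a)) + E) / 2
          + (R * (b - a) + M * (2 * E * T)) := by
  obtain ⟨i1, b1⟩ := h.integrable_drive hab hn0 hn3 hε hε1 hT hE0 hE hM
  obtain ⟨i2, b2⟩ := h.integrable_mixed hab hT hE0 hE hM hM0 hR0 hR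
  obtain ⟨i3, b3⟩ := h.integrable_cube hab hT hE0 hE hM hM0 hR0 hR
  have i4 : IntegrableOn (rhoFlux n ε u ux uxx uxxx) (Ioo 0 T ×ˢ Ioo a b) :=
    ((i1.add i2).sub (i3.div_const 3)).neg
  refine ⟨i4, ?_⟩
  have i1' : IntegrableOn (fun z : ℝ × ℝ => |(Ioi (0 : ℝ)).indicator (beps n ε) (u z.1 z.2)
        * thinFlux n ε u uxxx z|) (Ioo 0 T ×ˢ Ioo a b) := i1.norm
  have i2' : IntegrableOn (fun z : ℝ × ℝ => |u z.1 z.2 * onPos u ux z * onPos u uxx z|)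
        (Ioo 0 T ×ˢ Ioo a b) := i2.norm
  have i12 : IntegrableOn (fun z => |(Ioi (0 : ℝ)).indicator (beps n ε) (u z.1 z.2)
        * thinFlux n ε u uxxx z| + |u z.1 z.2 * onPos u ux z * onPos u uxx z|)
        (Ioo 0 T ×ˢ Ioo a b) := i1.norm.add i2.norm
  have i3' : IntegrableOn (fun z => |onPos u ux z ^ 3|) (Ioo 0 T ×ˢ Ioo a b) := i3.norm
  have h5 : ∫ z in Ioo 0 T ×ˢ Ioo a b, |rhoFlux n ε u ux uxx uxxx z|
      ≤ ∫ z in Ioo 0 T ×ˢ Ioo a b, (|(Ioi (0 : ℝ)).indicator (beps n ε) (u z.1 z.2)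
        * thinFlux n ε u uxxx z| + |u z.1 z.2 * onPos u ux z * onPos u uxx z|
        + |onPos u ux z ^ 3| / 3) := by
    refine integral_mono i4.norm (i12.add (i3'.div_const 3)) fun z => ?_
    simp only [rhoFlux, abs_neg]
    refine (abs_sub _ _).trans ?_
    rw [abs_div, abs_of_pos (show (0 : ℝ) < 3 by norm_num)]
    gcongr
    exact abs_add_le _ _
  refine h5.trans ?_
  rw [integral_add i12 (i3'.div_const 3), integral_add i1' i2', integral_div]
  have h6 : ∫ z in Ioo 0 T ×ˢ Ioo a b, |onPos u ux z ^ 3| ≥ 0 := integral_nonneg fun _ => abs_nonneg _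
  have h7 : 0 ≤ R * (b - a) + M * (2 * E * T) := add_nonneg (mul_nonneg hR0 (sub_pos.2 hab).le) (by positivity)
  linarith

/-- The integrability of `u_x² u_xx` and the corresponding integration by parts, for `n < 2`. -/
theorem square_mul_of_lt_two (h : IsThinFilmSolutionWith a b n ε uin uin' u ux uxx uxxx)
    (hab : a < b) (hT : 0 < T) (hE0 : 0 ≤ E)
    (hE : ∫⁻ x in Ioo a b, ENNReal.ofReal (uin' x ^ 2 / 2) ≤ ENNReal.ofReal E) (hn2 : n < 2) :
    IntegrableOn (fun z => onPos u ux z ^ 2 * onPos u uxx z) (Ioo 0 T ×ˢ Ioo a b) ∧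
      ∀ᵐ t ∂volume.restrict (Ioo 0 T), ∀ φ, IsTestFun (Ioo a b) φ →
        ∫ x in posSet a b (u t), φ x * (ux t x ^ 2 * uxx t x)
          = -∫ x in posSet a b (u t), deriv φ x * (ux t x ^ 3 / 3) := by
  obtain ⟨w₁, w₂, hw, -, -, hw2⟩ := h.regularity_lt_two hn2 T hT
  obtain ⟨iu, -⟩ := h.integrable_ux_sq hT hE0 hE
  have hw2i : IntegrableOn (fun z : ℝ × ℝ => w₂ z.1 z.2 ^ 2) (Ioo 0 T ×ˢ Ioo a b) := hw2.integrable_sq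
  -- By uniqueness of weak derivatives the function `w₁` from the regularity assumption is `ux`, so
  -- `w₂` is a weak derivative of `ux` on all of (a,b), not merely on {u > 0}.
  have hweak : ∀ᵐ t ∂volume.restrict (Ioo 0 T), HasWeakDerivOn (Ioo a b) (ux t) (w₂ t) := by
    filter_upwards [hw, ae_restrict_mem measurableSet_Ioo] with t ht htI
    have h1 := (h.weakDeriv_ux t htI.1).ae_eq isOpen_Ioo ht.1 (Eventually.of_forall fun _ _ => rfl)
    refine ⟨(h.weakDeriv_ux t htI.1).2.1, ht.2.2.1, fun φ hφ => ?_⟩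
    rw [← ht.2.2.2 φ hφ]
    refine setIntegral_congr_ae measurableSet_Ioo (h1.mono fun x hx hxI => by rw [hx hxI])
  have hcube : ∀ᵐ t ∂volume.restrict (Ioo 0 T), ∀ φ, IsTestFun (Ioo a b) φ →
        ∫ x in posSet a b (u t), φ x * (ux t x ^ 2 * uxx t x)
          = -∫ x in posSet a b (u t), deriv φ x * (ux t x ^ 3 / 3) := by
    filter_upwards [hweak, ae_Ioo h.weakDeriv_uxx, ae_restrict_mem measurableSet_Ioo]
      with t h1 h2 ht φ hφ
    exact slice_cube_of_weakDeriv (h.continuousOn t ht.1.le) (h.nonneg t ht.1.le)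
      (h.weakDeriv_ux t ht.1) h2 h1 hφ
  refine ⟨?_, hcube⟩
  -- the fourth power
  have hm4 : AEStronglyMeasurable (fun z : ℝ × ℝ => ux z.1 z.2 ^ 4)
      (volume.restrict (Ioo 0 T ×ˢ Ioo a b)) := (aesm h.measurable_ux).pow 4
  set A : ℝ → ℝ := fun t => ∫ y in Ioo a b, ux t y ^ 2 with hA
  set W : ℝ → ℝ := fun t => ∫ y in Ioo a b, w₂ t y ^ 2 with hW
  have iA : Integrable A (volume.restrict (Ioo 0 T)) := by
    rw [IntegrableOn, volume_restrict_prod] at iu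
    exact iu.integral_prod_left
  have iW : Integrable W (volume.restrict (Ioo 0 T)) := by
    rw [IntegrableOn, volume_restrict_prod] at hw2i
    exact hw2i.integral_prod_left
  have hba := sub_pos.2 hab
  -- Interpolation: ∫ u_x⁴ ≤ (sup u_x²) ∫ u_x². The last factor is at most 2E at every time, and the
  -- supremum is integrable in time because u_x ∈ L²H¹.
  have i4 : IntegrableOn (fun z : ℝ × ℝ => ux z.1 z.2 ^ 4) (Ioo 0 T ×ˢ Ioo a b) := by
    refine ⟨hm4, ?_⟩
    rw [hasFiniteIntegral_iff_ofReal (Eventually.of_forall fun z => by positivity),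
      lintegral_spaceTime hm4.aemeasurable.ennreal_ofReal]
    have hB : Integrable (fun t => (2 / (b - a) * A t + 2 * (b - a) * W t) * (2 * E))
      (volume.restrict (Ioo 0 T)) := ((iA.const_mul _).add (iW.const_mul _)).mul_const _
    refine lt_of_le_of_lt (lintegral_mono_ae ?_) hB.lintegral_lt_top
    filter_upwards [hweak, ae_slice_integrable hw2i, ae_restrict_mem measurableSet_Ioo]
      with t h1 h2 ht
    have h3 : MemLp (w₂ t) 2 (volume.restrict (Ioo a b)) :=
      (memLp_two_iff_integrable_sq (h1.2.1.aestronglyMeasurable)).2 h2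
    have h4 := h1.ae_sq_le hab (h.memLp_ux t ht.1) h3
    obtain ⟨h5, h6⟩ := integrable_sq_of_lintegral_le (h.memLp_ux t ht.1).1
      ((le_add_right le_rfl).trans ((h.energy t ht.1).trans hE)) hE0
    have hA0 : 0 ≤ A t := integral_nonneg fun _ => sq_nonneg _
    have hW0 : 0 ≤ W t := integral_nonneg fun _ => sq_nonneg _
    have hK0 : 0 ≤ 2 / (b - a) * A t + 2 * (b - a) * W t := by positivity
    calc ∫⁻ x in Ioo a b, ENNReal.ofReal (ux t x ^ 4)
        ≤ ∫⁻ x in Ioo a b, ENNReal.ofReal ((2 / (b - a) * A t + 2 * (b - a) * W t) * ux t x ^ 2) := by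
          refine lintegral_mono_ae ((ae_restrict_iff' measurableSet_Ioo).2 (h4.mono fun x hx hxI => ?_))
          refine ENNReal.ofReal_le_ofReal ?_
          have := hx hxI
          rw [show ux t x ^ 4 = ux t x ^ 2 * ux t x ^ 2 by ring]
          exact mul_le_mul_of_nonneg_right this (sq_nonneg _)
      _ = ENNReal.ofReal (∫ x in Ioo a b, (2 / (b - a) * A t + 2 * (b - a) * W t) * ux t x ^ 2) :=
          (ofReal_integral_eq_lintegral_ofReal (h5.const_mul _)
            (Eventually.of_forall fun x => mul_nonneg hK0 (sq_nonneg _))).symm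
      _ ≤ ENNReal.ofReal ((2 / (b - a) * A t + 2 * (b - a) * W t) * (2 * E)) := by
          rw [integral_const_mul]
          gcongr
  have hmw : AEStronglyMeasurable (onPos u w₂) (volume.restrict (Ioo 0 T ×ˢ Ioo a b)) :=
    aestronglyMeasurable_onPos (aesm h.measurable_u) hw2.1
  have heq : ∀ᵐ z ∂(volume : Measure (ℝ × ℝ)).restrict (Ioo 0 T ×ˢ Ioo a b),
      onPos u uxx z = onPos u w₂ z := by
    refine ae_of_ae_slice (nullMeasurableSet_eq_fun h.aesm_onPos_uxx.aemeasurable hmw.aemeasurable) ?_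
    filter_upwards [hweak, ae_Ioo h.weakDeriv_uxx, ae_restrict_mem measurableSet_Ioo]
      with t h1 h2 ht
    have h3 := h2.ae_eq (h.isOpen_pos ht.1.le) (h1.mono (posSet_subset a b (u t)))
      (Eventually.of_forall fun _ _ => rfl)
    rw [ae_restrict_iff' measurableSet_Ioo]
    filter_upwards [h3] with x hx hxI
    by_cases hu : 0 < u t x
    · rw [onPos_of_pos hu, onPos_of_pos hu, hx ⟨hxI, hu⟩]
    · rw [onPos_of_not_pos hu, onPos_of_not_pos hu]
  have hbd : IntegrableOn (fun z : ℝ × ℝ => (ux z.1 z.2 ^ 4 + w₂ z.1 z.2 ^ 2) / 2)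
    (Ioo 0 T ×ˢ Ioo a b) := (i4.add hw2i).div_const 2
  refine hbd.mono' ((h.aesm_onPos_ux.pow 2).mul h.aesm_onPos_uxx) ?_
  filter_upwards [heq] with z hz
  have h1 := abs_onPos_le u ux z
  have h2 := abs_onPos_le u w₂ z
  have h3 : |onPos u ux z| ^ 4 ≤ |ux z.1 z.2| ^ 4 := by gcongr
  have h4 : |onPos u w₂ z| ^ 2 ≤ |w₂ z.1 z.2| ^ 2 := by gcongr
  rw [sq_abs (w₂ z.1 z.2)] at h4
  rw [Even.pow_abs (by decide) (ux z.1 z.2)] at h3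
  rw [hz, norm_mul, norm_pow, Real.norm_eq_abs, Real.norm_eq_abs]
  nlinarith [sq_nonneg (|onPos u ux z| ^ 2 - |onPos u w₂ z|)]

/-- The integrability of `u_x² u_xx` and the corresponding integration by parts, for `n ≥ 2`. -/
theorem square_mul_of_two_le (h : IsThinFilmSolutionWith a b n ε uin uin' u ux uxx uxxx)
    (hab : a < b) (hT : 0 < T) (hE0 : 0 ≤ E)
    (hE : ∫⁻ x in Ioo a b, ENNReal.ofReal (uin' x ^ 2 / 2) ≤ ENNReal.ofReal E)
    (hM : ∀ t, 0 < t → ∀ x ∈ Ioo a b, u t x ≤ M) (hM0 : 0 ≤ M) (hR0 : 0 ≤ R)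
    (hR : ∀ t, 0 < t → ∀ x ∈ Ioo a b, rhoEps n ε u t x ≤ R) (hn2 : 2 ≤ n) :
    IntegrableOn (fun z => onPos u ux z ^ 2 * onPos u uxx z) (Ioo 0 T ×ˢ Ioo a b) ∧
      ∀ᵐ t ∂volume.restrict (Ioo 0 T), ∀ φ, IsTestFun (Ioo a b) φ →
        ∫ x in posSet a b (u t), φ x * (ux t x ^ 2 * uxx t x)
          = -∫ x in posSet a b (u t), deriv φ x * (ux t x ^ 3 / 3) := by
  obtain ⟨-, w₁, hw, hw4⟩ := h.regularity_ge_two hn2 T hT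
  obtain ⟨i1, -⟩ := h.integrable_rhoSource hab hT hR0 hR
  obtain ⟨i3, -⟩ := h.integrable_cube hab hT hE0 hE hM hM0 hR0 hR
  have hw4i : IntegrableOn (fun z : ℝ × ℝ => w₁ z.1 z.2 ^ 4) (Ioo 0 T ×ˢ Ioo a b) := by
    have := hw4.integrable_norm_pow (p := 4) (by norm_num)
    refine this.congr (Eventually.of_forall fun z => ?_)
    simp only [Real.norm_eq_abs]
    exact Even.pow_abs (by decide) _
  set q : ℝ → ℝ → ℝ := fun t x => ux t x ^ 4 / u t x with hq
  have hqm : AEStronglyMeasurable (onPos u q) (volume.restrict (Ioo 0 T ×ˢ Ioo a b)) := by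
    refine aestronglyMeasurable_onPos (aesm h.measurable_u) ?_
    exact (((aesm h.measurable_ux).aemeasurable.pow_const 4).div
      (aesm h.measurable_u).aemeasurable).aestronglyMeasurable
  have hmw : AEStronglyMeasurable (onPos u w₁) (volume.restrict (Ioo 0 T ×ˢ Ioo a b)) :=
    aestronglyMeasurable_onPos (aesm h.measurable_u) hw4.1
  -- On {u > 0} one has (u^{3/4})_x = (3/4) u^{-1/4} u_x, whose fourth power is (3/4)⁴ u_x⁴/u.
  have heq : ∀ᵐ z ∂(volume : Measure (ℝ × ℝ)).restrict (Ioo 0 T ×ˢ Ioo a b),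
      onPos u q z = (4 / 3) ^ 4 * onPos u w₁ z ^ 4 := by
    refine ae_of_ae_slice (nullMeasurableSet_eq_fun hqm.aemeasurable ((hmw.aemeasurable.pow_const 4).const_mul _)) ?_
    filter_upwards [hw, ae_Ioo h.weakDeriv_uxx, ae_Ioo h.weakDeriv_uxxx,
      ae_restrict_mem measurableSet_Ioo] with t h1 h2 h3 ht
    have hP := h.isOpen_pos ht.1.le
    obtain ⟨v, w, huv, hvw, -, hv, -⟩ := exists_slice_representatives (h.continuousOn t ht.1.le)
      (h.weakDeriv_ux t ht.1) h2 h3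
    have h4 : HasWeakDerivOn (posSet a b (u t)) (fun x => u t x ^ (3 / 4 : ℝ))
        (fun x => v x * (3 / 4) * u t x ^ ((3 / 4 : ℝ) - 1)) := by
      refine hasWeakDerivOn_of_hasDerivAt hP
        (fun x hx => (huv x hx).rpow_const (Or.inl hx.2.ne')) ?_
      intro x hx
      exact (((hvw x hx).continuousAt.mul continuousAt_const).mul
        ((huv x hx).continuousAt.rpow_const (Or.inl hx.2.ne'))).continuousWithinAt
    have h5 := h4.ae_eq hP (h1.mono (posSet_subset a b (u t))) (Eventually.of_forall fun _ _ => rfl)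
    rw [ae_restrict_iff' measurableSet_Ioo]
    filter_upwards [h5, hv] with x hx hx' hxI
    by_cases hu : 0 < u t x
    · have hxP : x ∈ posSet a b (u t) := ⟨hxI, hu⟩
      rw [onPos_of_pos hu, onPos_of_pos hu, ← hx hxP, hq]
      simp only
      rw [hx' hxP, mul_pow, ← Real.rpow_natCast (u t x ^ _), ← Real.rpow_mul hu.le]
      norm_num
      rw [Real.rpow_neg_one]
      ring
    · rw [onPos_of_not_pos hu, onPos_of_not_pos hu]; norm_num
  have iq : IntegrableOn (onPos u q) (Ioo 0 T ×ˢ Ioo a b) := by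
    refine (hw4i.const_mul ((4 / 3) ^ 4)).mono' hqm (heq.mono fun z hz => ?_)
    rw [hz, Real.norm_of_nonneg (by positivity)]
    refine mul_le_mul_of_nonneg_left ?_ (by positivity)
    have := abs_onPos_le u w₁ z
    rw [← Even.pow_abs (by decide : Even 4) (onPos u w₁ z), ← Even.pow_abs (by decide : Even 4) (w₁ z.1 z.2)]
    gcongr
  have hint : IntegrableOn (fun z => onPos u ux z ^ 2 * onPos u uxx z) (Ioo 0 T ×ˢ Ioo a b) := by
    have hbd : IntegrableOn (fun z : ℝ × ℝ => (onPos u q z + rhoSource u uxx z) / 2)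
      (Ioo 0 T ×ˢ Ioo a b) := (iq.add i1).div_const 2
    refine hbd.mono' ((h.aesm_onPos_ux.pow 2).mul h.aesm_onPos_uxx) (Eventually.of_forall ?_)
    rintro ⟨t, x⟩
    by_cases hu : 0 < u t x
    · rw [rhoSource, onPos_of_pos hu, onPos_of_pos hu, onPos_of_pos hu, hq]
      simp only
      -- Completing the square gives u_x²|u_xx| ≤ (u_x⁴/u + u u_xx²)/2.
      have e : (ux t x ^ 4 / u t x + u t x * uxx t x ^ 2) / 2 - |ux t x| ^ 2 * |uxx t x|
          = (|ux t x| ^ 2 - u t x * |uxx t x|) ^ 2 / (2 * u t x) := by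
        rw [← sq_abs (uxx t x), ← Even.pow_abs (by decide : Even 4) (ux t x)]
        field_simp
        ring
      have : 0 ≤ (|ux t x| ^ 2 - u t x * |uxx t x|) ^ 2 / (2 * u t x) := by positivity
      rw [norm_mul, norm_pow, Real.norm_eq_abs, Real.norm_eq_abs]
      linarith
    · rw [rhoSource, onPos_of_not_pos hu, onPos_of_not_pos hu, onPos_of_not_pos hu]; simp
  refine ⟨hint, ?_⟩
  filter_upwards [ae_slice_integrable hint, ae_slice_integrable iq, ae_slice_integrable i3,
    ae_Ioo h.weakDeriv_uxx, ae_Ioo h.weakDeriv_uxxx, ae_restrict_mem measurableSet_Ioo]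
    with t h1 h2 h3 h4 h5 ht φ hφ
  refine slice_cube_of_integrable (h.continuousOn t ht.1.le) (h.weakDeriv_ux t ht.1) h4 h5 ?_ ?_ ?_ hφ
  · exact h.integrableOn_posSet_of_slice (F := fun z => onPos u ux z ^ 2 * onPos u uxx z)
      ht.1.le h1 fun x hx => by rw [onPos_of_pos hx, onPos_of_pos hx]
  · exact h.integrableOn_posSet_of_slice ht.1.le h2 fun x hx => by rw [onPos_of_pos hx]
  · exact h.integrableOn_posSet_of_slice (F := fun z => onPos u ux z ^ 3)
      ht.1.le h3 fun x hx => by rw [onPos_of_pos hx]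

end IsThinFilmSolutionWith

end

/-! ### Space-time test functions and the equation in distributional form -/

section

section Test

variable {a b T : ℝ}

theorem fderiv_apply_one_zero {ψ : ℝ × ℝ → ℝ} (hψ : Differentiable ℝ ψ) (t x : ℝ) :
    deriv (fun s => ψ (s, x)) t = fderiv ℝ ψ (t, x) (1, 0) := by
  have h1 : HasDerivAt (fun s : ℝ => (s, x)) ((1 : ℝ), (0 : ℝ)) t :=
    (hasDerivAt_id t).prodMk (hasDerivAt_const t x)
  exact ((hψ (t, x)).hasFDerivAt.comp_hasDerivAt t h1).deriv

theorem fderiv_apply_zero_one {ψ : ℝ × ℝ → ℝ} (hψ : Differentiable ℝ ψ) (t x : ℝ) :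
    deriv (fun y => ψ (t, y)) x = fderiv ℝ ψ (t, x) (0, 1) := by
  have h1 : HasDerivAt (fun y : ℝ => (t, y)) ((0 : ℝ), (1 : ℝ)) x :=
    (hasDerivAt_const x t).prodMk (hasDerivAt_id x)
  exact ((hψ (t, x)).hasFDerivAt.comp_hasDerivAt x h1).deriv

theorem IsTestOn.isTestFun_slice {ψ : ℝ × ℝ → ℝ} (hψ : IsTestOn (Ioo 0 T ×ˢ Ioo a b) ψ) (t : ℝ) :
    IsTestFun (Ioo a b) fun x => ψ (t, x) := by
  have hK : IsCompact (Prod.snd '' tsupport ψ) := hψ.2.1.isCompact.image continuous_snd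
  have hz : ∀ x, x ∉ Prod.snd '' tsupport ψ → ψ (t, x) = 0 := fun x hx =>
    image_eq_zero_of_notMem_tsupport fun h => hx ⟨_, h, rfl⟩
  refine ⟨hψ.1.comp (contDiff_const.prodMk contDiff_id), HasCompactSupport.intro hK hz, ?_⟩
  refine (closure_minimal (fun x hx => ?_) hK.isClosed).trans ?_
  · by_contra h
    exact hx (hz x h)
  · rintro _ ⟨z, hz, rfl⟩
    exact (hψ.2.2 hz).2

theorem isTestOn_mul {θ φ : ℝ → ℝ} (hθ : IsTestFun (Ioo 0 T) θ) (hφ : IsTestFun (Ioo a b) φ) :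
    IsTestOn (Ioo 0 T ×ˢ Ioo a b) fun z : ℝ × ℝ => θ z.1 * φ z.2 := by
  have hK : IsCompact (tsupport θ ×ˢ tsupport φ) := hθ.2.1.isCompact.prod hφ.2.1.isCompact
  have hz : ∀ z : ℝ × ℝ, z ∉ tsupport θ ×ˢ tsupport φ → θ z.1 * φ z.2 = 0 := fun z hz => by
    by_cases h1 : z.1 ∈ tsupport θ
    · rw [image_eq_zero_of_notMem_tsupport fun h2 => hz ⟨h1, h2⟩, mul_zero]
    · rw [image_eq_zero_of_notMem_tsupport h1, zero_mul]
  refine ⟨(hθ.1.comp contDiff_fst).mul (hφ.1.comp contDiff_snd), HasCompactSupport.intro hK hz, ?_⟩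
  refine (closure_minimal (fun z hz' => ?_) hK.isClosed).trans (prod_mono hθ.2.2 hφ.2.2)
  by_contra h
  exact hz' (hz z h)

theorem volume_spaceTime_ne_top (a b T : ℝ) :
    (volume : Measure (ℝ × ℝ)) (Ioo 0 T ×ˢ Ioo a b) ≠ ⊤ := by
  rw [Measure.volume_eq_prod, Measure.prod_prod]; simp [ENNReal.mul_ne_top]

theorem tendsto_integral_weight {α : Type*} [MeasurableSpace α] {μ : Measure α} {A : α → ℝ} {C : ℝ}
    (hA : AEStronglyMeasurable A μ) (hAC : ∀ z, ‖A z‖ ≤ C) {F : ℕ → α → ℝ} {F₀ G : α → ℝ}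
    (hG : Integrable G μ) (hF : ∀ j, AEStronglyMeasurable (F j) μ)
    (hFG : ∀ j, ∀ᵐ z ∂μ, ‖F j z‖ ≤ G z)
    (hlim : ∀ᵐ z ∂μ, Tendsto (fun j => F j z) atTop (𝓝 (F₀ z))) :
    Tendsto (fun j => ∫ z, A z * F j z ∂μ) atTop (𝓝 (∫ z, A z * F₀ z ∂μ)) := by
  refine tendsto_integral_of_dominated_convergence (fun z => C * G z) (fun j => hA.mul (hF j))
    (hG.const_mul C) (fun j => (hFG j).mono fun z hz => ?_) (hlim.mono fun z hz => hz.const_mul _)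
  rw [norm_mul]
  exact mul_le_mul (hAC z) hz (norm_nonneg _) ((norm_nonneg _).trans (hAC z))

end Test

namespace IsThinFilmSolutionWith

variable {a b n ε : ℝ} {uin uin' : ℝ → ℝ} {u ux uxx uxxx : ℝ → ℝ → ℝ} {E M R T : ℝ}

theorem ae_mem_Icc (h : IsThinFilmSolutionWith a b n ε uin uin' u ux uxx uxxx)
    (hM : ∀ t, 0 < t → ∀ x ∈ Ioo a b, u t x ≤ M) :
    ∀ᵐ z ∂(volume : Measure (ℝ × ℝ)).restrict (Ioo 0 T ×ˢ Ioo a b), 0 ≤ u z.1 z.2 ∧ u z.1 z.2 ≤ M := by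
  filter_upwards [ae_mem_spaceTime a b T] with z hz
  exact ⟨h.nonneg z.1 hz.1.1.le z.2 (Ioo_subset_Icc_self hz.2), hM z.1 hz.1.1 z.2 hz.2⟩

theorem integrable_u (h : IsThinFilmSolutionWith a b n ε uin uin' u ux uxx uxxx)
    (hM : ∀ t, 0 < t → ∀ x ∈ Ioo a b, u t x ≤ M) :
    IntegrableOn (fun z : ℝ × ℝ => u z.1 z.2) (Ioo 0 T ×ˢ Ioo a b) := by
  refine Integrable.mono' (integrableOn_const (C := M) (volume_spaceTime_ne_top a b T))
    (aesm h.measurable_u) ((h.ae_mem_Icc hM).mono fun z hz => ?_)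
  rw [Real.norm_of_nonneg hz.1]; exact hz.2

theorem memLp_ux_spaceTime (h : IsThinFilmSolutionWith a b n ε uin uin' u ux uxx uxxx)
    (hT : 0 < T) (hE0 : 0 ≤ E)
    (hE : ∫⁻ x in Ioo a b, ENNReal.ofReal (uin' x ^ 2 / 2) ≤ ENNReal.ofReal E) :
    MemLp (fun z : ℝ × ℝ => ux z.1 z.2) 2 (volume.restrict (Ioo 0 T ×ˢ Ioo a b)) :=
  (memLp_two_iff_integrable_sq (aesm h.measurable_ux)).2 (h.integrable_ux_sq hT hE0 hE).1

theorem isFiniteMeasure_spaceTime (a b T : ℝ) :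
    IsFiniteMeasure ((volume : Measure (ℝ × ℝ)).restrict (Ioo 0 T ×ˢ Ioo a b)) :=
  isFiniteMeasure_restrict.2 (volume_spaceTime_ne_top a b T)

/-- The equation, tested with functions supported in `(0,T) × (a,b)`. -/
theorem weak_time (h : IsThinFilmSolutionWith a b n ε uin uin' u ux uxx uxxx)
    (hε : 0 < ε) (hε1 : ε < 1) (hM : ∀ t, 0 < t → ∀ x ∈ Ioo a b, u t x ≤ M)
    (hJ : MemLp (thinFlux n ε u uxxx) 2 (volume.restrict (Ioo 0 T ×ˢ Ioo a b)))
    {ψ : ℝ × ℝ → ℝ} (hψ : IsTestOn (Ioo 0 T ×ˢ Ioo a b) ψ) :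
    ∫ z in Ioo 0 T ×ˢ Ioo a b, u z.1 z.2 * fderiv ℝ ψ z (1, 0)
      = -∫ z in Ioo 0 T ×ˢ Ioo a b, thinFlux n ε u uxxx z * fderiv ℝ ψ z (0, 1) := by
  have := isFiniteMeasure_spaceTime a b T
  have hd : Differentiable ℝ ψ := hψ.1.differentiable (by simp)
  have hz {z : ℝ × ℝ} (hz : z ∉ Ioo 0 T ×ˢ Ioo a b) : ψ z = 0 :=
    image_eq_zero_of_notMem_tsupport fun h => hz (hψ.2.2 h)
  have hz' {z : ℝ × ℝ} (hz : z ∉ Ioo 0 T ×ˢ Ioo a b) : fderiv ℝ ψ z = 0 :=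
    image_eq_zero_of_notMem_tsupport fun h => hz (hψ.2.2 (tsupport_fderiv_subset ℝ h))
  have hfc : Continuous (fderiv ℝ ψ) := hψ.1.continuous_fderiv (by simp)
  obtain ⟨C, hC⟩ := (hψ.2.1.fderiv ℝ).exists_bound_of_continuous hfc
  have hbd (v : ℝ × ℝ) (z : ℝ × ℝ) : ‖fderiv ℝ ψ z v‖ ≤ C * ‖v‖ :=
    (fderiv ℝ ψ z).le_of_opNorm_le (hC z) v
  have hcv (v : ℝ × ℝ) : Continuous fun z => fderiv ℝ ψ z v := hfc.clm_apply continuous_const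
  have i1 : IntegrableOn (fun z : ℝ × ℝ => u z.1 z.2 * fderiv ℝ ψ z (1, 0)) (Ioo 0 T ×ˢ Ioo a b) :=
    (h.integrable_u hM).mul_bdd (c := C * ‖((1 : ℝ), (0 : ℝ))‖) (hcv _).aestronglyMeasurable
      (Eventually.of_forall (hbd _))
  have i2 : IntegrableOn (fun z : ℝ × ℝ => thinFlux n ε u uxxx z * fderiv ℝ ψ z (0, 1))
      (Ioo 0 T ×ˢ Ioo a b) :=
    (hJ.integrable one_le_two).mul_bdd (c := C * ‖((0 : ℝ), (1 : ℝ))‖) (hcv _).aestronglyMeasurable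
      (Eventually.of_forall (hbd _))
  have key := h.weak_equation (fun t x => ψ (t, x)) hψ.1 hψ.2.1
  -- The test function is supported in times strictly between 0 and T, so the initial datum does not
  -- enter.
  have e0 : ∫ x in Ioo a b, uin x * ψ (0, x) = 0 := by
    have hz0 : ∀ x, uin x * ψ (0, x) = 0 := fun x => by
      rw [hz fun h => lt_irrefl (0 : ℝ) h.1.1, mul_zero]
    simp [hz0]
  have e1 : ∫ t in Ioi (0 : ℝ), ∫ x in Ioo a b, u t x * deriv (fun s => ψ (s, x)) t
      = ∫ z in Ioo 0 T ×ˢ Ioo a b, u z.1 z.2 * fderiv ℝ ψ z (1, 0) := by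
    rw [integral_spaceTime i1]
    simp only [fderiv_apply_one_zero hd]
    refine setIntegral_eq_of_subset_of_forall_sdiff_eq_zero measurableSet_Ioi Ioo_subset_Ioi_self
      fun t ht => ?_
    rw [← integral_zero ℝ ℝ (μ := volume.restrict (Ioo a b))]
    congr 1
    funext x
    rw [hz' fun h => ht.2 h.1]; simp
  have e2 : |Real.log ε| * ∫ t in Ioi (0 : ℝ), ∫ x in posSet a b (u t),
        mobility n ε (u t x) * uxxx t x * deriv (fun y => ψ (t, y)) x
      = ∫ z in Ioo 0 T ×ˢ Ioo a b, thinFlux n ε u uxxx z * fderiv ℝ ψ z (0, 1) := by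
    rw [integral_spaceTime i2, ← integral_const_mul]
    simp only [fderiv_apply_zero_one hd]
    rw [setIntegral_eq_of_subset_of_forall_sdiff_eq_zero measurableSet_Ioi
      (show Ioo 0 T ⊆ Ioi 0 from Ioo_subset_Ioi_self) fun t ht => ?_]
    · refine setIntegral_congr_fun measurableSet_Ioo fun t ht => ?_
      have e3 : ∫ x in posSet a b (u t), thinFlux n ε u uxxx (t, x) * fderiv ℝ ψ (t, x) (0, 1)
          = ∫ x in Ioo a b, thinFlux n ε u uxxx (t, x) * fderiv ℝ ψ (t, x) (0, 1) :=
        setIntegral_posSet fun x _ hx => by rw [thinFlux, onPos_of_not_pos hx]; ring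
      rw [← e3, ← integral_const_mul]
      refine setIntegral_congr_fun (h.isOpen_pos ht.1.le).measurableSet fun x hx => ?_
      simp only [thinFlux]
      rw [onPos_of_pos hx.2]; ring
    · have : ∀ x, mobility n ε (u t x) * uxxx t x * fderiv ℝ ψ (t, x) (0, 1) = 0 := fun x => by
        rw [hz' fun h => ht.2 h.1]; simp
      simp [this]
  have hL : 0 < |Real.log ε| := abs_pos.2 (Real.log_neg hε hε1).ne
  rw [e0, add_zero, e1] at key
  rw [← e2]
  field_simp at key
  linarith

/-- `u_x` is the weak derivative of `u` on `(0,T) × (a,b)`. -/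
theorem weak_space (h : IsThinFilmSolutionWith a b n ε uin uin' u ux uxx uxxx)
    (hM : ∀ t, 0 < t → ∀ x ∈ Ioo a b, u t x ≤ M)
    (hV : MemLp (fun z : ℝ × ℝ => ux z.1 z.2) 2 (volume.restrict (Ioo 0 T ×ˢ Ioo a b)))
    {ψ : ℝ × ℝ → ℝ} (hψ : IsTestOn (Ioo 0 T ×ˢ Ioo a b) ψ) :
    ∫ z in Ioo 0 T ×ˢ Ioo a b, u z.1 z.2 * fderiv ℝ ψ z (0, 1)
      = -∫ z in Ioo 0 T ×ˢ Ioo a b, ux z.1 z.2 * ψ z := by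
  have := isFiniteMeasure_spaceTime a b T
  have hd : Differentiable ℝ ψ := hψ.1.differentiable (by simp)
  have hfc : Continuous (fderiv ℝ ψ) := hψ.1.continuous_fderiv (by simp)
  obtain ⟨C, hC⟩ := (hψ.2.1.fderiv ℝ).exists_bound_of_continuous hfc
  obtain ⟨C', hC'⟩ := hψ.2.1.exists_bound_of_continuous hψ.1.continuous
  have i1 : IntegrableOn (fun z : ℝ × ℝ => u z.1 z.2 * fderiv ℝ ψ z (0, 1)) (Ioo 0 T ×ˢ Ioo a b) :=
    (h.integrable_u hM).mul_bdd (c := C * ‖((0 : ℝ), (1 : ℝ))‖)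
      (hfc.clm_apply continuous_const).aestronglyMeasurable
      (Eventually.of_forall fun z => (fderiv ℝ ψ z).le_of_opNorm_le (hC z) _)
  have i2 : IntegrableOn (fun z : ℝ × ℝ => ux z.1 z.2 * ψ z) (Ioo 0 T ×ˢ Ioo a b) :=
    (hV.integrable one_le_two).mul_bdd (c := C') hψ.1.continuous.aestronglyMeasurable
      (Eventually.of_forall hC')
  rw [integral_spaceTime i1, integral_spaceTime i2, ← integral_neg]
  refine setIntegral_congr_fun measurableSet_Ioo fun t ht => ?_
  have := (h.weakDeriv_ux t ht.1).2.2 _ (hψ.isTestFun_slice t)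
  simp only [smul_eq_mul, fderiv_apply_zero_one hd] at this
  simp only [mul_comm (u _ _), mul_comm (ux _ _)]
  exact this

end IsThinFilmSolutionWith

end

/-! ### The entropy equation: chain rule, spatial integration by parts and removal of the cutoff -/

section

namespace IsThinFilmSolutionWith

variable {a b n ε : ℝ} {uin uin' : ℝ → ℝ} {u ux uxx uxxx : ℝ → ℝ → ℝ} {E M R T : ℝ}

theorem aesm_comp_u (h : IsThinFilmSolutionWith a b n ε uin uin' u ux uxx uxxx) {g : ℝ → ℝ}
    (hg : Continuous g) : AEStronglyMeasurable (fun z : ℝ × ℝ => g (u z.1 z.2))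
      (volume.restrict (Ioo 0 T ×ˢ Ioo a b)) :=
  hg.comp_aestronglyMeasurable (aesm h.measurable_u)

/-- The chain rule produces -∫ J(β'(u) ψ_x + β''(u) u_x ψ). In its second part β'' cancels the
mobility in J and leaves `idcut δ u` times u_x u_xxx, which is integrated by parts slice by slice;
the cutoff keeps everything inside {u > 0}. -/
theorem weak_betaApprox (h : IsThinFilmSolutionWith a b n ε uin uin' u ux uxx uxxx)
    (hab : a < b) (hn0 : 0 < n) (hε : 0 < ε) (hε1 : ε < 1) (hT : 0 < T) (hE0 : 0 ≤ E)
    (hE : ∫⁻ x in Ioo a b, ENNReal.ofReal (uin' x ^ 2 / 2) ≤ ENNReal.ofReal E)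
    (hM : ∀ t, 0 < t → ∀ x ∈ Ioo a b, u t x ≤ M) (hM0 : 0 ≤ M) (hR0 : 0 ≤ R)
    (hR : ∀ t, 0 < t → ∀ x ∈ Ioo a b, rhoEps n ε u t x ≤ R)
    (hsq : IntegrableOn (fun z => onPos u ux z ^ 2 * onPos u uxx z) (Ioo 0 T ×ˢ Ioo a b))
    {θ φ : ℝ → ℝ} (hθ : IsTestFun (Ioo 0 T) θ) (hφ : IsTestFun (Ioo a b) φ) {δ : ℝ} (hδ : 0 < δ) :
    ∫ z in Ioo 0 T ×ˢ Ioo a b, deriv θ z.1 * φ z.2 * betaApprox n ε M δ (u z.1 z.2)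
      = -(∫ z in Ioo 0 T ×ˢ Ioo a b, θ z.1 * deriv φ z.2 *
            (dbeta n ε M δ (u z.1 z.2) * thinFlux n ε u uxxx z))
        - ((∫ z in Ioo 0 T ×ˢ Ioo a b, θ z.1 * deriv φ z.2 *
              (idcut δ (u z.1 z.2) * onPos u ux z * onPos u uxx z))
          + (∫ z in Ioo 0 T ×ˢ Ioo a b, θ z.1 * φ z.2 *
              (deriv (idcut δ) (u z.1 z.2) * (onPos u ux z ^ 2 * onPos u uxx z)))
          + ∫ z in Ioo 0 T ×ˢ Ioo a b, θ z.1 * φ z.2 *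
              (idcut δ (u z.1 z.2) * onPos u uxx z ^ 2)) := by
  have := isFiniteMeasure_spaceTime a b T
  have hψ := isTestOn_mul hθ hφ
  have hJ := h.memLp_thinFlux hn0 hε hT hE0 hE hM
  have hV := h.memLp_ux_spaceTime hT hE0 hE
  have hu := h.ae_mem_Icc (T := T) hM
  obtain ⟨Cθ, hCθ⟩ := hθ.2.1.exists_bound_of_continuous hθ.continuous
  obtain ⟨Cφ, hCφ⟩ := hφ.2.1.exists_bound_of_continuous hφ.continuous
  obtain ⟨Cφ', hCφ'⟩ := hφ.2.1.deriv.exists_bound_of_continuous hφ.continuous_deriv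
  have hCθ0 : 0 ≤ Cθ := (norm_nonneg _).trans (hCθ 0)
  have mA : Continuous fun z : ℝ × ℝ => θ z.1 * φ z.2 :=
    (hθ.continuous.comp continuous_fst).mul (hφ.continuous.comp continuous_snd)
  have mA1 : Continuous fun z : ℝ × ℝ => θ z.1 * deriv φ z.2 :=
    (hθ.continuous.comp continuous_fst).mul (hφ.continuous_deriv.comp continuous_snd)
  have bA (z : ℝ × ℝ) : ‖θ z.1 * φ z.2‖ ≤ Cθ * Cφ := by
    rw [norm_mul]; exact mul_le_mul (hCθ _) (hCφ _) (norm_nonneg _) hCθ0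
  have bA1 (z : ℝ × ℝ) : ‖θ z.1 * deriv φ z.2‖ ≤ Cθ * Cφ' := by
    rw [norm_mul]; exact mul_le_mul (hCθ _) (hCφ' _) (norm_nonneg _) hCθ0
  have hbc {g : ℝ → ℝ} (hg : Continuous g) : ∃ C, ∀ᵐ z ∂(volume : Measure (ℝ × ℝ)).restrict
      (Ioo 0 T ×ˢ Ioo a b), ‖g (u z.1 z.2)‖ ≤ C := by
    obtain ⟨C, hC⟩ := isCompact_Icc.exists_bound_of_continuousOn (s := Icc 0 M) hg.continuousOn
    exact ⟨C, hu.mono fun z hz => hC _ hz⟩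
  -- the chain rule
  have key := chain_rule_of_weak (isOpen_Ioo.prod isOpen_Ioo) (volume_spaceTime_ne_top a b T)
    (aesm h.measurable_u) (hu.mono fun z hz => by rw [abs_of_nonneg hz.1]; exact hz.2) hV hJ
    (fun ψ hψ => h.weak_time hε hε1 hM hJ hψ) (fun ψ hψ => h.weak_space hM hV hψ)
    (contDiff_betaApprox (n := n) (M := M) hε hδ) hψ
  have hd1 (z : ℝ × ℝ) : fderiv ℝ (fun z : ℝ × ℝ => θ z.1 * φ z.2) z (1, 0) = deriv θ z.1 * φ z.2 := by
    rw [← fderiv_apply_one_zero (hψ.1.differentiable (by simp)) z.1 z.2]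
    exact ((hθ.differentiable z.1).hasDerivAt.mul_const (φ z.2)).deriv
  have hd2 (z : ℝ × ℝ) : fderiv ℝ (fun z : ℝ × ℝ => θ z.1 * φ z.2) z (0, 1) = θ z.1 * deriv φ z.2 := by
    rw [← fderiv_apply_zero_one (hψ.1.differentiable (by simp)) z.1 z.2]
    exact ((hφ.differentiable z.2).hasDerivAt.const_mul (θ z.1)).deriv
  simp only [hd1, hd2, deriv_betaApprox hε hδ, deriv_dbeta hε hδ] at key
  have e1 : ∀ z : ℝ × ℝ, deriv θ z.1 * φ z.2 * betaApprox n ε M δ (u z.1 z.2)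
      = betaApprox n ε M δ (u z.1 z.2) * (deriv θ z.1 * φ z.2) := fun z => mul_comm _ _
  simp only [e1]
  rw [key]
  have hJi : IntegrableOn (thinFlux n ε u uxxx) (Ioo 0 T ×ˢ Ioo a b) := hJ.integrable one_le_two
  have hJV : IntegrableOn (fun z : ℝ × ℝ => ux z.1 z.2 * thinFlux n ε u uxxx z)
    (Ioo 0 T ×ˢ Ioo a b) := hV.integrable_mul hJ
  obtain ⟨C1, hC1⟩ := hbc (continuous_dbeta (n := n) (M := M) hε hδ)
  obtain ⟨C2, hC2⟩ := hbc (continuous_kcut n hε hδ)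
  obtain ⟨C3, hC3⟩ := hbc ((contDiff_idcut δ).continuous_deriv (by simp))
  have i1 : IntegrableOn (fun z : ℝ × ℝ => θ z.1 * deriv φ z.2 *
      (dbeta n ε M δ (u z.1 z.2) * thinFlux n ε u uxxx z)) (Ioo 0 T ×ˢ Ioo a b) :=
    (hJi.bdd_mul (h.aesm_comp_u (continuous_dbeta hε hδ)) hC1).bdd_mul
      mA1.aestronglyMeasurable (Eventually.of_forall bA1)
  have i2 : IntegrableOn (fun z : ℝ × ℝ => θ z.1 * φ z.2 *
      (kcut n ε δ (u z.1 z.2) * (ux z.1 z.2 * thinFlux n ε u uxxx z))) (Ioo 0 T ×ˢ Ioo a b) :=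
    (hJV.bdd_mul (h.aesm_comp_u (continuous_kcut n hε hδ)) hC2).bdd_mul
      mA.aestronglyMeasurable (Eventually.of_forall bA)
  have hid : Continuous (idcut δ) := (contDiff_idcut δ).continuous
  have i3 : IntegrableOn (fun z : ℝ × ℝ => θ z.1 * deriv φ z.2 *
      (idcut δ (u z.1 z.2) * onPos u ux z * onPos u uxx z)) (Ioo 0 T ×ˢ Ioo a b) := by
    obtain ⟨i, -⟩ := h.integrable_mixed hab hT hE0 hE hM hM0 hR0 hR
    have : IntegrableOn (fun z : ℝ × ℝ => idcut δ (u z.1 z.2) * onPos u ux z * onPos u uxx z)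
        (Ioo 0 T ×ˢ Ioo a b) := by
      refine Integrable.mono i (((h.aesm_comp_u hid).mul h.aesm_onPos_ux).mul h.aesm_onPos_uxx)
        (hu.mono fun z hz => ?_)
      simp only [norm_mul]
      gcongr
      rw [Real.norm_of_nonneg (idcut_nonneg hz.1), Real.norm_of_nonneg hz.1]
      exact idcut_le_self hz.1
    exact this.bdd_mul mA1.aestronglyMeasurable (Eventually.of_forall bA1)
  have i4 : IntegrableOn (fun z : ℝ × ℝ => θ z.1 * φ z.2 *
      (deriv (idcut δ) (u z.1 z.2) * (onPos u ux z ^ 2 * onPos u uxx z))) (Ioo 0 T ×ˢ Ioo a b) :=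
    (hsq.bdd_mul (h.aesm_comp_u ((contDiff_idcut δ).continuous_deriv (by simp))) hC3).bdd_mul
      mA.aestronglyMeasurable (Eventually.of_forall bA)
  have i5 : IntegrableOn (fun z : ℝ × ℝ => θ z.1 * φ z.2 *
      (idcut δ (u z.1 z.2) * onPos u uxx z ^ 2)) (Ioo 0 T ×ˢ Ioo a b) := by
    obtain ⟨i, -⟩ := h.integrable_rhoSource hab hT hR0 hR
    have : IntegrableOn (fun z : ℝ × ℝ => idcut δ (u z.1 z.2) * onPos u uxx z ^ 2)
        (Ioo 0 T ×ˢ Ioo a b) := by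
      refine Integrable.mono i ((h.aesm_comp_u hid).mul (h.aesm_onPos_uxx.pow 2)) (hu.mono fun z hz => ?_)
      simp only [norm_mul, rhoSource]
      gcongr
      rw [Real.norm_of_nonneg (idcut_nonneg hz.1), Real.norm_of_nonneg hz.1]
      exact idcut_le_self hz.1
    exact this.bdd_mul mA.aestronglyMeasurable (Eventually.of_forall bA)
  have i34 : IntegrableOn (fun z : ℝ × ℝ => θ z.1 * deriv φ z.2 *
      (idcut δ (u z.1 z.2) * onPos u ux z * onPos u uxx z) + θ z.1 * φ z.2 *
      (deriv (idcut δ) (u z.1 z.2) * (onPos u ux z ^ 2 * onPos u uxx z))) (Ioo 0 T ×ˢ Ioo a b) :=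
    i3.add i4
  have i345 : IntegrableOn (fun z : ℝ × ℝ => θ z.1 * deriv φ z.2 *
      (idcut δ (u z.1 z.2) * onPos u ux z * onPos u uxx z) + θ z.1 * φ z.2 *
      (deriv (idcut δ) (u z.1 z.2) * (onPos u ux z ^ 2 * onPos u uxx z)) + θ z.1 * φ z.2 *
      (idcut δ (u z.1 z.2) * onPos u uxx z ^ 2)) (Ioo 0 T ×ˢ Ioo a b) := i34.add i5
  -- integration by parts in space
  have hL : 0 < |Real.log ε| := abs_pos.2 (Real.log_neg hε hε1).ne
  have e2 : ∫ z in Ioo 0 T ×ˢ Ioo a b, θ z.1 * φ z.2 *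
      (kcut n ε δ (u z.1 z.2) * (ux z.1 z.2 * thinFlux n ε u uxxx z))
      = -∫ z in Ioo 0 T ×ˢ Ioo a b, (θ z.1 * deriv φ z.2 *
      (idcut δ (u z.1 z.2) * onPos u ux z * onPos u uxx z) + θ z.1 * φ z.2 *
      (deriv (idcut δ) (u z.1 z.2) * (onPos u ux z ^ 2 * onPos u uxx z)) + θ z.1 * φ z.2 *
      (idcut δ (u z.1 z.2) * onPos u uxx z ^ 2)) := by
    rw [integral_spaceTime i2, integral_spaceTime i345, ← integral_neg]
    refine setIntegral_congr_ae measurableSet_Ioo ?_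
    rw [← ae_restrict_iff' measurableSet_Ioo]
    filter_upwards [ae_Ioo h.weakDeriv_uxx, ae_Ioo h.weakDeriv_uxxx,
      ae_restrict_mem measurableSet_Ioo] with t h2 h3 ht
    have hibp := slice_integral_by_parts (h.continuousOn t ht.1.le) (h.weakDeriv_ux t ht.1) h2 h3
      ((contDiff_idcut δ).of_le (by simp)) hδ (fun s hs => idcut_eq_zero hδ hs) hφ
    have hPm := (h.isOpen_pos ht.1.le).measurableSet
    rw [← setIntegral_posSet (w := u t) (fun x _ hx => by
        rw [thinFlux, onPos_of_not_pos hx]; ring),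
      ← setIntegral_posSet (w := u t) (fun x _ hx => by
        rw [onPos_of_not_pos hx, onPos_of_not_pos hx]; ring)]
    have e3 : ∫ x in posSet a b (u t), θ t * φ x * (kcut n ε δ (u t x) * (ux t x * thinFlux n ε u uxxx (t, x)))
        = θ t * ∫ x in posSet a b (u t), φ x * idcut δ (u t x) * ux t x * uxxx t x := by
      rw [← integral_const_mul]
      refine setIntegral_congr_fun hPm fun x hx => ?_
      -- The factor |ln ε| in the flux also cancels the |ln ε|⁻¹ in `kcut`, so no trace of ε remains
      -- besides `u` itself.
      have h5 := kcut_mul_mobility (n := n) (δ := δ) hε hx.2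
      have h6 : kcut n ε δ (u t x) * mobility n ε (u t x) * |Real.log ε| = idcut δ (u t x) := by
        rw [h5]; field_simp
      simp only [thinFlux]
      rw [onPos_of_pos hx.2, ← h6]
      ring
    rw [e3, hibp, mul_neg, ← integral_const_mul]
    congr 1
    refine setIntegral_congr_fun hPm fun x hx => ?_
    rw [onPos_of_pos hx.2, onPos_of_pos hx.2]
    ring
  have e4 : ∫ z in Ioo 0 T ×ˢ Ioo a b, thinFlux n ε u uxxx z *
        (dbeta n ε M δ (u z.1 z.2) * (θ z.1 * deriv φ z.2)
          + -kcut n ε δ (u z.1 z.2) * ux z.1 z.2 * (θ z.1 * φ z.2))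
      = (∫ z in Ioo 0 T ×ˢ Ioo a b, θ z.1 * deriv φ z.2 *
            (dbeta n ε M δ (u z.1 z.2) * thinFlux n ε u uxxx z))
        - ∫ z in Ioo 0 T ×ˢ Ioo a b, θ z.1 * φ z.2 *
      (kcut n ε δ (u z.1 z.2) * (ux z.1 z.2 * thinFlux n ε u uxxx z)) := by
    rw [← integral_sub i1 i2]
    congr 1
    funext z
    ring
  rw [e4, e2, integral_add i34 i5, integral_add i3 i4]
  ring

/-- The weak form of `∂ₜ ρ^ε = rhoSource + ∂ₓ rhoFlux`. -/
theorem weak_rhoEps (h : IsThinFilmSolutionWith a b n ε uin uin' u ux uxx uxxx)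
    (hab : a < b) (hn0 : 0 < n) (hn3 : n < 3) (hε : 0 < ε) (hε1 : ε < 1) (hT : 0 < T) (hE0 : 0 ≤ E)
    (hE : ∫⁻ x in Ioo a b, ENNReal.ofReal (uin' x ^ 2 / 2) ≤ ENNReal.ofReal E)
    (hM : ∀ t, 0 < t → ∀ x ∈ Ioo a b, u t x ≤ M) (hM0 : 0 ≤ M) (hR0 : 0 ≤ R)
    (hR : ∀ t, 0 < t → ∀ x ∈ Ioo a b, rhoEps n ε u t x ≤ R)
    {θ φ : ℝ → ℝ} (hθ : IsTestFun (Ioo 0 T) θ) (hφ : IsTestFun (Ioo a b) φ) :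
    ∫ z in Ioo 0 T ×ˢ Ioo a b, deriv θ z.1 * φ z.2 * rhoEps n ε u z.1 z.2
      = -((∫ z in Ioo 0 T ×ˢ Ioo a b, θ z.1 * φ z.2 * rhoSource u uxx z)
        - ∫ z in Ioo 0 T ×ˢ Ioo a b, θ z.1 * deriv φ z.2 * rhoFlux n ε u ux uxx uxxx z) := by
  have := isFiniteMeasure_spaceTime a b T
  have hu := h.ae_mem_Icc (T := T) hM
  obtain ⟨hsq, hcube⟩ : IntegrableOn (fun z => onPos u ux z ^ 2 * onPos u uxx z) (Ioo 0 T ×ˢ Ioo a b) ∧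
      ∀ᵐ t ∂volume.restrict (Ioo 0 T), ∀ φ, IsTestFun (Ioo a b) φ →
        ∫ x in posSet a b (u t), φ x * (ux t x ^ 2 * uxx t x)
          = -∫ x in posSet a b (u t), deriv φ x * (ux t x ^ 3 / 3) := by
    rcases lt_or_ge n 2 with hn2 | hn2
    · exact h.square_mul_of_lt_two hab hT hE0 hE hn2
    · exact h.square_mul_of_two_le hab hT hE0 hE hM hM0 hR0 hR hn2
  obtain ⟨Cθ, hCθ⟩ := hθ.2.1.exists_bound_of_continuous hθ.continuous
  obtain ⟨Cθ', hCθ'⟩ := hθ.2.1.deriv.exists_bound_of_continuous hθ.continuous_deriv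
  obtain ⟨Cφ, hCφ⟩ := hφ.2.1.exists_bound_of_continuous hφ.continuous
  obtain ⟨Cφ', hCφ'⟩ := hφ.2.1.deriv.exists_bound_of_continuous hφ.continuous_deriv
  have hCθ0 : 0 ≤ Cθ := (norm_nonneg _).trans (hCθ 0)
  have hCθ0' : 0 ≤ Cθ' := (norm_nonneg _).trans (hCθ' 0)
  have mA : Continuous fun z : ℝ × ℝ => θ z.1 * φ z.2 :=
    (hθ.continuous.comp continuous_fst).mul (hφ.continuous.comp continuous_snd)
  have mA1 : Continuous fun z : ℝ × ℝ => θ z.1 * deriv φ z.2 :=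
    (hθ.continuous.comp continuous_fst).mul (hφ.continuous_deriv.comp continuous_snd)
  have mA0 : Continuous fun z : ℝ × ℝ => deriv θ z.1 * φ z.2 :=
    (hθ.continuous_deriv.comp continuous_fst).mul (hφ.continuous.comp continuous_snd)
  have bA (z : ℝ × ℝ) : ‖θ z.1 * φ z.2‖ ≤ Cθ * Cφ := by
    rw [norm_mul]; exact mul_le_mul (hCθ _) (hCφ _) (norm_nonneg _) hCθ0
  have bA1 (z : ℝ × ℝ) : ‖θ z.1 * deriv φ z.2‖ ≤ Cθ * Cφ' := by
    rw [norm_mul]; exact mul_le_mul (hCθ _) (hCφ' _) (norm_nonneg _) hCθ0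
  have bA0 (z : ℝ × ℝ) : ‖deriv θ z.1 * φ z.2‖ ≤ Cθ' * Cφ := by
    rw [norm_mul]; exact mul_le_mul (hCθ' _) (hCφ _) (norm_nonneg _) hCθ0'
  set d : ℕ → ℝ := fun j => 1 / ((j : ℝ) + 1) with hd
  have hd0 (j : ℕ) : 0 < d j := by positivity
  have hdl : Tendsto d atTop (𝓝 0) := tendsto_one_div_add_atTop_nhds_zero_nat
  have hev {s : ℝ} (hs : 0 < s) : ∀ᶠ j in atTop, 2 * d j < s := by
    filter_upwards [hdl.eventually_lt_const (half_pos hs)] with j hj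
    linarith
  have hidl {s : ℝ} (hs : 0 ≤ s) : Tendsto (fun j => idcut (d j) s) atTop (𝓝 s) := by
    rcases hs.eq_or_lt with h0 | h0
    · subst h0; simp [idcut]
    · refine tendsto_const_nhds.congr' ?_
      filter_upwards [hev h0] with j hj
      exact (idcut_eq_self (hd0 j) hj.le).symm
  obtain ⟨iS, -⟩ := h.integrable_rhoSource (T := T) hab hT hR0 hR
  obtain ⟨iD, -⟩ := h.integrable_drive hab hn0 hn3 hε hε1 hT hE0 hE hM
  obtain ⟨iX, -⟩ := h.integrable_mixed hab hT hE0 hE hM hM0 hR0 hR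
  obtain ⟨iC, -⟩ := h.integrable_cube hab hT hE0 hE hM hM0 hR0 hR
  obtain ⟨K, hK⟩ := exists_abs_deriv_idcut_le
  have hid (δ : ℝ) : Continuous (idcut δ) := (contDiff_idcut δ).continuous
  have l0 := tendsto_integral_weight mA0.aestronglyMeasurable bA0
    (μ := volume.restrict (Ioo 0 T ×ˢ Ioo a b))
    (F := fun j z => betaApprox n ε M (d j) (u z.1 z.2)) (F₀ := fun z => rhoEps n ε u z.1 z.2)
    (G := fun _ => R) (integrable_const R)
    (fun j => h.aesm_comp_u (contDiff_betaApprox hε (hd0 j)).continuous)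
    (fun j => by
      filter_upwards [hu, ae_mem_spaceTime a b T] with z hz hzS
      rw [Real.norm_of_nonneg (betaApprox_nonneg hε hz.1 hz.2)]
      exact (betaApprox_le hn0 hn3 hε (hd0 j) hz.1 hz.2).trans (hR z.1 hzS.1.1 z.2 hzS.2))
    (hu.mono fun z hz => tendsto_betaApprox hn0 hn3 hε hd0 hdl hz.1 hz.2)
  have hflux0 {z : ℝ × ℝ} (hz : ¬0 < u z.1 z.2) : thinFlux n ε u uxxx z = 0 := by
    have : onPos u uxxx z = 0 := onPos_of_not_pos (t := z.1) (x := z.2) hz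
    rw [thinFlux, this, mul_zero]
  -- Since 0 ≤ `dbeta` ≤ `beps` for u > 0, the limit b(u) J dominates the approximations. Where u =
  -- 0 the flux vanishes, and the possibly singular value of `beps` plays no role.
  have l1 := tendsto_integral_weight mA1.aestronglyMeasurable bA1
    (F := fun j z => dbeta n ε M (d j) (u z.1 z.2) * thinFlux n ε u uxxx z)
    (F₀ := fun z => (Ioi (0 : ℝ)).indicator (beps n ε) (u z.1 z.2) * thinFlux n ε u uxxx z)
    iD.norm (fun j => (h.aesm_comp_u (continuous_dbeta hε (hd0 j))).mul (h.aesm_thinFlux hn0))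
    (fun j => by
      filter_upwards [hu] with z hz
      rcases hz.1.eq_or_lt with h0 | h0
      · rw [hflux0 (by rw [← h0]; exact lt_irrefl _), mul_zero, mul_zero]
      · rw [indicator_of_mem (show u z.1 z.2 ∈ Ioi 0 from h0), norm_mul, norm_mul,
          Real.norm_of_nonneg (dbeta_nonneg hε hz.1 hz.2), Real.norm_of_nonneg (beps_nonneg n hε hz.1)]
        gcongr
        exact dbeta_le hε (hd0 j) h0 hz.2)
    (by
      filter_upwards [hu] with z hz
      rcases hz.1.eq_or_lt with h0 | h0
      · have := hflux0 (z := z) (by rw [← h0]; exact lt_irrefl _)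
        simp [this]
      · rw [indicator_of_mem (show u z.1 z.2 ∈ Ioi 0 from h0)]
        exact (tendsto_dbeta hε hd0 hdl h0 hz.2).mul_const _)
  have l2 := tendsto_integral_weight mA1.aestronglyMeasurable bA1
    (F := fun j z => idcut (d j) (u z.1 z.2) * onPos u ux z * onPos u uxx z)
    (F₀ := fun z => u z.1 z.2 * onPos u ux z * onPos u uxx z)
    iX.norm (fun j => ((h.aesm_comp_u (hid _)).mul h.aesm_onPos_ux).mul h.aesm_onPos_uxx)
    (fun j => hu.mono fun z hz => by
      simp only [norm_mul]
      gcongr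
      rw [Real.norm_of_nonneg (idcut_nonneg hz.1), Real.norm_of_nonneg hz.1]
      exact idcut_le_self hz.1)
    (hu.mono fun z hz => ((hidl hz.1).mul_const _).mul_const _)
  -- The only term not dominated by the a priori bounds: this limit uses the integrability of u_x²
  -- u_xx obtained from the regularity assumption. Where u = 0 both sides vanish thanks to `onPos`.
  have l3 := tendsto_integral_weight mA.aestronglyMeasurable bA
    (F := fun j z => deriv (idcut (d j)) (u z.1 z.2) * (onPos u ux z ^ 2 * onPos u uxx z))
    (F₀ := fun z => onPos u ux z ^ 2 * onPos u uxx z)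
    (hsq.norm.const_mul K) (fun j => (h.aesm_comp_u ((contDiff_idcut _).continuous_deriv (by simp))).mul
      ((h.aesm_onPos_ux.pow 2).mul h.aesm_onPos_uxx))
    (fun j => hu.mono fun z hz => by
      rw [norm_mul]
      exact mul_le_mul_of_nonneg_right (hK _ (hd0 j) _ hz.1) (norm_nonneg _))
    (hu.mono fun z hz => by
      rcases hz.1.eq_or_lt with h0 | h0
      · have : onPos u ux z = 0 := onPos_of_not_pos (t := z.1) (x := z.2) (by
          rw [← h0]; exact lt_irrefl _)
        simp [this]
      · refine tendsto_const_nhds.congr' ?_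
        filter_upwards [hev h0] with j hj
        rw [deriv_idcut_eq_one (hd0 j) hj, one_mul])
  have l4 := tendsto_integral_weight mA.aestronglyMeasurable bA
    (F := fun j z => idcut (d j) (u z.1 z.2) * onPos u uxx z ^ 2)
    (F₀ := rhoSource u uxx)
    iS.norm (fun j => (h.aesm_comp_u (hid _)).mul (h.aesm_onPos_uxx.pow 2))
    (fun j => hu.mono fun z hz => by
      simp only [norm_mul, rhoSource]
      gcongr
      rw [Real.norm_of_nonneg (idcut_nonneg hz.1), Real.norm_of_nonneg hz.1]
      exact idcut_le_self hz.1)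
    (hu.mono fun z hz => (hidl hz.1).mul_const _)
  have hlim := tendsto_nhds_unique l0 ((l1.neg.sub ((l2.add l3).add l4)).congr fun j =>
    (h.weak_betaApprox hab hn0 hε hε1 hT hE0 hE hM hM0 hR0 hR hsq hθ hφ (hd0 j)).symm)
  have j3 : IntegrableOn (fun z : ℝ × ℝ => θ z.1 * φ z.2 * (onPos u ux z ^ 2 * onPos u uxx z))
    (Ioo 0 T ×ˢ Ioo a b) := hsq.bdd_mul mA.aestronglyMeasurable (Eventually.of_forall bA)
  have jC : IntegrableOn (fun z : ℝ × ℝ => θ z.1 * deriv φ z.2 * (onPos u ux z ^ 3 / 3))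
    (Ioo 0 T ×ˢ Ioo a b) :=
    (iC.div_const 3).bdd_mul mA1.aestronglyMeasurable (Eventually.of_forall bA1)
  have jX : IntegrableOn (fun z : ℝ × ℝ => θ z.1 * deriv φ z.2 *
      (u z.1 z.2 * onPos u ux z * onPos u uxx z)) (Ioo 0 T ×ˢ Ioo a b) :=
    iX.bdd_mul mA1.aestronglyMeasurable (Eventually.of_forall bA1)
  have jD : IntegrableOn (fun z : ℝ × ℝ => θ z.1 * deriv φ z.2 *
      ((Ioi (0 : ℝ)).indicator (beps n ε) (u z.1 z.2) * thinFlux n ε u uxxx z)) (Ioo 0 T ×ˢ Ioo a b) :=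
    iD.bdd_mul mA1.aestronglyMeasurable (Eventually.of_forall bA1)
  -- u_x² u_xx = (u_x³/3)_x on almost every slice, which turns this source term into a flux.
  have e3 : ∫ z in Ioo 0 T ×ˢ Ioo a b, θ z.1 * φ z.2 * (onPos u ux z ^ 2 * onPos u uxx z)
      = -∫ z in Ioo 0 T ×ˢ Ioo a b, θ z.1 * deriv φ z.2 * (onPos u ux z ^ 3 / 3) := by
    rw [integral_spaceTime j3, integral_spaceTime jC, ← integral_neg]
    refine setIntegral_congr_ae measurableSet_Ioo ?_
    rw [← ae_restrict_iff' measurableSet_Ioo]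
    filter_upwards [hcube, ae_restrict_mem measurableSet_Ioo] with t h2 ht
    have hPm := (h.isOpen_pos ht.1.le).measurableSet
    rw [← setIntegral_posSet (w := u t) (fun x _ hx => by
        rw [onPos_of_not_pos hx]; ring),
      ← setIntegral_posSet (w := u t) (fun x _ hx => by
        rw [onPos_of_not_pos hx]; ring)]
    have e5 : ∫ x in posSet a b (u t), θ t * φ x * (onPos u ux (t, x) ^ 2 * onPos u uxx (t, x))
        = θ t * ∫ x in posSet a b (u t), φ x * (ux t x ^ 2 * uxx t x) := by
      rw [← integral_const_mul]
      refine setIntegral_congr_fun hPm fun x hx => ?_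
      rw [onPos_of_pos hx.2, onPos_of_pos hx.2, mul_assoc]
    rw [e5, h2 φ hφ, mul_neg, ← integral_const_mul]
    congr 1
    refine setIntegral_congr_fun hPm fun x hx => ?_
    rw [onPos_of_pos hx.2, mul_assoc]
  have jDX : IntegrableOn (fun z : ℝ × ℝ => θ z.1 * deriv φ z.2 *
      ((Ioi (0 : ℝ)).indicator (beps n ε) (u z.1 z.2) * thinFlux n ε u uxxx z)
      + θ z.1 * deriv φ z.2 * (u z.1 z.2 * onPos u ux z * onPos u uxx z)) (Ioo 0 T ×ˢ Ioo a b) :=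
    jD.add jX
  have e4 : ∫ z in Ioo 0 T ×ˢ Ioo a b, θ z.1 * deriv φ z.2 * rhoFlux n ε u ux uxx uxxx z
      = -((∫ z in Ioo 0 T ×ˢ Ioo a b, θ z.1 * deriv φ z.2 *
            ((Ioi (0 : ℝ)).indicator (beps n ε) (u z.1 z.2) * thinFlux n ε u uxxx z))
          + (∫ z in Ioo 0 T ×ˢ Ioo a b, θ z.1 * deriv φ z.2 *
            (u z.1 z.2 * onPos u ux z * onPos u uxx z))
          - ∫ z in Ioo 0 T ×ˢ Ioo a b, θ z.1 * deriv φ z.2 * (onPos u ux z ^ 3 / 3)) := by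
    rw [← integral_add jD jX, ← integral_sub jDX jC, ← integral_neg]
    congr 1
    funext z
    rw [rhoFlux]
    ring
  rw [hlim, e4, e3]
  ring

end IsThinFilmSolutionWith

end

/-! ### From scalar weak formulations to functions with values in W^{-1,1} -/

section

/-- By second countability every open set is a countable union of balls, and the preimage of a ball
is a sublevel set of a distance function. -/
theorem measurable_of_measurable_dist {α X : Type*} [MeasurableSpace α] [MetricSpace X]
    [SecondCountableTopology X] [MeasurableSpace X] [BorelSpace X] {f : α → X}
    (hf : ∀ y, Measurable fun t => dist (f t) y) : Measurable f := by
  refine measurable_of_isOpen fun U hU => ?_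
  choose! r hr hrU using fun x hx => Metric.isOpen_iff.1 hU x hx
  obtain ⟨s, hsc, hs⟩ := TopologicalSpace.isOpen_iUnion_countable
    (fun x : U => Metric.ball (x : X) (r x)) fun _ => Metric.isOpen_ball
  have hUeq : U = ⋃ x ∈ s, Metric.ball (x : X) (r x) := by
    rw [hs]
    ext x
    refine ⟨fun hx => mem_iUnion.2 ⟨⟨x, hx⟩, Metric.mem_ball_self (hr x hx)⟩, fun hx => ?_⟩
    obtain ⟨y, hy⟩ := mem_iUnion.1 hx
    exact hrU y y.2 hy
  rw [hUeq, preimage_iUnion₂]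
  refine MeasurableSet.biUnion hsc fun x _ => ?_
  exact measurableSet_lt (hf x) measurable_const

open Classical in
/-- The class in `L¹(a,b)` of a function (`0` for functions that are not integrable). -/
def toL1Ioo (a b : ℝ) (f : ℝ → ℝ) : L1Ioo a b :=
  if h : MemLp f 1 (volume.restrict (Ioo a b)) then h.toLp f else 0

section ToL1

variable {a b T : ℝ}

theorem coeFn_toL1Ioo {f : ℝ → ℝ} (hf : IntegrableOn f (Ioo a b)) :
    toL1Ioo a b f =ᵐ[volume.restrict (Ioo a b)] f := by
  rw [toL1Ioo, dif_pos (memLp_one_iff_integrable.2 hf)]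
  exact MemLp.coeFn_toLp _

theorem toL1Ioo_congr {f g : ℝ → ℝ} (h : f =ᵐ[volume.restrict (Ioo a b)] g) :
    toL1Ioo a b f = toL1Ioo a b g := by
  by_cases hf : MemLp f 1 (volume.restrict (Ioo a b))
  · rw [toL1Ioo, toL1Ioo, dif_pos hf, dif_pos ((memLp_congr_ae h).1 hf), MemLp.toLp_eq_toLp_iff]
    exact h
  · rw [toL1Ioo, toL1Ioo, dif_neg hf, dif_neg fun h' => hf ((memLp_congr_ae h).2 h')]

theorem norm_toL1Ioo {f : ℝ → ℝ} (hf : IntegrableOn f (Ioo a b)) :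
    ‖toL1Ioo a b f‖ = ∫ x in Ioo a b, |f x| := by
  rw [L1.norm_eq_integral_norm]
  exact integral_congr_ae ((coeFn_toL1Ioo hf).mono fun x hx => by simp only [hx, Real.norm_eq_abs])

theorem dist_toL1Ioo {f : ℝ → ℝ} (hf : IntegrableOn f (Ioo a b)) (y : L1Ioo a b) :
    dist (toL1Ioo a b f) y = ∫ x in Ioo a b, |f x - y x| := by
  rw [dist_eq_norm, L1.norm_eq_integral_norm]
  refine integral_congr_ae ?_
  filter_upwards [coeFn_toL1Ioo hf, Lp.coeFn_sub (toL1Ioo a b f) y] with x h1 h2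
  rw [h2, Pi.sub_apply, h1, Real.norm_eq_abs]

/-- L¹ is separable, so it suffices that the distances to fixed elements are measurable in time. For
a jointly measurable representative these are parameter integrals. -/
theorem aestronglyMeasurable_toL1Ioo {F : ℝ × ℝ → ℝ}
    (hF : AEStronglyMeasurable F (volume.restrict (Ioo 0 T ×ˢ Ioo a b))) :
    AEStronglyMeasurable (fun t => toL1Ioo a b fun x => F (t, x)) (volume.restrict (Ioo 0 T)) := by
  have : Fact ((1 : ℝ≥0∞) ≠ ⊤) := ⟨ENNReal.one_ne_top⟩
  borelize (L1Ioo a b)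
  have hG := hF.stronglyMeasurable_mk
  set G := hF.mk F with hGdef
  have hFG : ∀ᵐ t ∂volume.restrict (Ioo 0 T),
      toL1Ioo a b (fun x => F (t, x)) = toL1Ioo a b fun x => G (t, x) :=
    (ae_slice hF.ae_eq_mk).mono fun t ht => toL1Ioo_congr ht
  refine ⟨fun t => toL1Ioo a b fun x => G (t, x), Measurable.stronglyMeasurable ?_, hFG⟩
  refine measurable_of_measurable_dist fun y => ?_
  classical
  -- Slices that are not integrable are sent to 0 by convention, so the distance is defined
  -- piecewise and the set of integrable slices has to be measurable.
  have hS : MeasurableSet {t | IntegrableOn (fun x => G (t, x)) (Ioo a b)} :=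
    measurableSet_integrable (μ := volume.restrict (Ioo a b)) (f := fun t x => G (t, x)) hG
  have hy : StronglyMeasurable (y : ℝ → ℝ) := Lp.stronglyMeasurable y
  have hint : StronglyMeasurable fun t => ∫ x in Ioo a b, |G (t, x) - y x| :=
    StronglyMeasurable.integral_prod_right (f := fun t x => |G (t, x) - y x|)
      (ν := volume.restrict (Ioo a b))
      (hG.sub (hy.comp_measurable measurable_snd)).norm
  have : (fun t => dist (toL1Ioo a b fun x => G (t, x)) y)
      = {t | IntegrableOn (fun x => G (t, x)) (Ioo a b)}.piecewise
        (fun t => ∫ x in Ioo a b, |G (t, x) - y x|) fun _ => dist 0 y := by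
    funext t
    by_cases ht : t ∈ {t | IntegrableOn (fun x => G (t, x)) (Ioo a b)}
    · rw [piecewise_eq_of_mem _ _ _ ht, dist_toL1Ioo ht]
    · rw [piecewise_eq_of_notMem _ _ _ ht, toL1Ioo, dif_neg]
      exact fun h => ht (memLp_one_iff_integrable.1 h)
  rw [this]
  exact hint.measurable.piecewise hS measurable_const

theorem integrable_toL1Ioo {F : ℝ × ℝ → ℝ} (hF : IntegrableOn F (Ioo 0 T ×ˢ Ioo a b)) :
    IntegrableOn (fun t => toL1Ioo a b fun x => F (t, x)) (Ioo 0 T) ∧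
      ∫ t in Ioo 0 T, ‖toL1Ioo a b fun x => F (t, x)‖ = ∫ z in Ioo 0 T ×ˢ Ioo a b, |F z| := by
  have hn : (fun t => ‖toL1Ioo a b fun x => F (t, x)‖) =ᵐ[volume.restrict (Ioo 0 T)]
      fun t => ∫ x in Ioo a b, |F (t, x)| :=
    (ae_slice_integrable hF).mono fun t ht => norm_toL1Ioo ht
  have hF' : IntegrableOn (fun z => |F z|) (Ioo 0 T ×ˢ Ioo a b) := hF.norm
  refine ⟨?_, ?_⟩
  · refine (integrable_norm_iff (aestronglyMeasurable_toL1Ioo hF.1)).1 ?_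
    refine Integrable.congr ?_ hn.symm
    have h2 := hF'
    rw [IntegrableOn, volume_restrict_prod] at h2
    exact h2.integral_prod_left
  · rw [integral_congr_ae hn, integral_spaceTime hF']

/-- The functional `f ↦ ∫ f h` on `L¹(a,b)`. -/
def L1Ioo.integralMul (a b : ℝ) {h : ℝ → ℝ} (hc : Continuous h) (hs : HasCompactSupport h) :
    L1Ioo a b →L[ℝ] ℝ where
  toFun f := ∫ x in Ioo a b, f x * h x
  map_add' f g := by
    rw [← integral_add (f.integrable_mul hc hs) (g.integrable_mul hc hs)]
    refine integral_congr_ae ?_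
    filter_upwards [Lp.coeFn_add f g] with x hx
    rw [hx, Pi.add_apply, add_mul]
  map_smul' c f := by
    rw [RingHom.id_apply, smul_eq_mul, ← integral_const_mul]
    refine integral_congr_ae ?_
    filter_upwards [Lp.coeFn_smul c f] with x hx
    rw [hx, Pi.smul_apply, smul_eq_mul, mul_assoc]
  cont := L1Ioo.continuous_integral_mul hc hs

theorem L1Ioo.integralMul_apply {h : ℝ → ℝ} (hc : Continuous h)
    (hs : HasCompactSupport h) (f : L1Ioo a b) :
    L1Ioo.integralMul a b hc hs f = ∫ x in Ioo a b, f x * h x := rfl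

theorem L1Ioo.integralMul_toL1Ioo {h : ℝ → ℝ} (hc : Continuous h)
    (hs : HasCompactSupport h) {f : ℝ → ℝ} (hf : IntegrableOn f (Ioo a b)) :
    L1Ioo.integralMul a b hc hs (toL1Ioo a b f) = ∫ x in Ioo a b, f x * h x := by
  rw [L1Ioo.integralMul_apply]
  exact integral_congr_ae ((coeFn_toL1Ioo hf).mono fun x hx => by simp only [hx])

/-- `f ↦ f`, as a map from `L¹` to `W^{-1,1}`. -/
def wm11Incl (a b : ℝ) : L1Ioo a b →L[ℝ] Wm11 a b :=
  LinearMap.mkContinuous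
    { toFun := fun f => Submodule.Quotient.mk (WithLp.toLp 1 (f, 0))
      map_add' := fun f g => by
        rw [← Submodule.Quotient.mk_add, ← WithLp.toLp_add, Prod.mk_add_mk, add_zero]
      map_smul' := fun c f => by
        rw [RingHom.id_apply, ← Submodule.Quotient.mk_smul, ← WithLp.toLp_smul, Prod.smul_mk,
          smul_zero] } 1 fun f => by
    refine (Submodule.Quotient.norm_mk_le _ _).trans (le_of_eq ?_)
    rw [WithLp.prod_norm_eq_add (by simp)]
    simp

/-- `f ↦ ∂ₓ f`, as a map from `L¹` to `W^{-1,1}`. -/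
def wm11Deriv (a b : ℝ) : L1Ioo a b →L[ℝ] Wm11 a b :=
  LinearMap.mkContinuous
    { toFun := fun f => Submodule.Quotient.mk (WithLp.toLp 1 (0, f))
      map_add' := fun f g => by
        rw [← Submodule.Quotient.mk_add, ← WithLp.toLp_add, Prod.mk_add_mk, add_zero]
      map_smul' := fun c f => by
        rw [RingHom.id_apply, ← Submodule.Quotient.mk_smul, ← WithLp.toLp_smul, Prod.smul_mk,
          smul_zero] } 1 fun f => by
    refine (Submodule.Quotient.norm_mk_le _ _).trans (le_of_eq ?_)
    rw [WithLp.prod_norm_eq_add (by simp)]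
    simp

theorem wm11Incl_apply (f : L1Ioo a b) :
    wm11Incl a b f = Submodule.Quotient.mk (WithLp.toLp 1 (f, 0)) := rfl

theorem wm11Deriv_apply (f : L1Ioo a b) :
    wm11Deriv a b f = Submodule.Quotient.mk (WithLp.toLp 1 (0, f)) := rfl

theorem norm_wm11Incl_le (f : L1Ioo a b) : ‖wm11Incl a b f‖ ≤ ‖f‖ := by
  have := (wm11Incl a b).le_of_opNorm_le (LinearMap.mkContinuous_norm_le _ zero_le_one _) f
  rwa [one_mul] at this

theorem norm_wm11Deriv_le (f : L1Ioo a b) : ‖wm11Deriv a b f‖ ≤ ‖f‖ := by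
  have := (wm11Deriv a b).le_of_opNorm_le (LinearMap.mkContinuous_norm_le _ zero_le_one _) f
  rwa [one_mul] at this

theorem toWm11_eq (f : ℝ → ℝ) : toWm11 a b f = wm11Incl a b (toL1Ioo a b f) := by
  rw [toWm11, toL1Ioo]
  split_ifs with h
  · rfl
  · rw [map_zero]

theorem wm11Incl_add_wm11Deriv_eq_zero {f g : L1Ioo a b}
    (h : ∀ φ, IsTestFun (Ioo a b) φ →
      (∫ x in Ioo a b, f x * φ x) - ∫ x in Ioo a b, g x * deriv φ x = 0) :
    wm11Incl a b f + wm11Deriv a b g = 0 := by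
  rw [wm11Incl_apply, wm11Deriv_apply, ← Submodule.Quotient.mk_add, ← WithLp.toLp_add,
    Prod.mk_add_mk, add_zero, zero_add, Submodule.Quotient.mk_eq_zero]
  exact h

/-- From a weak formulation on `(0,T) × (a,b)` to a weak derivative with values in `W^{-1,1}`. -/
theorem exists_hasWeakDerivOn_toWm11 {r f₀ f₁ : ℝ × ℝ → ℝ}
    (hr : IntegrableOn r (Ioo 0 T ×ˢ Ioo a b)) (h₀ : IntegrableOn f₀ (Ioo 0 T ×ˢ Ioo a b))
    (h₁ : IntegrableOn f₁ (Ioo 0 T ×ˢ Ioo a b))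
    (hw : ∀ θ φ, IsTestFun (Ioo 0 T) θ → IsTestFun (Ioo a b) φ →
      ∫ z in Ioo 0 T ×ˢ Ioo a b, deriv θ z.1 * φ z.2 * r z
        = -((∫ z in Ioo 0 T ×ˢ Ioo a b, θ z.1 * φ z.2 * f₀ z)
          - ∫ z in Ioo 0 T ×ˢ Ioo a b, θ z.1 * deriv φ z.2 * f₁ z)) :
    ∃ g : ℝ → Wm11 a b,
      HasWeakDerivOn (Ioo 0 T) (fun t => toWm11 a b fun x => r (t, x)) g ∧
      IntegrableOn g (Ioo 0 T) ∧
      ∫ t in Ioo 0 T, ‖g t‖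
        ≤ (∫ z in Ioo 0 T ×ˢ Ioo a b, |f₀ z|) + ∫ z in Ioo 0 T ×ˢ Ioo a b, |f₁ z| := by
  obtain ⟨ir, -⟩ := integrable_toL1Ioo hr
  obtain ⟨i0, n0⟩ := integrable_toL1Ioo h₀
  obtain ⟨i1, n1⟩ := integrable_toL1Ioo h₁
  set lr : ℝ → L1Ioo a b := fun t => toL1Ioo a b fun x => r (t, x) with hlr
  set l0 : ℝ → L1Ioo a b := fun t => toL1Ioo a b fun x => f₀ (t, x) with hl0
  set l1 : ℝ → L1Ioo a b := fun t => toL1Ioo a b fun x => f₁ (t, x) with hl1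
  set g : ℝ → Wm11 a b := fun t => wm11Incl a b (l0 t) + wm11Deriv a b (l1 t) with hg
  have ig : IntegrableOn g (Ioo 0 T) :=
    ((wm11Incl a b).integrable_comp i0).add ((wm11Deriv a b).integrable_comp i1)
  have ir' : IntegrableOn (fun t => toWm11 a b fun x => r (t, x)) (Ioo 0 T) := by
    simp only [toWm11_eq]
    exact (wm11Incl a b).integrable_comp ir
  refine ⟨g, ⟨ir'.locallyIntegrableOn, ig.locallyIntegrableOn, fun θ hθ => ?_⟩, ig, ?_⟩
  · obtain ⟨Cθ, hCθ⟩ := hθ.2.1.exists_bound_of_continuous hθ.continuous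
    obtain ⟨Cθ', hCθ'⟩ := hθ.2.1.deriv.exists_bound_of_continuous hθ.continuous_deriv
    have jr : Integrable (fun t => deriv θ t • lr t) (volume.restrict (Ioo 0 T)) :=
      ir.bdd_smul Cθ' hθ.continuous_deriv.aestronglyMeasurable (Eventually.of_forall hCθ')
    have j0 : Integrable (fun t => θ t • l0 t) (volume.restrict (Ioo 0 T)) :=
      i0.bdd_smul Cθ hθ.continuous.aestronglyMeasurable (Eventually.of_forall hCθ)
    have j1 : Integrable (fun t => θ t • l1 t) (volume.restrict (Ioo 0 T)) :=
      i1.bdd_smul Cθ hθ.continuous.aestronglyMeasurable (Eventually.of_forall hCθ)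
    have k0 : Integrable (fun t => θ t • wm11Incl a b (l0 t)) (volume.restrict (Ioo 0 T)) := by
      simpa only [map_smul] using (wm11Incl a b).integrable_comp j0
    have k1 : Integrable (fun t => θ t • wm11Deriv a b (l1 t)) (volume.restrict (Ioo 0 T)) := by
      simpa only [map_smul] using (wm11Deriv a b).integrable_comp j1
    have er : ∫ t in Ioo 0 T, deriv θ t • toWm11 a b (fun x => r (t, x))
        = wm11Incl a b (∫ t in Ioo 0 T, deriv θ t • lr t) := by
      rw [← (wm11Incl a b).integral_comp_comm jr]
      simp only [map_smul, toWm11_eq, hlr]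
    have eg : ∫ t in Ioo 0 T, θ t • g t
        = wm11Incl a b (∫ t in Ioo 0 T, θ t • l0 t) + wm11Deriv a b (∫ t in Ioo 0 T, θ t • l1 t) := by
      rw [← (wm11Incl a b).integral_comp_comm j0, ← (wm11Deriv a b).integral_comp_comm j1]
      simp only [map_smul, hg, smul_add]
      exact integral_add k0 k1
    -- With the maps into W^{-1,1} pulled out of the Bochner integrals, the claim says that one
    -- distribution f + ∂ₓ g vanishes. Testing with φ returns the scalar identity for the product
    -- θ(t) φ(x).
    rw [er, eg, eq_neg_iff_add_eq_zero, ← add_assoc, ← map_add]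
    refine wm11Incl_add_wm11Deriv_eq_zero fun φ hφ => ?_
    have hc := hφ.continuous
    have hs := hφ.2.1
    have hc' := hφ.continuous_deriv
    have hs' := hφ.2.1.deriv
    obtain ⟨Cφ, hCφ⟩ := hs.exists_bound_of_continuous hc
    obtain ⟨Cφ', hCφ'⟩ := hs'.exists_bound_of_continuous hc'
    rw [← L1Ioo.integralMul_apply hc hs, ← L1Ioo.integralMul_apply hc' hs', map_add,
      ← ContinuousLinearMap.integral_comp_comm _ jr, ← ContinuousLinearMap.integral_comp_comm _ j0,
      ← ContinuousLinearMap.integral_comp_comm _ j1]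
    have aux {F : ℝ × ℝ → ℝ} (hF : IntegrableOn F (Ioo 0 T ×ˢ Ioo a b)) {θ h : ℝ → ℝ} {C C' : ℝ}
        (hθ : Continuous θ) (hC : ∀ t, ‖θ t‖ ≤ C) (hh : Continuous h) (hs : HasCompactSupport h)
        (hC' : ∀ t, ‖h t‖ ≤ C') :
        ∫ t in Ioo 0 T, L1Ioo.integralMul a b hh hs (θ t • toL1Ioo a b fun x => F (t, x))
          = ∫ z in Ioo 0 T ×ˢ Ioo a b, θ z.1 * h z.2 * F z := by
      have hi : IntegrableOn (fun z : ℝ × ℝ => θ z.1 * h z.2 * F z) (Ioo 0 T ×ˢ Ioo a b) := by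
        refine hF.bdd_mul (c := C * C')
          ((hθ.comp continuous_fst).mul (hh.comp continuous_snd)).aestronglyMeasurable
          (Eventually.of_forall fun z => ?_)
        simp only [norm_mul]
        exact mul_le_mul (hC _) (hC' _) (norm_nonneg _) ((norm_nonneg _).trans (hC 0))
      rw [integral_spaceTime hi]
      refine integral_congr_ae ((ae_slice_integrable hF).mono fun t ht => ?_)
      simp only [map_smul]
      rw [L1Ioo.integralMul_toL1Ioo hh hs ht, smul_eq_mul, ← integral_const_mul]
      congr 1
      funext x
      ring
    rw [aux hr hθ.continuous_deriv hCθ' hc hs hCφ, aux h₀ hθ.continuous hCθ hc hs hCφ,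
      aux h₁ hθ.continuous hCθ hc' hs' hCφ', hw θ φ hθ hφ]
    ring
  · rw [← n0, ← n1, ← integral_add i0.norm i1.norm]
    refine integral_mono ig.norm (i0.norm.add i1.norm) fun t => ?_
    exact (norm_add_le _ _).trans (add_le_add (norm_wm11Incl_le _) (norm_wm11Deriv_le _))

end ToL1

end

/-! ### Compactness of functions of bounded variation with values in a totally bounded set -/

section

section Compactness

/-- On bounded sets of functions, closeness in `L¹` implies closeness in `L^p`. -/
theorem exists_eLpNorm_le_of_eLpNorm_one_le {α X : Type*} [MeasurableSpace α] {μ : Measure α}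
    [NormedAddCommGroup X] {p : ℝ≥0∞} (hp1 : 1 ≤ p) (hp : p ≠ ⊤) {D η : ℝ} (hD : 0 ≤ D) (hη : 0 < η) :
    ∃ κ : ℝ, 0 < κ ∧ ∀ f : α → X, (∀ᵐ x ∂μ, ‖f x‖ ≤ D) →
      ∫⁻ x, ‖f x‖ₑ ∂μ ≤ ENNReal.ofReal κ → eLpNorm f p μ ≤ ENNReal.ofReal η := by
  have hp0 : p ≠ 0 := (zero_lt_one.trans_le hp1).ne'
  set q := p.toReal with hq
  have hq1 : 1 ≤ q := by
    rw [hq, ← ENNReal.toReal_one]; exact ENNReal.toReal_mono hp hp1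
  have hq0 : 0 < q := zero_lt_one.trans_le hq1
  -- From ‖f‖ ≤ D one gets ‖f‖^q ≤ (D+1)^{q-1} ‖f‖; D + 1 instead of D keeps the denominator
  -- positive.
  refine ⟨η ^ q / (D + 1) ^ (q - 1), by positivity, fun f hfD hf => ?_⟩
  rw [eLpNorm_eq_lintegral_rpow_enorm_toReal hp0 hp, one_div, ENNReal.rpow_inv_le_iff hq0,
    ENNReal.ofReal_rpow_of_pos hη]
  calc ∫⁻ x, ‖f x‖ₑ ^ q ∂μ ≤ ∫⁻ x, ENNReal.ofReal ((D + 1) ^ (q - 1)) * ‖f x‖ₑ ∂μ := by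
        refine lintegral_mono_ae (hfD.mono fun x hx => ?_)
        rw [← ofReal_norm, ENNReal.ofReal_rpow_of_nonneg (norm_nonneg _) hq0.le,
          ← ENNReal.ofReal_mul (by positivity)]
        refine ENNReal.ofReal_le_ofReal ?_
        rcases (norm_nonneg (f x)).eq_or_lt with h0 | h0
        · rw [← h0, Real.zero_rpow hq0.ne', mul_zero]
        · have : ‖f x‖ ^ q = ‖f x‖ ^ (q - 1) * ‖f x‖ := by
            rw [← Real.rpow_add_one h0.ne', sub_add_cancel]
          rw [this]
          refine mul_le_mul_of_nonneg_right ?_ (norm_nonneg _)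
          exact Real.rpow_le_rpow (norm_nonneg _) (by linarith) (by linarith)
    _ = ENNReal.ofReal ((D + 1) ^ (q - 1)) * ∫⁻ x, ‖f x‖ₑ ∂μ :=
        lintegral_const_mul' _ _ ENNReal.ofReal_ne_top
    _ ≤ ENNReal.ofReal ((D + 1) ^ (q - 1)) * ENNReal.ofReal (η ^ q / (D + 1) ^ (q - 1)) := by
        gcongr
    _ = ENNReal.ofReal (η ^ q) := by
        rw [← ENNReal.ofReal_mul (by positivity), mul_div_cancel₀]
        positivity

/-- The index of the cell containing `t` in a partition of `(a,b)` into `N` equal cells. -/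
def cellIdx (a b : ℝ) (N : ℕ) (t : ℝ) : ℕ := ⌊(t - a) * (N / (b - a))⌋₊

variable {a b : ℝ} {N : ℕ}

theorem measurable_cellIdx : Measurable (cellIdx a b N) :=
  Nat.measurable_floor.comp ((measurable_id.sub_const a).mul_const _)

theorem monotone_cellIdx (hab : a < b) : Monotone (cellIdx a b N) := fun s t hst => by
  have : 0 < b - a := sub_pos.2 hab
  exact Nat.floor_mono (mul_le_mul_of_nonneg_right (by linarith) (by positivity))

theorem cellIdx_lt (hab : a < b) (hN : 0 < N) {t : ℝ} (ht : t ∈ Ioo a b) : cellIdx a b N t < N := by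
  have hba : 0 < b - a := sub_pos.2 hab
  have hN' : (0 : ℝ) < N := Nat.cast_pos.2 hN
  rw [cellIdx, Nat.floor_lt (mul_nonneg (by linarith [ht.1]) (by positivity)), mul_div_assoc',
    div_lt_iff₀ hba, mul_comm]
  exact mul_lt_mul_of_pos_left (by linarith [ht.2]) hN'

theorem cellIdx_eq_iff (hab : a < b) (hN : 0 < N) {t : ℝ} (ht : a ≤ t) (k : ℕ) :
    cellIdx a b N t = k ↔ t ∈ Ico (a + k * ((b - a) / N)) (a + (k + 1) * ((b - a) / N)) := by
  have hba : 0 < b - a := sub_pos.2 hab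
  have hN' : (0 : ℝ) < N := Nat.cast_pos.2 hN
  have e (x : ℝ) : x * ((b - a) / N) = x / (N / (b - a)) := by field_simp
  rw [cellIdx, Nat.floor_eq_iff (mul_nonneg (by linarith) (by positivity)), mem_Ico, e, e,
    ← le_sub_iff_add_le', div_le_iff₀ (by positivity), ← sub_lt_iff_lt_add' (a := t),
    lt_div_iff₀ (by positivity)]

theorem volume_cell_le (hab : a < b) (hN : 0 < N) (k : ℕ) :
    volume ({t | cellIdx a b N t = k} ∩ Ioo a b) ≤ ENNReal.ofReal ((b - a) / N) := by
  have : {t | cellIdx a b N t = k} ∩ Ioo a b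
      ⊆ Ico (a + k * ((b - a) / N)) (a + (k + 1) * ((b - a) / N)) := fun t ht =>
    (cellIdx_eq_iff hab hN ht.2.1.le k).1 ht.1
  refine (measure_mono this).trans (le_of_eq ?_)
  rw [Real.volume_Ico]
  congr 1
  ring

/-- A step function with given values on the cells. -/
def cellStep {X : Type*} (a b : ℝ) (m : ℕ) (y : Fin (m + 1) → X) (t : ℝ) : X :=
  y (Fin.ofNat (m + 1) (cellIdx a b (m + 1) t))

theorem stronglyMeasurable_cellStep {X : Type*} [NormedAddCommGroup X] (a b : ℝ) (m : ℕ)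
    (y : Fin (m + 1) → X) : StronglyMeasurable (cellStep a b m y) :=
  (StronglyMeasurable.of_discrete (f := fun k : ℕ => y (Fin.ofNat (m + 1) k))).comp_measurable
    measurable_cellIdx

/-- The oscillation over the cells is bounded by the total variation, in `L¹`. -/
theorem lintegral_cell_le {X : Type*} [NormedAddCommGroup X] {g : ℝ → X} (hab : a < b) (hN : 0 < N)
    (hg : AEStronglyMeasurable g (volume.restrict (Ioo a b))) :
    ∫⁻ t in Ioo a b, ∫⁻ s in Ioo a b, {s | cellIdx a b N s = cellIdx a b N t}.indicator
        (fun s => ‖g s‖ₑ) s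
      ≤ ENNReal.ofReal ((b - a) / N) * ∫⁻ s in Ioo a b, ‖g s‖ₑ := by
  have hm : MeasurableSet {z : ℝ × ℝ | cellIdx a b N z.2 = cellIdx a b N z.1} :=
    measurableSet_eq_fun (measurable_cellIdx.comp measurable_snd)
      (measurable_cellIdx.comp measurable_fst)
  have hF : AEMeasurable ({z : ℝ × ℝ | cellIdx a b N z.2 = cellIdx a b N z.1}.indicator
      fun z => ‖g z.2‖ₑ) ((volume.restrict (Ioo a b)).prod (volume.restrict (Ioo a b))) :=
    (hg.enorm.comp_snd).indicator hm
  have e (t s : ℝ) : {s | cellIdx a b N s = cellIdx a b N t}.indicator (fun s => ‖g s‖ₑ) s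
      = {z : ℝ × ℝ | cellIdx a b N z.2 = cellIdx a b N z.1}.indicator (fun z => ‖g z.2‖ₑ) (t, s) := rfl
  simp only [e]
  -- After Tonelli, each ‖g(s)‖ is weighted by the measure of the times `t` in the cell of `s`, at
  -- most (b-a)/N.
  rw [lintegral_lintegral_swap (f := fun t s =>
    {z : ℝ × ℝ | cellIdx a b N z.2 = cellIdx a b N z.1}.indicator (fun z => ‖g z.2‖ₑ) (t, s)) hF, ← lintegral_const_mul' _ _ ENNReal.ofReal_ne_top]
  refine lintegral_mono fun s => ?_
  have e' (t : ℝ) : {z : ℝ × ℝ | cellIdx a b N z.2 = cellIdx a b N z.1}.indicator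
      (fun z => ‖g z.2‖ₑ) (t, s) = {t | cellIdx a b N t = cellIdx a b N s}.indicator
        (fun _ => ‖g s‖ₑ) t := by
    by_cases h : cellIdx a b N t = cellIdx a b N s
    · rw [indicator_of_mem (show t ∈ {t | cellIdx a b N t = cellIdx a b N s} from h),
        indicator_of_mem (show (t, s) ∈ {z : ℝ × ℝ | cellIdx a b N z.2 = cellIdx a b N z.1} from h.symm)]
    · rw [indicator_of_notMem (show t ∉ {t | cellIdx a b N t = cellIdx a b N s} from h),
        indicator_of_notMem
          (show (t, s) ∉ {z : ℝ × ℝ | cellIdx a b N z.2 = cellIdx a b N z.1} from fun h' => h h'.symm)]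
  simp only [e']
  have hm' : MeasurableSet {t | cellIdx a b N t = cellIdx a b N s} :=
    measurable_cellIdx (measurableSet_singleton _)
  rw [lintegral_indicator_const hm', Measure.restrict_apply hm', mul_comm]
  gcongr
  exact volume_cell_le hab hN _

/-- A set of functions with values in a totally bounded set and with uniformly bounded variation
is totally bounded in `L^p`. -/
theorem totallyBounded_of_variation_le {X : Type*} [NormedAddCommGroup X] [NormedSpace ℝ X]
    (hab : a < b) {K : Set X} (hK : TotallyBounded K) {C : ℝ} (hC : 0 ≤ C) {p : ℝ≥0∞}
    [Fact (1 ≤ p)] (hp : p ≠ ⊤) {A : Set (Lp X p (volume.restrict (Ioo a b)))}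
    (hA : ∀ f ∈ A, ∃ g : ℝ → X, AEStronglyMeasurable g (volume.restrict (Ioo a b)) ∧
      ∫⁻ t in Ioo a b, ‖g t‖ₑ ≤ ENNReal.ofReal C ∧ ∃ S : Set ℝ, (∀ᵐ t, t ∈ S) ∧
        (∀ t ∈ S, t ∈ Ioo a b → f t ∈ K) ∧
        ∀ s ∈ S, ∀ t ∈ S, s ≤ t → Icc s t ⊆ Ioo a b → f t - f s = ∫ r in s..t, g r) :
    TotallyBounded A := by
  have hba : 0 < b - a := sub_pos.2 hab
  obtain ⟨D, hD⟩ := hK.isBounded.exists_norm_le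
  rw [Metric.totallyBounded_iff]
  intro η hη
  set D' := 2 * |D| with hD'
  obtain ⟨κ, hκ, hint⟩ := exists_eLpNorm_le_of_eLpNorm_one_le (X := X)
    (μ := volume.restrict (Ioo a b)) (Fact.out : 1 ≤ p) hp (D := D') (by positivity) (half_pos hη)
  -- The L¹ budget κ is split in two: the oscillation over m + 1 cells costs at most (b-a)C/(m+1) ≤
  -- κ/2, and replacing the sampled values by points of an η'-net of `K` costs η'(b-a) = κ/2.
  obtain ⟨m, hm⟩ := exists_nat_gt ((b - a) * C / (κ / 2))
  have hmC : (b - a) / ((m + 1 : ℕ) : ℝ) * C ≤ κ / 2 := by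
    rw [div_lt_iff₀ (by positivity)] at hm
    rw [div_mul_eq_mul_div, div_le_iff₀ (by positivity)]
    push_cast
    nlinarith
  set η' := κ / 2 / (b - a) with hη'
  have hη'0 : 0 < η' := by positivity
  obtain ⟨F, hFK, hFfin, hF⟩ := Metric.finite_approx_of_totallyBounded hK η' hη'0
  have hmem (y : Fin (m + 1) → X) :
      MemLp (cellStep a b m y) p (volume.restrict (Ioo a b)) := by
    obtain ⟨c, hc⟩ := (finite_range y).isBounded.exists_norm_le
    exact MemLp.of_bound (stronglyMeasurable_cellStep a b m y).aestronglyMeasurable c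
      (Eventually.of_forall fun t => hc _ (mem_range_self _))
  refine ⟨(fun y => (hmem y).toLp) '' univ.pi fun _ => F, (Finite.pi fun _ => hFfin).image _, fun f hf => ?_⟩
  obtain ⟨g, hgm, hgC, S, hS, hSK, hSg⟩ := hA f hf
  have hN : 0 < m + 1 := m.succ_pos
  -- sample points
  have hpt (k : Fin (m + 1)) : ∃ t ∈ S, t ∈ Ioo a b ∧ cellIdx a b (m + 1) t = k := by
    set c := a + k * ((b - a) / ((m + 1 : ℕ) : ℝ)) with hc
    set d := a + (k + 1) * ((b - a) / ((m + 1 : ℕ) : ℝ)) with hd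
    have hpos : 0 < (b - a) / ((m + 1 : ℕ) : ℝ) := by positivity
    have hcd : c < d := by rw [hc, hd]; nlinarith
    have hac : a ≤ c := by
      have : 0 ≤ (k : ℝ) * ((b - a) / ((m + 1 : ℕ) : ℝ)) := by positivity
      rw [hc]
      linarith
    have hdb : d ≤ b := by
      have h1 : (k : ℝ) + 1 ≤ ((m + 1 : ℕ) : ℝ) := by exact_mod_cast k.2
      have h2 : ((k : ℝ) + 1) * ((b - a) / ((m + 1 : ℕ) : ℝ)) ≤ b - a := by
        rw [mul_div_assoc', div_le_iff₀ (by positivity), mul_comm]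
        exact mul_le_mul_of_nonneg_left h1 hba.le
      linarith
    -- Each cell has positive measure, so it meets the full-measure set `S` on which `f` is
    -- controlled pointwise.
    have hne : (volume.restrict (Ioo c d)) ≠ 0 := by
      rw [Ne, Measure.restrict_eq_zero, Real.volume_Ioo, ENNReal.ofReal_eq_zero]
      linarith
    have : (ae (volume.restrict (Ioo c d))).NeBot := ae_neBot.2 hne
    obtain ⟨t, htS, ht⟩ := ((ae_restrict_of_ae hS).and
      (ae_restrict_mem (μ := volume) (measurableSet_Ioo (a := c) (b := d)))).exists
    have hta : a < t := hac.trans_lt ht.1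
    exact ⟨t, htS, ⟨hta, ht.2.trans_le hdb⟩, (cellIdx_eq_iff hab hN hta.le _).2 ⟨ht.1.le, ht.2⟩⟩
  choose τ hτS hτI hτk using hpt
  have hy (k : Fin (m + 1)) : ∃ y ∈ F, dist (f (τ k)) y < η' := by
    have := hF (hSK _ (hτS k) (hτI k))
    simpa using this
  choose y hyF hyd using hy
  refine mem_iUnion₂.2 ⟨(hmem y).toLp, ⟨y, fun k _ => hyF k, rfl⟩, ?_⟩
  rw [Metric.mem_ball, Lp.dist_def]
  have hae : (⇑f - ⇑((hmem y).toLp)) =ᵐ[volume.restrict (Ioo a b)] fun t => f t - cellStep a b m y t := by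
    filter_upwards [(hmem y).coeFn_toLp] with t ht
    rw [Pi.sub_apply, ht]
  rw [eLpNorm_congr_ae hae]
  have hbound : eLpNorm (fun t => f t - cellStep a b m y t) p (volume.restrict (Ioo a b))
      ≤ ENNReal.ofReal (η / 2) := by
    refine hint _ ?_ ?_
    · filter_upwards [ae_restrict_of_ae hS, ae_restrict_mem measurableSet_Ioo] with t ht htI
      refine (norm_sub_le _ _).trans ?_
      have h1 := hD _ (hSK t ht htI)
      have h2 := hD _ (hFK (hyF (Fin.ofNat (m + 1) (cellIdx a b (m + 1) t))))
      have h3 := le_abs_self D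
      rw [cellStep]
      linarith
    -- At time `t` the error is the increment of `f` from the sample point of the same cell, at most
    -- the integral of ‖g‖ over that cell, plus the distance of the sampled value to the net.
    · calc ∫⁻ t in Ioo a b, ‖f t - cellStep a b m y t‖ₑ
          ≤ ∫⁻ t in Ioo a b, ((∫⁻ s in Ioo a b,
              {s | cellIdx a b (m + 1) s = cellIdx a b (m + 1) t}.indicator (fun s => ‖g s‖ₑ) s)
              + ENNReal.ofReal η') := by
            refine lintegral_mono_ae ?_
            filter_upwards [ae_restrict_of_ae hS, ae_restrict_mem measurableSet_Ioo] with t ht htI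
            set k := Fin.ofNat (m + 1) (cellIdx a b (m + 1) t) with hk
            -- `Fin.ofNat` reduces modulo m + 1, which has no effect for times inside (a,b).
            have hkv : (k : ℕ) = cellIdx a b (m + 1) t := by
              rw [hk, Fin.val_ofNat]
              exact Nat.mod_eq_of_lt (cellIdx_lt hab hN htI)
            have e1 : f t - cellStep a b m y t = (f t - f (τ k)) + (f (τ k) - y k) := by
              rw [sub_add_sub_cancel]; rfl
            rw [e1]
            refine (enorm_add_le _ _).trans (add_le_add ?_ ?_)
            · have hsub : uIcc (τ k) t ⊆ Ioo a b := by
                rw [uIcc]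
                exact Icc_subset_Ioo (lt_min (hτI k).1 htI.1) (max_lt (hτI k).2 htI.2)
              have h2 : ‖f t - f (τ k)‖ₑ = ‖∫ r in (τ k)..t, g r‖ₑ := by
                rcases le_total (τ k) t with h | h
                · rw [hSg _ (hτS k) _ ht h (by rwa [uIcc_of_le h] at hsub)]
                · rw [← enorm_neg, neg_sub, hSg _ ht _ (hτS k) h (by rwa [uIcc_of_ge h] at hsub),
                    intervalIntegral.integral_symm, enorm_neg]
              rw [h2]
              have h3 : ‖∫ r in (τ k)..t, g r‖ₑ ≤ ∫⁻ r in uIoc (τ k) t, ‖g r‖ₑ := by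
                rw [← ofReal_norm, intervalIntegral.norm_intervalIntegral_eq,
                  ofReal_norm]
                exact enorm_integral_le_lintegral_enorm _
              refine h3.trans ?_
              have hcm : MeasurableSet {s | cellIdx a b (m + 1) s = cellIdx a b (m + 1) t} :=
                measurable_cellIdx (measurableSet_singleton _)
              rw [lintegral_indicator hcm, Measure.restrict_restrict hcm]
              refine lintegral_mono_set fun s hs => ⟨?_, hsub (uIoc_subset_uIcc hs)⟩
              have hs' := uIoc_subset_uIcc hs
              have hmono := monotone_cellIdx (N := m + 1) hab
              have hτ' : cellIdx a b (m + 1) (τ k) = cellIdx a b (m + 1) t := by rw [hτk, hkv]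
              rcases le_total (τ k) t with h | h
              · rw [uIcc_of_le h] at hs'
                exact le_antisymm (hmono hs'.2) (hτ' ▸ hmono hs'.1)
              · rw [uIcc_of_ge h] at hs'
                exact le_antisymm (hτ' ▸ hmono hs'.2) (hmono hs'.1)
            · rw [← ofReal_norm, ← dist_eq_norm]
              exact ENNReal.ofReal_le_ofReal (hyd k).le
        _ = (∫⁻ t in Ioo a b, ∫⁻ s in Ioo a b,
              {s | cellIdx a b (m + 1) s = cellIdx a b (m + 1) t}.indicator (fun s => ‖g s‖ₑ) s)
              + ENNReal.ofReal η' * ENNReal.ofReal (b - a) := by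
            rw [lintegral_add_right _ measurable_const, setLIntegral_const, Real.volume_Ioo]
        _ ≤ ENNReal.ofReal ((b - a) / ((m + 1 : ℕ) : ℝ)) * ENNReal.ofReal C
              + ENNReal.ofReal η' * ENNReal.ofReal (b - a) := by
            gcongr
            refine (lintegral_cell_le hab hN hgm).trans ?_
            gcongr
        _ ≤ ENNReal.ofReal κ := by
            rw [← ENNReal.ofReal_mul (by positivity), ← ENNReal.ofReal_mul hη'0.le,
              ← ENNReal.ofReal_add (by positivity) (by positivity)]
            refine ENNReal.ofReal_le_ofReal ?_
            have : η' * (b - a) = κ / 2 := by rw [hη']; field_simp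
            linarith
  exact (ENNReal.toReal_le_of_le_ofReal (half_pos hη).le hbound).trans_lt (half_lt_self hη)

end Compactness

end

/-! ### Total boundedness of bounded functions in W^{-1,1} -/

section

variable {a b : ℝ}

/-- The primitive of an integrable function is absolutely continuous with that function as
derivative almost everywhere, and φ vanishes at both ends. -/
theorem integral_primitive_mul_deriv (hab : a < b) {f : ℝ → ℝ} (hf : IntegrableOn f (Ioo a b))
    {φ : ℝ → ℝ} (hφ : IsTestFun (Ioo a b) φ) :
    ∫ x in Ioo a b, (∫ t in a..x, f t) * deriv φ x = -∫ x in Ioo a b, f x * φ x := by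
  have hfi : IntervalIntegrable f volume a b := by
    rw [intervalIntegrable_iff_integrableOn_Ioo_of_le hab.le]; exact hf
  have hF : AbsolutelyContinuousOnInterval (fun x => ∫ t in a..x, f t) a b :=
    hfi.absolutelyContinuousOnInterval_intervalIntegral left_mem_uIcc
  have hφac : AbsolutelyContinuousOnInterval φ a b :=
    (hφ.1.of_le (by simp)).contDiffOn.absolutelyContinuousOnInterval
  have hibp := hF.integral_mul_deriv_eq_deriv_mul hφac
  rw [hφ.eq_zero (x := a) (by simp), hφ.eq_zero (x := b) (by simp), mul_zero, mul_zero, sub_zero,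
    zero_sub, intervalIntegral.integral_of_le hab.le, intervalIntegral.integral_of_le hab.le]
    at hibp
  rw [← integral_Ioc_eq_integral_Ioo, ← integral_Ioc_eq_integral_Ioo, hibp, neg_inj]
  refine setIntegral_congr_ae measurableSet_Ioc ?_
  filter_upwards [hfi.ae_hasDerivAt_integral] with x hx hxI
  rw [(hx (by rw [uIcc_of_le hab.le]; exact Ioc_subset_Icc_self hxI) a left_mem_uIcc).deriv]

/-- Sets of bounded functions are totally bounded in `W^{-1,1}`. -/
theorem totallyBounded_toWm11 (hab : a < b) {R : ℝ} (hR : 0 ≤ R) :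
    TotallyBounded {y : Wm11 a b | ∃ f : ℝ → ℝ, IntegrableOn f (Ioo a b) ∧
      (∀ x ∈ Ioo a b, |f x| ≤ R) ∧ toWm11 a b f = y} := by
  have hba : 0 < b - a := sub_pos.2 hab
  set A : Set (L1Ioo a b) := {F | ∃ f : ℝ → ℝ, IntegrableOn f (Ioo a b) ∧
      (∀ x ∈ Ioo a b, |f x| ≤ R) ∧ toL1Ioo a b (fun x => -∫ t in a..x, f t) = F} with hA
  have hprim {f : ℝ → ℝ} (hf : IntegrableOn f (Ioo a b)) :
      ContinuousOn (fun x => ∫ t in a..x, f t) (Icc a b) := by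
    have := intervalIntegral.continuousOn_primitive_interval (μ := volume) (f := f) (a := a) (b := b)
      (by rw [uIcc_of_le hab.le, integrableOn_Icc_iff_integrableOn_Ioo]; exact hf)
    rwa [uIcc_of_le hab.le] at this
  have hii {f : ℝ → ℝ} (hf : IntegrableOn f (Ioo a b)) {s t : ℝ} (hs : s ∈ Icc a b)
      (ht : t ∈ Icc a b) : IntervalIntegrable f volume s t := by
    have : IntervalIntegrable f volume a b := by
      rw [intervalIntegrable_iff_integrableOn_Ioo_of_le hab.le]; exact hf
    exact this.mono_set (by rw [uIcc_of_le hab.le]; exact uIcc_subset_Icc hs ht)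
  have hFint {f : ℝ → ℝ} (hf : IntegrableOn f (Ioo a b)) :
      IntegrableOn (fun x => -∫ t in a..x, f t) (Ioo a b) :=
    ((hprim hf).neg.integrableOn_compact isCompact_Icc).mono_set Ioo_subset_Icc_self
  -- The compactness lemma is used here with `x` in the role of time and real values: primitives of
  -- functions bounded by R take values in a fixed compact interval and have variation at most
  -- R(b-a).
  have hAtb : TotallyBounded A := by
    refine totallyBounded_of_variation_le hab
      (K := Metric.closedBall (0 : ℝ) (R * (b - a))) (isCompact_closedBall _ _).totallyBounded
      (C := R * (b - a)) (by positivity) ENNReal.one_ne_top ?_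
    rintro _ ⟨f, hf, hfR, rfl⟩
    refine ⟨fun x => -f x, hf.1.neg, ?_, ?_⟩
    · calc ∫⁻ t in Ioo a b, ‖-f t‖ₑ ≤ ∫⁻ _ in Ioo a b, ENNReal.ofReal R := by
            refine setLIntegral_mono' measurableSet_Ioo fun x hx => ?_
            rw [enorm_neg, ← ofReal_norm]
            exact ENNReal.ofReal_le_ofReal (hfR x hx)
        _ = ENNReal.ofReal (R * (b - a)) := by
            rw [setLIntegral_const, Real.volume_Ioo, ENNReal.ofReal_mul hR]
    · refine ⟨{x | x ∈ Ioo a b → toL1Ioo a b (fun x => -∫ t in a..x, f t) x = -∫ t in a..x, f t},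
        (ae_restrict_iff' measurableSet_Ioo).1 (coeFn_toL1Ioo (hFint hf)), fun t ht htI => ?_,
        fun s hs t ht hst hsub => ?_⟩
      · rw [ht htI, mem_closedBall_zero_iff, norm_neg]
        have := intervalIntegral.norm_integral_le_of_norm_le_const (f := f) (a := a) (b := t) (C := R)
          fun x hx => by
            rw [uIoc_of_le htI.1.le] at hx
            exact hfR x ⟨hx.1, hx.2.trans_lt htI.2⟩
        refine this.trans (mul_le_mul_of_nonneg_left ?_ hR)
        rw [abs_of_pos (by linarith [htI.1])]
        linarith [htI.2]
      · have hsI := hsub (left_mem_Icc.2 hst)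
        have htI := hsub (right_mem_Icc.2 hst)
        rw [ht htI, hs hsI, intervalIntegral.integral_neg,
          ← intervalIntegral.integral_interval_sub_left
            (hii hf (left_mem_Icc.2 hab.le) (Ioo_subset_Icc_self htI))
            (hii hf (left_mem_Icc.2 hab.le) (Ioo_subset_Icc_self hsI))]
        ring
  refine (hAtb.image (wm11Deriv a b).uniformContinuous).subset ?_
  rintro _ ⟨f, hf, hfR, rfl⟩
  -- The set `A` records minus the primitives, so `f`, being the derivative of its primitive, is
  -- reached from `-f`.
  refine ⟨_, ⟨fun x => -f x, hf.neg, fun x hx => by rw [abs_neg]; exact hfR x hx, rfl⟩, ?_⟩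
  have key : wm11Incl a b (toL1Ioo a b f)
      + wm11Deriv a b (toL1Ioo a b fun x => -∫ t in a..x, f t) = 0 := by
    refine wm11Incl_add_wm11Deriv_eq_zero fun φ hφ => ?_
    rw [← L1Ioo.integralMul_apply hφ.continuous hφ.2.1,
      ← L1Ioo.integralMul_apply hφ.continuous_deriv hφ.2.1.deriv,
      L1Ioo.integralMul_toL1Ioo _ _ hf, L1Ioo.integralMul_toL1Ioo _ _ (hFint hf)]
    have := integral_primitive_mul_deriv hab hf hφ
    simp only [neg_mul, integral_neg]
    rw [this]; ring
  have e2 : toL1Ioo a b (fun x => -∫ t in a..x, -f t)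
      = -toL1Ioo a b fun x => -∫ t in a..x, f t := by
    refine Lp.ext ?_
    have hf' : IntegrableOn (fun x => -f x) (Ioo a b) := hf.neg
    filter_upwards [coeFn_toL1Ioo (hFint hf'), coeFn_toL1Ioo (hFint hf),
      Lp.coeFn_neg (toL1Ioo a b fun x => -∫ t in a..x, f t)] with x h1 h2 h3
    rw [h1, h3, Pi.neg_apply, h2, intervalIntegral.integral_neg]
  rw [e2, map_neg, toWm11_eq]
  exact (eq_neg_of_add_eq_zero_left key).symm

end

/-! ### Uniform bounds and the conclusion -/

theorem IsThinFilmSolutionWith.continuousOn_rhoEps {a b n ε : ℝ} {uin uin' : ℝ → ℝ}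
    {u ux uxx uxxx : ℝ → ℝ → ℝ} (h : IsThinFilmSolutionWith a b n ε uin uin' u ux uxx uxxx)
    (hn0 : 0 < n) (hn3 : n < 3) (hε : 0 < ε) {t : ℝ} (ht : 0 ≤ t) :
    ContinuousOn (rhoEps n ε u t) (Icc a b) :=
  (continuousOn_Beps hn0 hn3 hε).comp (h.continuousOn t ht) fun x hx => h.nonneg t ht x hx

theorem IsThinFilmSolutionWith.aesm_rhoEps {a b n ε T : ℝ} {uin uin' : ℝ → ℝ}
    {u ux uxx uxxx : ℝ → ℝ → ℝ} (h : IsThinFilmSolutionWith a b n ε uin uin' u ux uxx uxxx)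
    (hn0 : 0 < n) (hn3 : n < 3) (hε : 0 < ε) :
    AEStronglyMeasurable (fun z : ℝ × ℝ => rhoEps n ε u z.1 z.2)
      (volume.restrict (Ioo 0 T ×ˢ Ioo a b)) := by
  -- Truncating at 0 extends B^ε continuously to ℝ, so that the measurability of `u` passes to ρ^ε
  -- without restricting to its range.
  have hc : Continuous fun s => Beps n ε (max s 0) :=
    (continuousOn_Beps hn0 hn3 hε).comp_continuous (continuous_id.max continuous_const)
      fun s => mem_Ici.2 (le_max_right s 0)
  refine (h.aesm_comp_u hc).congr ?_
  filter_upwards [IsThinFilmSolutionWith.ae_mem_spaceTime a b T] with z hz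
  rw [max_eq_left (h.nonneg z.1 hz.1.1.le z.2 (Ioo_subset_Icc_self hz.2)), rhoEps]

/-- The uniform bounds for `ρ^ε` and for `∂ₜ ρ^ε`. -/
theorem exists_uniform_bounds {a b n : ℝ} (hab : a < b) (hn0 : 0 < n) (hn3 : n < 3)
    {uin uin' : ℝ → ℝ} (huin0 : ∀ x ∈ Icc a b, 0 ≤ uin x)
    (huin'2 : MemLp uin' 2 (volume.restrict (Ioo a b)))
    {ε₀ : ℝ} (hε₀ : ε₀ < 1) {u : ℝ → ℝ → ℝ → ℝ}
    (hu : ∀ ε ∈ Ioc 0 ε₀, IsThinFilmSolution a b n ε uin uin' (u ε)) {T : ℝ} (hT : 0 < T) :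
    ∃ R C : ℝ, 0 ≤ R ∧ 0 ≤ C ∧ ∀ ε ∈ Ioc 0 ε₀,
      AEStronglyMeasurable (fun z : ℝ × ℝ => rhoEps n ε (u ε) z.1 z.2)
        (volume.restrict (Ioo 0 T ×ˢ Ioo a b)) ∧
      (∀ t, 0 < t → IntegrableOn (rhoEps n ε (u ε) t) (Ioo a b) ∧
        ∀ x ∈ Ioo a b, |rhoEps n ε (u ε) t x| ≤ R) ∧
      ∃ g : ℝ → Wm11 a b,
        HasWeakDerivOn (Ioo 0 T) (fun t => toWm11 a b (rhoEps n ε (u ε) t)) g ∧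
        IntegrableOn g (Ioo 0 T) ∧ ∫ t in Ioo 0 T, ‖g t‖ ≤ C := by
  have hba : 0 < b - a := sub_pos.2 hab
  set E := (∫⁻ x in Ioo a b, ENNReal.ofReal (uin' x ^ 2 / 2)).toReal with hEdef
  have hE0 : 0 ≤ E := ENNReal.toReal_nonneg
  have hE : ∫⁻ x in Ioo a b, ENNReal.ofReal (uin' x ^ 2 / 2) ≤ ENNReal.ofReal E := by
    rw [hEdef, ENNReal.ofReal_toReal]
    exact (huin'2.integrable_sq.div_const 2).lintegral_lt_top.ne
  -- M depends only on the interval and the initial datum. R and C below involve ε only through |ln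
  -- ε|⁻¹, already replaced by its largest value |ln ε₀|⁻¹.
  set M := (∫ y in Ioo a b, uin y) / (b - a) + ((b - a) / 2 + E) with hMdef
  have hM0 : 0 ≤ M := by
    have : 0 ≤ ∫ y in Ioo a b, uin y :=
      setIntegral_nonneg measurableSet_Ioo fun x hx => huin0 x (Ioo_subset_Icc_self hx)
    positivity
  set R := |Real.log ε₀|⁻¹ * (Bfun n 1 + Real.log (1 + M)) + 1 with hRdef
  have hR0 : 0 ≤ R := by
    have h1 := Bfun_nonneg n (zero_le_one (α := ℝ))
    have h2 : 0 ≤ Real.log (1 + M) := Real.log_nonneg (by linarith)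
    positivity
  set C := R * (b - a) + ((|Real.log ε₀|⁻¹ * (bconst' n * (1 + M)) * (T * (b - a)) + E) / 2
          + (R * (b - a) + M * (2 * E * T))) with hCdef
  have hbc : 0 ≤ bconst' n := by unfold bconst'; positivity
  refine ⟨R, C, hR0, by positivity, fun ε hε => ?_⟩
  have hε0 := hε.1
  have hε1 : ε < 1 := hε.2.trans_lt hε₀
  obtain ⟨ux, uxx, uxxx, h⟩ := hu ε hε
  have hM : ∀ t, 0 < t → ∀ x ∈ Ioo a b, u ε t x ≤ M := fun t ht x hx =>
    h.le_bound hab hE0 hE ht hx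
  have hR : ∀ t, 0 < t → ∀ x ∈ Ioo a b, rhoEps n ε (u ε) t x ≤ R := fun t ht x hx =>
    Beps_le hn0 hn3 hε0 hε.2 hε₀ (h.nonneg t ht.le x (Ioo_subset_Icc_self hx)) (hM t ht x hx)
  have hρ0 : ∀ t, 0 < t → ∀ x ∈ Ioo a b, 0 ≤ rhoEps n ε (u ε) t x := fun t ht x hx =>
    Beps_nonneg n hε0 (h.nonneg t ht.le x (Ioo_subset_Icc_self hx))
  have hρm := h.aesm_rhoEps (T := T) hn0 hn3 hε0
  refine ⟨hρm, fun t ht => ⟨?_, fun x hx => ?_⟩, ?_⟩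
  · exact ((h.continuousOn_rhoEps hn0 hn3 hε0 ht.le).integrableOn_compact isCompact_Icc).mono_set
      Ioo_subset_Icc_self
  · rw [abs_of_nonneg (hρ0 t ht x hx)]; exact hR t ht x hx
  · have hρi : IntegrableOn (fun z : ℝ × ℝ => rhoEps n ε (u ε) z.1 z.2) (Ioo 0 T ×ˢ Ioo a b) := by
      refine Integrable.mono' (integrableOn_const (C := R) (volume_spaceTime_ne_top a b T)) hρm ?_
      filter_upwards [IsThinFilmSolutionWith.ae_mem_spaceTime a b T] with z hz
      rw [Real.norm_of_nonneg (hρ0 z.1 hz.1.1 z.2 hz.2)]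
      exact hR z.1 hz.1.1 z.2 hz.2
    obtain ⟨i0, b0⟩ := h.integrable_rhoSource (T := T) hab hT hR0 hR
    obtain ⟨i1, b1⟩ := h.integrable_rhoFlux hab hn0 hn3 hε0 hε1 hT hE0 hE hM hM0 hR0 hR
    obtain ⟨g, hg, hgi, hgb⟩ := exists_hasWeakDerivOn_toWm11 hρi i0 i1 fun θ φ hθ hφ =>
      h.weak_rhoEps hab hn0 hn3 hε0 hε1 hT hE0 hE hM hM0 hR0 hR hθ hφ
    refine ⟨g, hg, hgi, hgb.trans (add_le_add ?_ (b1.trans ?_))⟩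
    · refine le_trans (le_of_eq (integral_congr_ae ?_)) b0
      filter_upwards [IsThinFilmSolutionWith.ae_mem_spaceTime a b T] with z hz
      exact abs_of_nonneg (mul_nonneg
        (h.nonneg z.1 hz.1.1.le z.2 (Ioo_subset_Icc_self hz.2)) (sq_nonneg _))
    -- This is the only factor of the flux bound that depends on ε, and it is largest at ε₀.
    · have hl : |Real.log ε|⁻¹ ≤ |Real.log ε₀|⁻¹ := by
        have h0 : Real.log ε₀ < 0 := Real.log_neg (hε0.trans_le hε.2) hε₀
        have h1 : Real.log ε ≤ Real.log ε₀ := Real.log_le_log hε0 hε.2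
        rw [abs_of_neg h0, abs_of_neg (h1.trans_lt h0)]
        exact inv_anti₀ (by linarith) (by linarith)
      gcongr

theorem norm_toWm11_le {a b R : ℝ} (hab : a < b) {f : ℝ → ℝ} (hf : IntegrableOn f (Ioo a b))
    (hfR : ∀ x ∈ Ioo a b, |f x| ≤ R) : ‖toWm11 a b f‖ ≤ R * (b - a) := by
  rw [toWm11_eq]
  refine (norm_wm11Incl_le _).trans ?_
  rw [norm_toL1Ioo hf]
  refine (setIntegral_mono_on hf.norm (integrableOn_const (C := R) (by simp)) measurableSet_Ioo
    hfR).trans (le_of_eq ?_)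
  rw [setIntegral_const, Real.volume_real_Ioo_of_le hab.le, smul_eq_mul, mul_comm]

end


theorem proposition2 (a b n : ℝ) (hab : a < b) (hn0 : 0 < n) (hn3 : n < 3)
    (uin uin' : ℝ → ℝ) (huin : ContinuousOn uin (Icc a b)) (huin0 : ∀ x ∈ Icc a b, 0 ≤ uin x)
    (huin' : HasWeakDerivOn (Ioo a b) uin uin')
    (huin'2 : MemLp uin' 2 (volume.restrict (Ioo a b)))
    (ε₀ : ℝ) (hε₀ : ε₀ < 1) (u : ℝ → ℝ → ℝ → ℝ)
    (hu : ∀ ε ∈ Ioc 0 ε₀, IsThinFilmSolution a b n ε uin uin' (u ε)) :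
    ∀ T : ℝ, 0 < T →
      (∃ C : ℝ≥0, ∀ ε ∈ Ioc 0 ε₀,
        AEStronglyMeasurable (fun z : ℝ × ℝ => rhoEps n ε (u ε) z.1 z.2)
          (volume.restrict (Ioo 0 T ×ˢ Ioo a b)) ∧
        eLpNorm (fun z : ℝ × ℝ => rhoEps n ε (u ε) z.1 z.2) ⊤
          (volume.restrict (Ioo 0 T ×ˢ Ioo a b)) ≤ C) ∧
      (∃ C : ℝ, ∀ ε ∈ Ioc 0 ε₀, ∃ g : ℝ → Wm11 a b,
        HasWeakDerivOn (Ioo 0 T) (fun t => toWm11 a b (rhoEps n ε (u ε) t)) g ∧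
        IntegrableOn g (Ioo 0 T) ∧ ∫ t in Ioo 0 T, ‖g t‖ ≤ C) ∧
      (∀ (p : ℝ≥0∞) [Fact (1 ≤ p)], p ≠ ⊤ →
        ∃ hmem : ∀ ε : Ioc 0 ε₀,
          MemLp (fun t => toWm11 a b (rhoEps n ε (u ε) t)) p (volume.restrict (Ioo 0 T)),
        IsCompact (closure (range fun ε : Ioc 0 ε₀ => (hmem ε).toLp))) := by
  intro T hT
  obtain ⟨R, C, hR0, hC0, h⟩ := exists_uniform_bounds hab hn0 hn3 huin0 huin'2 hε₀ hu hT
  refine ⟨⟨R.toNNReal, fun ε hε => ⟨(h ε hε).1, ?_⟩⟩, ⟨C, fun ε hε => (h ε hε).2.2⟩,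
    fun p hp1 hp => ?_⟩
  · rw [eLpNorm_exponent_top]
    refine eLpNormEssSup_le_of_ae_bound (C := R) ?_
    filter_upwards [IsThinFilmSolutionWith.ae_mem_spaceTime a b T] with z hz
    exact ((h ε hε).2.1 z.1 hz.1.1).2 z.2 hz.2
  have hmem (ε : Ioc 0 ε₀) :
      MemLp (fun t => toWm11 a b (rhoEps n ε (u ε) t)) p (volume.restrict (Ioo 0 T)) := by
    obtain ⟨-, hb, g, hg, -⟩ := h ε ε.2
    refine MemLp.of_bound hg.1.aestronglyMeasurable (R * (b - a)) ?_
    filter_upwards [ae_restrict_mem measurableSet_Ioo] with t ht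
    exact norm_toWm11_le hab (hb t ht.1).1 (hb t ht.1).2
  -- W^{-1,1} is a quotient of a complete space by a closed subspace, so L^p with values in it is
  -- complete and total boundedness gives a compact closure.
  refine ⟨hmem, (TotallyBounded.closure ?_).isCompact_of_isClosed isClosed_closure⟩
  refine totallyBounded_of_variation_le hT (totallyBounded_toWm11 hab hR0) hC0 hp ?_
  rintro _ ⟨ε, rfl⟩
  obtain ⟨-, hb, g, hg, hgi, hgC⟩ := h ε ε.2
  refine ⟨g, hgi.1, ?_, ?_⟩
  · rw [← ofReal_integral_norm_eq_lintegral_enorm hgi]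
    exact ENNReal.ofReal_le_ofReal hgC
  · obtain ⟨N, hN, hNg⟩ := hg.exists_sub_eq_integral isOpen_Ioo
    have hae := (ae_restrict_iff' measurableSet_Ioo).1 (hmem ε).coeFn_toLp
    -- On this full-measure set the L^p representative agrees with ρ^ε(t), and its increments are
    -- integrals of the weak time derivative.
    refine ⟨{t | t ∈ N ∧ (t ∈ Ioo 0 T → ((hmem ε).toLp _) t = toWm11 a b (rhoEps n ε (u ε) t))},
      hN.and hae, fun t ht htI => ?_, fun s hs t ht hst hsub => ?_⟩
    · rw [ht.2 htI]
      exact ⟨_, (hb t htI.1).1, (hb t htI.1).2, rfl⟩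
    · rw [ht.2 (hsub (right_mem_Icc.2 hst)), hs.2 (hsub (left_mem_Icc.2 hst))]
      exact hNg s hs.1 t ht.1 hst hsub
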